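/- Let $n\ge 1$, $m=n-1$, $\chi=8(n+2)$. Let $\mathrm u$ be an imaginary quaternion variable ($\bar{\mathrm u}=-\mathrm u$) and $\mathbf u\in\mathbb H^{m}$ a quaternionic row vector variable, and let $D_x$ be the total $x$-derivative on differential polynomials (without explicit $x$) in the real components of $(\mathrm u,\mathbf u)$. Write $\langle\mathbf a,\mathbf b\rangle=\mathbf a\bar{\mathbf b}^{\rm t}$; $C(\mathrm a,\mathrm b)=\mathrm a\mathrm b-\mathrm b\mathrm a$ and $A(\mathrm a,\mathrm b)=\mathrm a\mathrm b+\mathrm b\mathrm a$ for scalars; $C(\mathbf a,\mathbf b)=\langle\mathbf a,\mathbf b\rangle-\langle\mathbf b,\mathbf a\rangle$, $A(\mathbf a,\mathbf b)=\langle\mathbf a,\mathbf b\rangle+\langle\mathbf b,\mathbf a\rangle$ and $\mathbf C(\mathbf a,\mathbf b)=\bar{\mathbf a}^{\rm t}\mathbf b-\bar{\mathbf b}^{\rm t}\mathbf a$ for vectors. Define, on pairs of an imaginary scalar and a vector, $$\mathcal H\begin{pmatrix}\mathrm w\\ \mathbf w\end{pmatrix}=\begin{pmatrix}D_x\mathrm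 w+C(\mathrm u,\mathrm p)+\tfrac12C(\mathbf u,\mathbf w)\\ D_x\mathbf w-\mathrm p\,\mathbf u+\mathbf u\mathbf P+\mathrm w\mathbf u-\mathrm u\mathbf w\end{pmatrix},\quad \mathrm p=-D_x^{-1}\big(C(\mathrm u,\mathrm w)-\tfrac12C(\mathbf u,\mathbf w)\big),\quad \mathbf P=D_x^{-1}\mathbf C(\mathbf u,\mathbf w),$$ $$\mathcal J\begin{pmatrix}\mathrm h\\ \mathbf h\end{pmatrix}=\begin{pmatrix}\tfrac14D_x\mathrm h+\tfrac14C(\mathbf u,\mathbf h)+q\,\mathrm u\\ D_x\mathbf h+\tfrac12\mathrm h\mathbf u+\mathrm u\mathbf h+q\,\mathbf u\end{pmatrix},\quad q=-D_x^{-1}\big(\tfrac12A(\mathrm u,\mathrm h)-\tfrac12A(\mathbf u,\mathbf h)\big),$$ and $\mathcal R=\mathcal H\mathcal J$, $\mathcal E=\mathcal R\mathcal H$. Here $D_x^{-1}f$ denotes an antiderivative of $f$; on differential polynomials it is the antiderivative without constant term. For a density $H$ let $\delta H/\delta\mathrm u$ (imaginary) and $\delta H/\delta\bar{\mathbf u}$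 be determined, modulo total $x$-derivatives, by $\delta_{\mathrm h}H=\mathrm{Re}(\mathrm h\,\delta H/\delta\mathrm u)$ for imaginary $\mathrm h$ and $\delta_{\mathbf h}H=\mathrm{Re}\langle\mathbf h,\delta H/\delta\bar{\mathbf u}\rangle$. A linear operator $\mathcal P$ depending on $(\mathrm u,\mathbf u)$ is called Hamiltonian if, modulo total $x$-derivatives, it is skew-adjoint for the pairing $\mathrm{Re}(\langle\mathrm w_1,\mathrm w_2\rangle+\langle\mathbf w_1,\mathbf w_2\rangle)$ and satisfies the Jacobi identity $\mathrm{Re}\langle w_1,(\mathrm{pr}X_2\,\mathcal P)w_3\rangle+\text{cyclic}=0$, where $w_i$ are covectors not depending on $(\mathrm u,\mathbf u)$ and $X_i$ is the evolutionary vector field with components $\mathcal Pw_i$; for nonlocal operators this is required over all commutative differential $\mathbb R$-algebras and for all choices in them of the antiderivatives $D_x^{-1}$ that occur. Two operators are a compatible pair if each of them and each of their real linear combinations is Hamiltonian. Then: 1. $\mathcal H$ and $\mathcal E$ are a compatible pair of Hamiltonian operators. 2. The recursion $(\mathrm h_{(l)},\mathbf h_{(l)})=\mathcal R^l(\mathrm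 u_x,\mathbf u_x)$, $l=0,1,2,\dots$, is well defined on differential polynomials (every $D_x^{-1}$ that occurs is applied to a total derivative), and so is $H^{(l)}=\frac1{1+2l}D_x^{-1}\mathrm{Re}\big(\langle\mathrm u,\mathrm h_{(l)}\rangle+\langle\mathbf u,\mathbf h_{(l)}\rangle\big)$. For $l\ge1$ the flow $(\mathrm u,\mathbf u)_t=\mathcal H(\mathrm w,\mathbf w)+\chi^{-1}(\mathrm h,\mathbf h)$, $(\mathrm w,\mathbf w)=\mathcal J(\mathrm h,\mathbf h)$, with $(\mathrm h,\mathbf h)=(\mathrm h_{(l-1)},\mathbf h_{(l-1)})$ is the evolution equation $$\begin{pmatrix}\mathrm u_t\\ \mathbf u_t\end{pmatrix}=\begin{pmatrix}\mathrm h_{(l)}+\chi^{-1}\mathrm h_{(l-1)}\\ \mathbf h_{(l)}+\chi^{-1}\mathbf h_{(l-1)}\end{pmatrix}.\qquad(*_l)$$ These form a bi-Hamiltonian hierarchy: $$\begin{pmatrix}\mathrm h_{(l)}\\ \mathbf h_{(l)}\end{pmatrix}=\mathcal H\begin{pmatrix}-\delta H^{(l)}/\delta\mathrm u\\ \delta H^{(l)}/\delta\bar{\mathbf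 u}\end{pmatrix}\ (l\ge0),\qquad \begin{pmatrix}\mathrm h_{(l)}\\ \mathbf h_{(l)}\end{pmatrix}=\mathcal E\begin{pmatrix}-\delta H^{(l-1)}/\delta\mathrm u\\ \delta H^{(l-1)}/\delta\bar{\mathbf u}\end{pmatrix}\ (l\ge1).$$ 3. Each equation $(*_l)$, $l\ge1$, is invariant under the rigid ($x$- and $t$-independent) transformations $\mathrm u\mapsto a\mathrm ua^{-1}$, $\mathbf u\mapsto a\mathbf uA$ with $a\in\mathrm U(1,\mathbb H)$, $A\in\mathrm U(m,\mathbb H)$ (that is, $a\bar a=1$, $A\bar A^{\rm t}=I$): its right-hand side is equivariant, and on every open set of the $(t,x)$-plane a smooth pair $(\mathrm u,\mathbf u)$ is a solution if and only if its transform is. 4. For $l=1$ the hierarchy gives the quaternionic scalar-vector mKdV system: with $|\mathbf u|^2=\langle\mathbf u,\mathbf u\rangle$, $$\mathrm h_{(1)}=\tfrac14\mathrm u_{xxx}-\tfrac32\mathrm u^2\mathrm u_x+\tfrac34C(\mathrm u,C(\mathbf u,\mathbf u_x))+\tfrac34C(\mathbf u,\mathbf u_{xx}),$$ $$\mathbf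 h_{(1)}=\mathbf u_{xxx}+\tfrac32(|\mathbf u|^2-\mathrm u^2+\mathrm u_x)\mathbf u_x+\tfrac34\big(2\mathrm u|\mathbf u|^2-A(\mathrm u,\mathrm u_x)+\mathrm u_{xx}-C(\mathbf u,\mathbf u_x)\big)\mathbf u,$$ and the Hamiltonians are $H^{(0)}=-\tfrac12\mathrm u^2+\tfrac12|\mathbf u|^2$ and, modulo a total $x$-derivative, $H^{(1)}=\tfrac18\mathrm u_x^2-\tfrac12|\mathbf u_x|^2-\tfrac18A(\mathrm u,C(\mathbf u,\mathbf u_x))+\tfrac18(\mathrm u^2-|\mathbf u|^2)^2$; with these expressions, $(\mathrm h_{(1)},\mathbf h_{(1)})=\mathcal H(-\delta H^{(1)}/\delta\mathrm u,\delta H^{(1)}/\delta\bar{\mathbf u})=\mathcal E(-\delta H^{(0)}/\delta\mathrm u,\delta H^{(0)}/\delta\bar{\mathbf u})$. -/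

import Mathlib

open scoped Quaternion Matrix

noncomputable section

namespace HPnFlow

/-! ## Scalar-vector pairs of quaternions over a differential algebra

`B` is a commutative real algebra with a derivation `D` (the total `x`-derivative).  A field is a
pair of a quaternion scalar (required to be imaginary where that matters) and a quaternionic row
vector with `m` entries. -/

/-- Pairs of a quaternion and a quaternionic row vector of length `m`, with coefficients in `B`. -/
abbrev Pair (B : Type) [CommRing B] (m : ℕ) : Type := ℍ[B] × (Fin m → ℍ[B])

section Algebra

variable {B : Type} [CommRing B] {m : ℕ}

/-- The Hermitian product `⟨x, y⟩ = x ȳᵗ` of quaternionic row vectors. -/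
def herm (x y : Fin m → ℍ[B]) : ℍ[B] := ∑ r, x r * star (y r)

/-- The commutator `C(a, b) = a b - b a` of scalars. -/
def comS (a b : ℍ[B]) : ℍ[B] := a * b - b * a

/-- The anticommutator `A(a, b) = a b + b a` of scalars. -/
def antiS (a b : ℍ[B]) : ℍ[B] := a * b + b * a

/-- The commutator `C(x, y) = ⟨x, y⟩ - ⟨y, x⟩` of vectors. -/
def comV (x y : Fin m → ℍ[B]) : ℍ[B] := herm x y - herm y x

/-- The anticommutator `A(x, y) = ⟨x, y⟩ + ⟨y, x⟩` of vectors. -/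
def antiV (x y : Fin m → ℍ[B]) : ℍ[B] := herm x y + herm y x

/-- The matrix commutator `x̄ᵗ y - ȳᵗ x` of row vectors, a skew-Hermitian matrix. -/
def comM (x y : Fin m → ℍ[B]) : Matrix (Fin m) (Fin m) ℍ[B] :=
  Matrix.of fun r s => star (x r) * y s - star (y r) * x s

/-- The real pairing `Re (⟨f₁, g₁⟩ + ⟨f₂, g₂⟩)` of pairs. -/
def rePair (f g : Pair B m) : B := (f.1 * star g.1 + herm f.2 g.2).re

variable [Algebra ℝ B]

/-- A derivation acting on quaternions by components. -/
def dQ (D : Derivation ℝ B B) (q : ℍ[B]) : ℍ[B] := ⟨D q.re, D q.imI, D q.imJ, D q.imK⟩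

/-- A derivation acting on pairs by components. -/
def dPair (D : Derivation ℝ B B) (f : Pair B m) : Pair B m := (dQ D f.1, fun r => dQ D (f.2 r))

/-- All components of a quaternion lie in `N`. -/
def QIn (N : Submodule ℝ B) (q : ℍ[B]) : Prop := q.re ∈ N ∧ q.imI ∈ N ∧ q.imJ ∈ N ∧ q.imK ∈ N

/-! ## The operators

The operators contain the formal inverse `D⁻¹`, so they are given as relations: `IsH D N u w y`
says that `y = 𝓗 w` at the field `u`, where each `D⁻¹ f` occurring in `𝓗 w` stands for an element
`g` with `D g = f` that belongs to the space `N` of admissible antiderivatives.  On differential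
polynomials `N` will be the polynomials without constant term, which makes `D⁻¹` single-valued. -/

/-- `y = 𝓗 w`, where `𝓗` is the operator matrix
`[D - C_u D⁻¹ C_u, C_𝐮 + C_u D⁻¹ C_𝐮; R_𝐮 D⁻¹ C_u + R_𝐮, D - R_𝐮 D⁻¹ C_𝐮 + L_𝐮 D⁻¹ 𝐂_𝐮 - L_u]`
(with `C_𝐮 v = ½ C(𝐮, v)`): here `p = -D⁻¹ (C_u w - C_𝐮 𝐰)` and `P = D⁻¹ 𝐂_𝐮 𝐰`. -/
def IsH (D : Derivation ℝ B B) (N : Submodule ℝ B) (u w y : Pair B m) : Prop :=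
  w.1.re = 0 ∧
  ∃ (p : ℍ[B]) (P : Matrix (Fin m) (Fin m) ℍ[B]),
    p.re = 0 ∧ QIn N p ∧
    dQ D p = -(comS u.1 w.1 - (1 / 2 : ℝ) • comV u.2 w.2) ∧
    Pᴴ = -P ∧ (∀ r s, QIn N (P r s)) ∧
    (∀ r s, dQ D (P r s) = comM u.2 w.2 r s) ∧
    y.1 = dQ D w.1 + comS u.1 p + (1 / 2 : ℝ) • comV u.2 w.2 ∧
    ∀ r, y.2 r = dQ D (w.2 r) - p * u.2 r + ∑ s, u.2 s * P s r + w.1 * u.2 r - u.1 * w.2 r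

/-- `w = 𝓙 h`, where `𝓙` is the operator matrix
`[¼ D - ¼ A_u D⁻¹ A_u, ½ C_𝐮 + ½ A_u D⁻¹ A_𝐮; ½ R_𝐮 - ½ R_𝐮 D⁻¹ A_u, D + L_u + R_𝐮 D⁻¹ A_𝐮]`
(with `A_u v = A(u, v)`, `A_𝐮 v = ½ A(𝐮, v)`): here `q = -D⁻¹ (½ A(u, h) - ½ A(𝐮, 𝐡))`, whose
argument is real. -/
def IsJ (D : Derivation ℝ B B) (N : Submodule ℝ B) (u h w : Pair B m) : Prop :=
  h.1.re = 0 ∧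
  ∃ q ∈ N,
    D q = -((1 / 2 : ℝ) • antiS u.1 h.1 - (1 / 2 : ℝ) • antiV u.2 h.2).re ∧
    w.1 = (1 / 4 : ℝ) • dQ D h.1 + (1 / 4 : ℝ) • comV u.2 h.2 + q • u.1 ∧
    ∀ r, w.2 r = dQ D (h.2 r) + (1 / 2 : ℝ) • (h.1 * u.2 r) + u.1 * h.2 r + q • u.2 r

/-- `y = 𝓡 h` for the recursion operator `𝓡 = 𝓗 𝓙`. -/
def IsR (D : Derivation ℝ B B) (N : Submodule ℝ B) (u h y : Pair B m) : Prop :=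
  ∃ w, IsJ D N u h w ∧ IsH D N u w y

/-- `y = 𝓔 w` for `𝓔 = 𝓡 𝓗`. -/
def IsE (D : Derivation ℝ B B) (N : Submodule ℝ B) (u w y : Pair B m) : Prop :=
  ∃ h, IsH D N u w h ∧ IsR D N u h y

end Algebra

/-! ## Hamiltonian operators -/

/-- A (possibly nonlocal) linear operator depending on a field, given over every differential
algebra as a relation between argument and value, as for `IsH`. -/
abbrev OpFamily (m : ℕ) : Type 1 :=
  ∀ (B : Type) [CommRing B] [Algebra ℝ B],
    Derivation ℝ B B → Submodule ℝ B → Pair B m → Pair B m → Pair B m → Prop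

/-- The operator `𝓗`. -/
def opH (m : ℕ) : OpFamily m := fun _ _ _ D N u w y => IsH D N u w y

/-- The operator `𝓔`. -/
def opE (m : ℕ) : OpFamily m := fun _ _ _ D N u w y => IsE D N u w y

/-- The linear combination `c₁ P + c₂ Q` of operators. -/
def opComb {m : ℕ} (c₁ : ℝ) (P : OpFamily m) (c₂ : ℝ) (Q : OpFamily m) : OpFamily m :=
  fun B _ _ D N u w y => ∃ y₁ y₂, P B D N u w y₁ ∧ Q B D N u w y₂ ∧ y = c₁ • y₁ + c₂ • y₂

/-- `P` is a Hamiltonian (cosymplectic) operator: modulo total derivatives it is skew-adjoint,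
`Re ⟨w₁, P w₂⟩ = -Re ⟨w₂, P w₁⟩`, and it satisfies the Jacobi identity
`Re ⟨w₁, (pr X₂ P) w₃⟩ + cyclic = 0` with `X_i` the evolutionary vector field of `P w_i`.
The differential algebra `B` is arbitrary, so that it can contain the antiderivatives that occur.
The vector field `X_i` is a derivation of `B` that commutes with `D` and takes `u` to `P w_i`; the
covectors `w_i` do not depend on `u`, so `(pr X_i P) w_j = X_i (P w_j)`. -/
def IsHamiltonian {m : ℕ} (P : OpFamily m) : Prop :=
  ∀ (B : Type) [CommRing B] [Algebra ℝ B] (D : Derivation ℝ B B) (u : Pair B m), u.1.re = 0 →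
    (∀ w₁ w₂ y₁ y₂ : Pair B m, P B D ⊤ u w₁ y₁ → P B D ⊤ u w₂ y₂ →
      ∃ g : B, D g = rePair w₁ y₂ + rePair w₂ y₁) ∧
    (∀ (w y : Fin 3 → Pair B m) (X : Fin 3 → Derivation ℝ B B),
      (∀ i, P B D ⊤ u (w i) (y i)) →
      (∀ i b, X i (D b) = D (X i b)) →
      (∀ i, dPair (X i) u = y i) →
      (∀ i j, dPair (X i) (w j) = 0) →
      ∃ g : B, D g = rePair (w 0) (dPair (X 1) (y 2)) + rePair (w 1) (dPair (X 2) (y 0))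
        + rePair (w 2) (dPair (X 0) (y 1)))

/-- `P` and `Q` are compatible Hamiltonian operators. -/
def IsHamiltonianPair {m : ℕ} (P Q : OpFamily m) : Prop :=
  IsHamiltonian P ∧ IsHamiltonian Q ∧ ∀ c₁ c₂ : ℝ, IsHamiltonian (opComb c₁ P c₂ Q)

/-! ## Differential polynomials in the components of `(u, 𝐮)` -/

/-- Indices of the real components: the three of `u` and the four of each entry of `𝐮`. -/
abbrev Comp (m : ℕ) : Type := Fin 3 ⊕ Fin m × Fin 4

/-- Real differential polynomials: the variable `(v, k)` is the `k`-th `x`-derivative of `v`. -/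
abbrev Jet (m : ℕ) : Type := MvPolynomial (Comp m × ℕ) ℝ

/-- The total `x`-derivative. -/
def Dx (m : ℕ) : Derivation ℝ (Jet m) (Jet m) :=
  MvPolynomial.mkDerivation ℝ fun a => MvPolynomial.X (a.1, a.2 + 1)

/-- Differential polynomials without constant term. -/
def noConst (m : ℕ) : Submodule ℝ (Jet m) := LinearMap.ker (MvPolynomial.lcoeff ℝ 0)

/-- The variables `(u, 𝐮)` with `u` imaginary. -/
def uJet (m : ℕ) : Pair (Jet m) m :=
  (⟨0, MvPolynomial.X (Sum.inl 0, 0), MvPolynomial.X (Sum.inl 1, 0),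
      MvPolynomial.X (Sum.inl 2, 0)⟩,
    fun r => ⟨MvPolynomial.X (Sum.inr (r, 0), 0), MvPolynomial.X (Sum.inr (r, 1), 0),
      MvPolynomial.X (Sum.inr (r, 2), 0), MvPolynomial.X (Sum.inr (r, 3), 0)⟩)

/-- The Euler operator `∑ₖ (-D)ᵏ ∂/∂v₍ₖ₎` (only finitely many terms are nonzero). -/
def euler {m : ℕ} (v : Comp m) (f : Jet m) : Jet m :=
  ∑ᶠ k : ℕ, (-1 : ℝ) ^ k • (Dx m)^[k] (MvPolynomial.pderiv (v, k) f)

theorem euler_support_finite {m : ℕ} (v : Comp m) (f : Jet m) :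
    (Function.support fun k : ℕ =>
      (-1 : ℝ) ^ k • (Dx m)^[k] (MvPolynomial.pderiv (v, k) f)).Finite := by
  classical
  refine (f.vars.image Prod.snd).finite_toSet.subset fun k hk => ?_
  by_contra hn
  have hv : (v, k) ∉ f.vars := fun h =>
    hn (Finset.mem_coe.2 (Finset.mem_image.2 ⟨(v, k), h, rfl⟩))
  refine hk ?_
  have h0 : ∀ k : ℕ, (Dx m)^[k] (0 : Jet m) = 0 := fun k =>
    Function.iterate_fixed (map_zero (Dx m)) k
  simp [MvPolynomial.pderiv_eq_zero_of_notMem_vars hv, h0]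

/-- `δH/δu`, determined by `δ_h H = ∫ Re (h δH/δu) dx` for imaginary `h`. -/
def deltaU {m : ℕ} (f : Jet m) : ℍ[Jet m] :=
  -⟨0, euler (Sum.inl 0) f, euler (Sum.inl 1) f, euler (Sum.inl 2) f⟩

/-- `δH/δ𝐮̄`, determined by `δ_𝐡 H = Re ∫ ⟨𝐡, δH/δ𝐮̄⟩ dx` for all `𝐡`. -/
def deltaUbar {m : ℕ} (f : Jet m) : Fin m → ℍ[Jet m] := fun r =>
  ⟨euler (Sum.inr (r, 0)) f, euler (Sum.inr (r, 1)) f, euler (Sum.inr (r, 2)) f,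
    euler (Sum.inr (r, 3)) f⟩

/-- The covector `(-δH/δu, δH/δ𝐮̄)`. -/
def covec {m : ℕ} (f : Jet m) : Pair (Jet m) m := (-deltaU f, deltaUbar f)

/-- `y = 𝓗 w` on differential polynomials. -/
abbrev JetH {m : ℕ} (w y : Pair (Jet m) m) : Prop := IsH (Dx m) (noConst m) (uJet m) w y

/-- `w = 𝓙 h` on differential polynomials. -/
abbrev JetJ {m : ℕ} (h w : Pair (Jet m) m) : Prop := IsJ (Dx m) (noConst m) (uJet m) h w

/-- `y = 𝓡 h` on differential polynomials. -/
abbrev JetR {m : ℕ} (h y : Pair (Jet m) m) : Prop := IsR (Dx m) (noConst m) (uJet m) h y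

/-- `y = 𝓔 w` on differential polynomials. -/
abbrev JetE {m : ℕ} (w y : Pair (Jet m) m) : Prop := IsE (Dx m) (noConst m) (uJet m) w y

/-- `h l = 𝓡ˡ (u_x, 𝐮_x)` for all `l`. -/
def IsHierarchy {m : ℕ} (h : ℕ → Pair (Jet m) m) : Prop :=
  h 0 = dPair (Dx m) (uJet m) ∧ ∀ l, JetR (h l) (h (l + 1))

/-- `f = (1 + 2 l)⁻¹ D⁻¹ Re (⟨u, h⟩ + ⟨𝐮, 𝐡⟩)`. -/
def IsHamDensity {m : ℕ} (l : ℕ) (h : Pair (Jet m) m) (f : Jet m) : Prop :=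
  ∃ g ∈ noConst m, Dx m g = rePair (uJet m) h ∧ f = (1 / (1 + 2 * (l : ℝ))) • g

/-- The constant `χ = 8 (n + 2)`. -/
def chi (n : ℕ) : ℝ := 8 * ((n : ℝ) + 2)

/-- `F = 𝓗 𝐰 + χ⁻¹ h` with `𝐰 = 𝓙 h`: the right-hand side of the flow determined by `h`. -/
def IsFlow {m : ℕ} (χ : ℝ) (h F : Pair (Jet m) m) : Prop :=
  ∃ w y, JetJ h w ∧ JetH w y ∧ F = y + χ⁻¹ • h

/-! ## Evolution equations and the group action -/

/-- The real component of a pair with a given index. -/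
def coord {m : ℕ} (f : Pair ℝ m) : Comp m → ℝ
  | Sum.inl i => ![f.1.imI, f.1.imJ, f.1.imK] i
  | Sum.inr (r, i) => ![(f.2 r).re, (f.2 r).imI, (f.2 r).imJ, (f.2 r).imK] i

/-- The value of a differential polynomial when the `k`-th derivative of `(u, 𝐮)` is `j k`. -/
def evalJet {m : ℕ} (j : ℕ → Pair ℝ m) (f : Jet m) : ℝ :=
  MvPolynomial.eval (fun a => coord (j a.2) a.1) f

/-- Evaluation of a quaternion of differential polynomials. -/
def evalQ {m : ℕ} (j : ℕ → Pair ℝ m) (q : ℍ[Jet m]) : ℍ[ℝ] :=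
  ⟨evalJet j q.re, evalJet j q.imI, evalJet j q.imJ, evalJet j q.imK⟩

/-- Evaluation of a pair of differential polynomials. -/
def evalPair {m : ℕ} (j : ℕ → Pair ℝ m) (F : Pair (Jet m) m) : Pair ℝ m :=
  (evalQ j F.1, fun r => evalQ j (F.2 r))

/-- `(u, 𝐮)(t, x)` is a smooth solution on `Ω` of the evolution equation `(u, 𝐮)_t = F`, with `u`
imaginary. -/
def IsSolution {m : ℕ} (F : Pair (Jet m) m) (Ω : Set (ℝ × ℝ)) (u : ℝ → ℝ → Pair ℝ m) : Prop :=
  ContDiffOn ℝ ((⊤ : ℕ∞) : WithTop ℕ∞) (fun p : ℝ × ℝ => u p.1 p.2) Ω ∧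
  ∀ t x : ℝ, (t, x) ∈ Ω → (u t x).1.re = 0 ∧
    deriv (fun s => u s x) t = evalPair (fun k => iteratedDeriv k (fun y => u t y) x) F

/-- The transformation `u ↦ a u a⁻¹`, `𝐮 ↦ a 𝐮 A`. -/
def act {m : ℕ} (a : ℍ[ℝ]) (A : Matrix (Fin m) (Fin m) ℍ[ℝ]) (f : Pair ℝ m) : Pair ℝ m :=
  (a * f.1 * a⁻¹, (fun r => a * f.2 r) ᵥ* A)

/-- The evolution equation `(u, 𝐮)_t = F` is invariant under the rigid action of
`U(1, ℍ) × U(m, ℍ)`: its right-hand side is equivariant, and the action maps the solutions on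
every open set onto the solutions. -/
def IsInvariantFlow {m : ℕ} (F : Pair (Jet m) m) : Prop :=
  ∀ a ∈ unitary ℍ[ℝ], ∀ A ∈ unitary (Matrix (Fin m) (Fin m) ℍ[ℝ]),
    (∀ j : ℕ → Pair ℝ m, (∀ k, (j k).1.re = 0) →
      evalPair (fun k => act a A (j k)) F = act a A (evalPair j F)) ∧
    (∀ (Ω : Set (ℝ × ℝ)) (u : ℝ → ℝ → Pair ℝ m), IsOpen Ω →
      (IsSolution F Ω (fun t x => act a A (u t x)) ↔ IsSolution F Ω u))

/-! ## The quaternionic scalar-vector mKdV system -/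

/-- The right-hand side of the scalar-vector mKdV system,
`¼ u_xxx - (3/2) u² u_x + ¾ C(u, C(𝐮, 𝐮_x)) + ¾ C(𝐮, 𝐮_xx)` and
`𝐮_xxx + (3/2) (|𝐮|² - u² + u_x) 𝐮_x + ¾ (2 u |𝐮|² - A(u, u_x) + u_xx - C(𝐮, 𝐮_x)) 𝐮`. -/
def mkdvRHS (m : ℕ) : Pair (Jet m) m :=
  let U := uJet m
  let U₁ := dPair (Dx m) U
  let U₂ := dPair (Dx m) U₁
  let U₃ := dPair (Dx m) U₂
  ((1 / 4 : ℝ) • U₃.1 - (3 / 2 : ℝ) • (U.1 ^ 2 * U₁.1)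
      + (3 / 4 : ℝ) • comS U.1 (comV U.2 U₁.2) + (3 / 4 : ℝ) • comV U.2 U₂.2,
    fun r => U₃.2 r + (3 / 2 : ℝ) • ((herm U.2 U.2 - U.1 ^ 2 + U₁.1) * U₁.2 r)
      + (3 / 4 : ℝ) • (((2 : ℝ) • (U.1 * herm U.2 U.2) - antiS U.1 U₁.1 + U₂.1
          - comV U.2 U₁.2) * U.2 r))

/-- The density `-½ u² + ½ |𝐮|²` (a real quaternion). -/
def mkdvH0 (m : ℕ) : Jet m :=
  let U := uJet m
  (-(1 / 2 : ℝ) • U.1 ^ 2 + (1 / 2 : ℝ) • herm U.2 U.2).re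

/-- The density `⅛ u_x² - ½ |𝐮_x|² - ⅛ A(u, C(𝐮, 𝐮_x)) + ⅛ (u² - |𝐮|²)²` (a real quaternion). -/
def mkdvH1 (m : ℕ) : Jet m :=
  let U := uJet m
  let U₁ := dPair (Dx m) U
  ((1 / 8 : ℝ) • U₁.1 ^ 2 - (1 / 2 : ℝ) • herm U₁.2 U₁.2
    - (1 / 8 : ℝ) • antiS U.1 (comV U.2 U₁.2)
    + (1 / 8 : ℝ) • (U.1 ^ 2 - herm U.2 U.2) ^ 2).re

end HPnFlow

end

set_option linter.unusedSectionVars false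

noncomputable section

namespace HPnFlow

/-! ## The Jacobi identity in a ring with a trace modulo total derivatives -/

section AbstractJacobi

variable {A Q : Type*} [Ring A] [Algebra ℝ A] [AddCommGroup Q] [Module ℝ Q]

/-! Everything takes place among quaternionic matrices of size m + 2, graded into even and odd ones
by a signature matrix. The field is an even skew-Hermitian matrix u, e is a constant odd matrix with
e³ = e, and ∇ = D + ad u. The nonlocal variables are components along the centralizer of e. 𝓗 is ∇
applied to a matrix W whose centralizer part (p, P) makes ∇W transversal; 𝓙 takes V with [e, V] = h,
its centralizer part q being such that ∇V lies in the image of ad e, and reads off w from ∇V = [e,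
W]. So y = 𝓔 w becomes the chain ∇W = [e, V], ∇V = [e, Z], ∇Z = y (`IsE.nabla_eq`), in which no
antiderivative appears.

Hamiltonian pair: let τ be the real trace modulo total derivatives. It is cyclic and kills
derivatives, so ∇ is skew for τ(XY), and the invariant three-form τ(a[b, c]) is annihilated by ∇
summed over its slots (`trace_vol`). Varying a chain and integrating by parts leaves only terms τ(X
u · [·,·]), since the variation of a constant covector's matrix lies in the centralizer, which is
orthogonal to transversal matrices. The Jacobi sum is then a combination of `trace_vol` and of the
Jacobi identity of the commutator (`trace_lie_lie`); this is `jacobi_pencil`, valid for unrelated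
antiderivatives in 𝓗 and 𝓔.

Hierarchy: there is exactly one power series M = -e + M₁z + ⋯ with M³ = M that commutes with D + u -
e/z (`exists_isResolvent`, `IsResolvent.unique`). The equations ∇M_k = [e, M_{k+1}] are the chain
above continued forever, so odd coefficients carry covectors, even ones carry the flows together
with q, and every antiderivative is a matrix entry, hence a differential polynomial. Uniqueness
gives the rest of the structure: whatever maps resolvents to resolvents fixes M. This yields the
parity and Hermitian symmetry of M_k, the vanishing constant terms and the equivariance under
rotations.

Gradients: `IsResolvent.trace_variation` says k τ(δu M_k) = τ(δM_{k+1} e). For k = 2l + 1 the right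
side is the variation of q up to the factor -2, so q/(1 + 2l) has the covector of M_{2l+1} as its
gradient.

The mKdV formulas come from explicit antiderivatives for one step of the recursion, and from
uniqueness of antiderivatives without constant term. -/

/-- The covariant derivative `D + ad u`. -/
def nabla (D : A →ₗ[ℝ] A) (u x : A) : A := D x + (u * x - x * u)

theorem nabla_add (D : A →ₗ[ℝ] A) (u x y : A) :
    nabla D u (x + y) = nabla D u x + nabla D u y := by
  simp only [nabla, map_add]; noncomm_ring

theorem nabla_sub (D : A →ₗ[ℝ] A) (u x y : A) :
    nabla D u (x - y) = nabla D u x - nabla D u y := by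
  simp only [nabla, map_sub]; noncomm_ring

theorem nabla_mul {D : A →ₗ[ℝ] A} (hD : ∀ a b, D (a * b) = D a * b + a * D b) (u x y : A) :
    nabla D u (x * y) = nabla D u x * y + x * nabla D u y := by
  simp only [nabla, hD]; noncomm_ring

/-- By cyclicity τ([e, a][b, c]) = τ(e [a, [b, c]]), so this is the Jacobi identity of the
commutator. -/
theorem trace_lie_lie {τ : A →ₗ[ℝ] Q} (hτ : ∀ a b, τ (a * b) = τ (b * a)) (e a b c : A) :
    τ ((e * a - a * e) * (b * c - c * b)) + τ ((e * b - b * e) * (c * a - a * c))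
      + τ ((e * c - c * e) * (a * b - b * a)) = 0 := by
  have k : ∀ x y, τ (x * (e * y)) = τ (e * (y * x)) := fun x y => by
    rw [hτ x, mul_assoc]
  simp only [mul_sub, sub_mul, map_sub, mul_assoc, k]
  abel

theorem trace_nabla {D : A →ₗ[ℝ] A} {τ : A →ₗ[ℝ] Q} (hτ : ∀ a b, τ (a * b) = τ (b * a))
    (hτD : ∀ a, τ (D a) = 0) (u x : A) : τ (nabla D u x) = 0 := by
  rw [nabla, map_add, map_sub, hτD, hτ u x, sub_self, add_zero]

theorem trace_nabla_mul {D : A →ₗ[ℝ] A} (hD : ∀ a b, D (a * b) = D a * b + a * D b)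
    {τ : A →ₗ[ℝ] Q} (hτ : ∀ a b, τ (a * b) = τ (b * a))
    (hτD : ∀ a, τ (D a) = 0) (u x y : A) :
    τ (nabla D u x * y) = -τ (x * nabla D u y) := by
  rw [eq_neg_iff_add_eq_zero, ← map_add, ← nabla_mul hD, trace_nabla hτ hτD]

/-- ∇ is a derivation, so the sum is τ(∇(a[b, c])) rearranged cyclically, and τ annihilates ∇. -/
theorem trace_vol {D : A →ₗ[ℝ] A} (hD : ∀ a b, D (a * b) = D a * b + a * D b)
    {τ : A →ₗ[ℝ] Q} (hτ : ∀ a b, τ (a * b) = τ (b * a))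
    (hτD : ∀ a, τ (D a) = 0) (u a b c : A) :
    τ (nabla D u a * (b * c - c * b)) + τ (nabla D u b * (c * a - a * c))
      + τ (nabla D u c * (a * b - b * a)) = 0 := by
  have h := trace_nabla hτ hτD u (a * (b * c - c * b))
  rw [nabla_mul hD, nabla_sub, nabla_mul hD, nabla_mul hD] at h
  rw [← h]
  have k1 : τ (a * (nabla D u b * c)) = τ (nabla D u b * (c * a)) := by rw [hτ, mul_assoc]
  have k2 : τ (a * (b * nabla D u c)) = τ (nabla D u c * (a * b)) := by rw [← mul_assoc, hτ]
  have k3 : τ (a * (c * nabla D u b)) = τ (nabla D u b * (a * c)) := by rw [← mul_assoc, hτ]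
  have k4 : τ (a * (nabla D u c * b)) = τ (nabla D u c * (b * a)) := by rw [hτ, mul_assoc]
  simp only [mul_sub, mul_add, map_sub, map_add, k1, k2, k3, k4]
  abel

theorem trace_lie_mul {τ : A →ₗ[ℝ] Q} (hτ : ∀ a b, τ (a * b) = τ (b * a)) (x y z : A) :
    τ ((x * y - y * x) * z) = -τ (y * (x * z - z * x)) := by
  simp only [mul_sub, sub_mul, map_sub, mul_assoc]
  rw [hτ x, mul_assoc]; abel

theorem trace_mul_lie {τ : A →ₗ[ℝ] Q} (hτ : ∀ a b, τ (a * b) = τ (b * a)) (x y z : A) :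
    τ (x * (y * z - z * y)) = τ (y * (z * x - x * z)) := by
  simp only [mul_sub, map_sub]
  rw [hτ x, mul_assoc, ← mul_assoc x z y, hτ (x * z) y]

/-- Variation of `⟨K₁, ∇ K₃⟩` when `∇ K₁` is orthogonal to the variation of `K₃`. -/
theorem variation_first {D X : A →ₗ[ℝ] A} (hD : ∀ a b, D (a * b) = D a * b + a * D b)
    (hX : ∀ a b, X (a * b) = X a * b + a * X b) (hXD : ∀ a, X (D a) = D (X a))
    {τ : A →ₗ[ℝ] Q} (hτ : ∀ a b, τ (a * b) = τ (b * a)) (hτD : ∀ a, τ (D a) = 0)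
    (u K₁ K₃ : A) :
    τ (K₁ * X (nabla D u K₃)) =
      -τ (nabla D u K₁ * X K₃) + τ (X u * (K₃ * K₁ - K₁ * K₃)) := by
  have h : X (nabla D u K₃) = nabla D u (X K₃) + (X u * K₃ - K₃ * X u) := by
    simp only [nabla, map_add, map_sub, hX, hXD]; noncomm_ring
  rw [h, mul_add, map_add, trace_nabla_mul hD hτ hτD, neg_neg, trace_mul_lie hτ]

/-- The variation is moved down the chain: each `variation_first` contributes one X u term and
leaves a factor [e, ·]. Since X e = 0, ad e passes to the varied factor and turns it into the next ∇
of the third chain. -/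
theorem variation_second {D X : A →ₗ[ℝ] A} (hD : ∀ a b, D (a * b) = D a * b + a * D b)
    (hX : ∀ a b, X (a * b) = X a * b + a * X b) (hXD : ∀ a, X (D a) = D (X a))
    {τ : A →ₗ[ℝ] Q} (hτ : ∀ a b, τ (a * b) = τ (b * a)) (hτD : ∀ a, τ (D a) = 0)
    {e u W₁ V₁ Z₁ W₃ V₃ Z₃ : A} (he : X e = 0)
    (h₁ : nabla D u W₁ = e * V₁ - V₁ * e) (h₁' : nabla D u V₁ = e * Z₁ - Z₁ * e)
    (h₃ : nabla D u W₃ = e * V₃ - V₃ * e) (h₃' : nabla D u V₃ = e * Z₃ - Z₃ * e) :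
    τ (W₁ * X (nabla D u Z₃)) =
      -τ (nabla D u Z₁ * X W₃) + τ (X u * (Z₃ * W₁ - W₁ * Z₃))
        + τ (X u * (V₃ * V₁ - V₁ * V₃)) + τ (X u * (W₃ * Z₁ - Z₁ * W₃)) := by
  have k : ∀ a, X (e * a - a * e) = e * X a - X a * e := fun a => by
    simp [map_sub, hX, he]
  rw [variation_first hD hX hXD hτ hτD, h₁, trace_lie_mul hτ, ← k, ← h₃',
    variation_first hD hX hXD hτ hτD, h₁', trace_lie_mul hτ, ← k, ← h₃,
    variation_first hD hX hXD hτ hτD]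
  abel

/-- Give W, V, Z the weights 0, 1, 2. The sum has total weight 4 and holds only the terms with ∇ on
a Z. `trace_vol` for all triples of types ZZW and ZVV supplies the missing terms; there ∇W and ∇V
become commutators with e, and the triples V, Z, Z that remain cancel by `trace_lie_lie`. -/
theorem jacobi_second {D : A →ₗ[ℝ] A} (hD : ∀ a b, D (a * b) = D a * b + a * D b)
    {τ : A →ₗ[ℝ] Q} (hτ : ∀ a b, τ (a * b) = τ (b * a)) (hτD : ∀ a, τ (D a) = 0)
    {e u W₁ V₁ Z₁ W₂ V₂ Z₂ W₃ V₃ Z₃ : A}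
    (hW₁ : nabla D u W₁ = e * V₁ - V₁ * e) (hV₁ : nabla D u V₁ = e * Z₁ - Z₁ * e)
    (hW₂ : nabla D u W₂ = e * V₂ - V₂ * e) (hV₂ : nabla D u V₂ = e * Z₂ - Z₂ * e)
    (hW₃ : nabla D u W₃ = e * V₃ - V₃ * e) (hV₃ : nabla D u V₃ = e * Z₃ - Z₃ * e) :
    (τ (nabla D u Z₂ * (Z₃ * W₁ - W₁ * Z₃)) + τ (nabla D u Z₂ * (V₃ * V₁ - V₁ * V₃))
          + τ (nabla D u Z₂ * (W₃ * Z₁ - Z₁ * W₃)))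
        + (τ (nabla D u Z₃ * (Z₁ * W₂ - W₂ * Z₁)) + τ (nabla D u Z₃ * (V₁ * V₂ - V₂ * V₁))
          + τ (nabla D u Z₃ * (W₁ * Z₂ - Z₂ * W₁)))
        + (τ (nabla D u Z₁ * (Z₂ * W₃ - W₃ * Z₂)) + τ (nabla D u Z₁ * (V₂ * V₃ - V₃ * V₂))
          + τ (nabla D u Z₁ * (W₂ * Z₃ - Z₃ * W₂))) = 0 := by
  have v1 := trace_vol hD hτ hτD u Z₂ Z₃ W₁
  have v2 := trace_vol hD hτ hτD u Z₂ W₃ Z₁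
  have v3 := trace_vol hD hτ hτD u W₂ Z₃ Z₁
  have v4 := trace_vol hD hτ hτD u Z₂ V₃ V₁
  have v5 := trace_vol hD hτ hτD u V₂ Z₃ V₁
  have v6 := trace_vol hD hτ hτD u V₂ V₃ Z₁
  have e1 := trace_lie_lie hτ e V₂ Z₃ Z₁
  have e2 := trace_lie_lie hτ e V₃ Z₁ Z₂
  have e3 := trace_lie_lie hτ e V₁ Z₂ Z₃
  rw [hW₁] at v1
  rw [hW₃] at v2
  rw [hW₂] at v3
  rw [hV₃, hV₁] at v4
  rw [hV₂, hV₁] at v5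
  rw [hV₂, hV₃] at v6
  simp only [mul_sub, map_sub] at *
  linear_combination (norm := module) v1 + v2 + v3 + v4 + v5 + v6 - e1 - e2 - e3

/-- The element kᵢ is the discrepancy between the antiderivatives chosen in 𝓗 and in 𝓔. It commutes
with e but need not be constant. -/
theorem jacobi_mixed {D : A →ₗ[ℝ] A} (hD : ∀ a b, D (a * b) = D a * b + a * D b)
    {τ : A →ₗ[ℝ] Q} (hτ : ∀ a b, τ (a * b) = τ (b * a)) (hτD : ∀ a, τ (D a) = 0)
    {e u W₁ V₁ Z₁ W₂ V₂ Z₂ W₃ V₃ Z₃ k₁ k₂ k₃ : A}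
    (hW₁ : nabla D u W₁ = e * V₁ - V₁ * e) (hV₁ : nabla D u V₁ = e * Z₁ - Z₁ * e)
    (hW₂ : nabla D u W₂ = e * V₂ - V₂ * e) (hV₂ : nabla D u V₂ = e * Z₂ - Z₂ * e)
    (hW₃ : nabla D u W₃ = e * V₃ - V₃ * e) (hV₃ : nabla D u V₃ = e * Z₃ - Z₃ * e)
    (hc₁ : e * k₁ - k₁ * e = 0) (hc₂ : e * k₂ - k₂ * e = 0) (hc₃ : e * k₃ - k₃ * e = 0)
    (ho₁ : τ (nabla D u Z₁ * (k₂ * k₃ - k₃ * k₂)) = 0)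
    (ho₂ : τ (nabla D u Z₂ * (k₃ * k₁ - k₁ * k₃)) = 0)
    (ho₃ : τ (nabla D u Z₃ * (k₁ * k₂ - k₂ * k₁)) = 0) :
    (τ (nabla D u Z₂ * ((W₃ + k₃) * (W₁ + k₁) - (W₁ + k₁) * (W₃ + k₃)))
        + τ (nabla D u Z₃ * ((W₁ + k₁) * (W₂ + k₂) - (W₂ + k₂) * (W₁ + k₁)))
        + τ (nabla D u Z₁ * ((W₂ + k₂) * (W₃ + k₃) - (W₃ + k₃) * (W₂ + k₂))))
      + ((τ (nabla D u (W₂ + k₂) * (Z₃ * W₁ - W₁ * Z₃))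
          + τ (nabla D u (W₂ + k₂) * (V₃ * V₁ - V₁ * V₃))
          + τ (nabla D u (W₂ + k₂) * (W₃ * Z₁ - Z₁ * W₃)))
        + (τ (nabla D u (W₃ + k₃) * (Z₁ * W₂ - W₂ * Z₁))
          + τ (nabla D u (W₃ + k₃) * (V₁ * V₂ - V₂ * V₁))
          + τ (nabla D u (W₃ + k₃) * (W₁ * Z₂ - Z₂ * W₁)))
        + (τ (nabla D u (W₁ + k₁) * (Z₂ * W₃ - W₃ * Z₂))
          + τ (nabla D u (W₁ + k₁) * (V₂ * V₃ - V₃ * V₂))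
          + τ (nabla D u (W₁ + k₁) * (W₂ * Z₃ - Z₃ * W₂)))) = 0 := by
  have v1 := trace_vol hD hτ hτD u Z₂ (W₃ + k₃) (W₁ + k₁)
  have v2 := trace_vol hD hτ hτD u (W₂ + k₂) Z₃ (W₁ + k₁)
  have v3 := trace_vol hD hτ hτD u (W₂ + k₂) (W₃ + k₃) Z₁
  have v4 := trace_vol hD hτ hτD u k₂ V₃ V₁
  have v5 := trace_vol hD hτ hτD u k₃ V₁ V₂
  have v6 := trace_vol hD hτ hτD u k₁ V₂ V₃
  -- The terms quadratic in k have no counterpart on the 𝓔 side; these three identities remove them,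
  -- up to the terms assumed to vanish in `ho₁`, `ho₂`, `ho₃`.
  have v7 := trace_vol hD hτ hτD u k₂ k₃ Z₁
  have v8 := trace_vol hD hτ hτD u k₃ k₁ Z₂
  have v9 := trace_vol hD hτ hτD u k₁ k₂ Z₃
  have e0 := trace_lie_lie hτ e V₁ V₂ V₃
  have e1 := trace_lie_lie hτ e V₁ k₂ Z₃
  have e2 := trace_lie_lie hτ e V₂ k₃ Z₁
  have e3 := trace_lie_lie hτ e V₃ k₁ Z₂
  have e4 := trace_lie_lie hτ e V₁ Z₂ k₃
  have e5 := trace_lie_lie hτ e V₂ Z₃ k₁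
  have e6 := trace_lie_lie hτ e V₃ Z₁ k₂
  simp only [hc₁, hc₂, hc₃, zero_mul, map_zero] at e1 e2 e3 e4 e5 e6
  simp only [nabla_add, hW₁, hW₂, hW₃] at v1 v2 v3 ⊢
  rw [hV₃, hV₁] at v4
  rw [hV₂, hV₁] at v5
  rw [hV₂, hV₃] at v6
  clear hW₁ hW₂ hW₃ hV₁ hV₂ hV₃ hc₁ hc₂ hc₃
  simp only [mul_sub, map_sub, mul_add, map_add, add_mul] at *
  linear_combination (norm := module) v1 + v2 + v3 + v4 + v5 + v6 - v7 - v8 - v9 + e0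
    - e1 - e2 - e3 - e4 - e5 - e6 + ho₁ + ho₂ + ho₃

/-- The Jacobi identity for `c₁ 𝓗 + c₂ 𝓔`, with independent antiderivatives in `𝓗` and `𝓔`. -/
theorem jacobi_pencil {D : A →ₗ[ℝ] A} (hD : ∀ a b, D (a * b) = D a * b + a * D b)
    {τ : A →ₗ[ℝ] Q} (hτ : ∀ a b, τ (a * b) = τ (b * a)) (hτD : ∀ a, τ (D a) = 0)
    {e u K₁ W₁ V₁ Z₁ K₂ W₂ V₂ Z₂ K₃ W₃ V₃ Z₃ Y₁ Y₂ Y₃ : A} (c₁ c₂ : ℝ)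
    (hW₁ : nabla D u W₁ = e * V₁ - V₁ * e) (hV₁ : nabla D u V₁ = e * Z₁ - Z₁ * e)
    (hW₂ : nabla D u W₂ = e * V₂ - V₂ * e) (hV₂ : nabla D u V₂ = e * Z₂ - Z₂ * e)
    (hW₃ : nabla D u W₃ = e * V₃ - V₃ * e) (hV₃ : nabla D u V₃ = e * Z₃ - Z₃ * e)
    (hc₁ : e * (K₁ - W₁) - (K₁ - W₁) * e = 0) (hc₂ : e * (K₂ - W₂) - (K₂ - W₂) * e = 0)
    (hc₃ : e * (K₃ - W₃) - (K₃ - W₃) * e = 0)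
    (ho₁ : τ (nabla D u Z₁ * ((K₂ - W₂) * (K₃ - W₃) - (K₃ - W₃) * (K₂ - W₂))) = 0)
    (ho₂ : τ (nabla D u Z₂ * ((K₃ - W₃) * (K₁ - W₁) - (K₁ - W₁) * (K₃ - W₃))) = 0)
    (ho₃ : τ (nabla D u Z₃ * ((K₁ - W₁) * (K₂ - W₂) - (K₂ - W₂) * (K₁ - W₁))) = 0)
    (hY₁ : Y₁ = c₁ • nabla D u K₁ + c₂ • nabla D u Z₁)
    (hY₂ : Y₂ = c₁ • nabla D u K₂ + c₂ • nabla D u Z₂)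
    (hY₃ : Y₃ = c₁ • nabla D u K₃ + c₂ • nabla D u Z₃) :
    c₁ • (τ (Y₂ * (K₃ * K₁ - K₁ * K₃)) + τ (Y₃ * (K₁ * K₂ - K₂ * K₁))
        + τ (Y₁ * (K₂ * K₃ - K₃ * K₂)))
      + c₂ • ((τ (Y₂ * (Z₃ * W₁ - W₁ * Z₃)) + τ (Y₂ * (V₃ * V₁ - V₁ * V₃))
          + τ (Y₂ * (W₃ * Z₁ - Z₁ * W₃)))
        + (τ (Y₃ * (Z₁ * W₂ - W₂ * Z₁)) + τ (Y₃ * (V₁ * V₂ - V₂ * V₁))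
          + τ (Y₃ * (W₁ * Z₂ - Z₂ * W₁)))
        + (τ (Y₁ * (Z₂ * W₃ - W₃ * Z₂)) + τ (Y₁ * (V₂ * V₃ - V₃ * V₂))
          + τ (Y₁ * (W₂ * Z₃ - Z₃ * W₂)))) = 0 := by
  -- The Jacobi sum is quadratic in (c₁, c₂): the three facts are its coefficients at c₁², c₂² and
  -- c₁c₂.
  have h1 := trace_vol hD hτ hτD u K₁ K₂ K₃
  have h2 := jacobi_second hD hτ hτD hW₁ hV₁ hW₂ hV₂ hW₃ hV₃
  have h3 := jacobi_mixed hD hτ hτD hW₁ hV₁ hW₂ hV₂ hW₃ hV₃ hc₁ hc₂ hc₃ ho₁ ho₂ ho₃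
  simp only [add_sub_cancel] at h3
  subst hY₁ hY₂ hY₃
  simp only [add_mul, smul_mul_assoc, map_add, map_smul]
  linear_combination (norm := module) (c₁ * c₁) • h1 + (c₂ * c₂) • h2 + (c₁ * c₂) • h3

end AbstractJacobi
end HPnFlow
end

noncomputable section

namespace HPnFlow

/-! ## Matrix realization of the operators -/

/-- Square quaternionic matrices of size `m + 2`. -/
abbrev QMat (B : Type) [CommRing B] (m : ℕ) : Type := Matrix (Bool ⊕ Fin m) (Bool ⊕ Fin m) ℍ[B]

section Realization

variable {B : Type} [CommRing B] {m : ℕ}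

/-- The even matrix with components `f = (w, 𝐰)` transversal to, and `p`, `P` in, the centralizer
of `eMat`. -/
def embH (f : Pair B m) (p : ℍ[B]) (P : Matrix (Fin m) (Fin m) ℍ[B]) : QMat B m :=
  Matrix.of fun
    | Sum.inl false, Sum.inl false => f.1 + p
    | Sum.inl true, Sum.inl true => p - f.1
    | Sum.inl true, Sum.inr r => f.2 r
    | Sum.inr r, Sum.inl true => -star (f.2 r)
    | Sum.inr r, Sum.inr s => P r s
    | _, _ => 0

/-- The odd matrix with corner entries `v`, `star v` and off-diagonal vector `x`. -/
def embM (v : ℍ[B]) (x : Fin m → ℍ[B]) : QMat B m :=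
  Matrix.of fun
    | Sum.inl false, Sum.inl true => v
    | Sum.inl true, Sum.inl false => star v
    | Sum.inl false, Sum.inr r => x r
    | Sum.inr r, Sum.inl false => star (x r)
    | _, _ => 0

variable (B m) in
/-- The distinguished odd matrix, with `eMat ^ 3 = eMat`. -/
def eMat : QMat B m := embM 1 0

/-- The real part of the trace. -/
def reTr (X : QMat B m) : B := X.trace.re

theorem re_mul_comm (a b : ℍ[B]) : (a * b).re = (b * a).re := by
  simp; ring

theorem re_sum {ι : Type*} (s : Finset ι) (f : ι → ℍ[B]) : (∑ i ∈ s, f i).re =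
    ∑ i ∈ s, (f i).re := by
  classical
  induction s using Finset.induction_on with
  | empty => simp
  | insert a s ha ih => simp [Finset.sum_insert ha, ih]

/-- Quaternions do not commute, but the real part of a product is symmetric, so the real trace is
still cyclic. -/
theorem reTr_mul_comm (X Y : QMat B m) : reTr (X * Y) = reTr (Y * X) := by
  simp only [reTr, Matrix.trace, Matrix.diag, Matrix.mul_apply, re_sum]
  rw [Finset.sum_comm]
  simp only [re_mul_comm]

/-- The product of matrices in components. -/
theorem qmat_mul_apply (X Y : QMat B m) (i j : Bool ⊕ Fin m) :
    (X * Y) i j = X i (.inl true) * Y (.inl true) j + X i (.inl false) * Y (.inl false) j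
      + ∑ s, X i (.inr s) * Y (.inr s) j := by
  rw [Matrix.mul_apply, Fintype.sum_sum_type, Fintype.sum_bool]

variable [Algebra ℝ B]

/-- `reTr` as a linear map. -/
def reTrL : QMat B m →ₗ[ℝ] B where
  toFun := reTr
  map_add' X Y := by simp [reTr]
  map_smul' c X := by simp [reTr]

@[simp] theorem dQ_re (D : Derivation ℝ B B) (a : ℍ[B]) : (dQ D a).re = D a.re := rfl

@[simp] theorem dQ_imI (D : Derivation ℝ B B) (a : ℍ[B]) : (dQ D a).imI = D a.imI := rfl

@[simp] theorem dQ_imJ (D : Derivation ℝ B B) (a : ℍ[B]) : (dQ D a).imJ = D a.imJ := rfl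

@[simp] theorem dQ_imK (D : Derivation ℝ B B) (a : ℍ[B]) : (dQ D a).imK = D a.imK := rfl

/-- `dQ` as a linear map. -/
def dQL (D : Derivation ℝ B B) : ℍ[B] →ₗ[ℝ] ℍ[B] where
  toFun := dQ D
  map_add' x y := by ext <;> simp
  map_smul' c x := by ext <;> simp

theorem dQ_add (D : Derivation ℝ B B) (a b : ℍ[B]) : dQ D (a + b) = dQ D a + dQ D b :=
  (dQL D).map_add a b

theorem dQ_sub (D : Derivation ℝ B B) (a b : ℍ[B]) : dQ D (a - b) = dQ D a - dQ D b :=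
  (dQL D).map_sub a b

theorem dQ_neg (D : Derivation ℝ B B) (a : ℍ[B]) : dQ D (-a) = -dQ D a :=
  (dQL D).map_neg a

theorem dQ_smul (D : Derivation ℝ B B) (c : ℝ) (a : ℍ[B]) : dQ D (c • a) = c • dQ D a :=
  (dQL D).map_smul c a

theorem dQ_sum (D : Derivation ℝ B B) {ι : Type*} (s : Finset ι) (f : ι → ℍ[B]) :
    dQ D (∑ i ∈ s, f i) = ∑ i ∈ s, dQ D (f i) := map_sum (dQL D) f s

@[simp] theorem dQ_zero (D : Derivation ℝ B B) : dQ D 0 = 0 := (dQL D).map_zero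

@[simp] theorem dQ_one (D : Derivation ℝ B B) : dQ D 1 = 0 := by ext <;> simp

theorem dQ_star (D : Derivation ℝ B B) (a : ℍ[B]) : dQ D (star a) = star (dQ D a) := by
  ext <;> simp

theorem dQ_mul (D : Derivation ℝ B B) (a b : ℍ[B]) : dQ D (a * b) = dQ D a * b + a * dQ D b := by
  ext <;> simp <;> ring

theorem dQ_bsmul (D : Derivation ℝ B B) (b : B) (a : ℍ[B]) :
    dQ D (b • a) = D b • a + b • dQ D a := by
  ext <;> simp <;> ring

theorem dQ_comm {D X : Derivation ℝ B B} (h : ∀ b, X (D b) = D (X b)) (a : ℍ[B]) :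
    dQ X (dQ D a) = dQ D (dQ X a) := by
  ext <;> simp [h]

/-- A derivation acting on matrices by components. -/
def dMat (D : Derivation ℝ B B) : QMat B m →ₗ[ℝ] QMat B m := (dQL D).mapMatrix

@[simp] theorem dMat_apply (D : Derivation ℝ B B) (X : QMat B m) (i j : Bool ⊕ Fin m) :
    dMat D X i j = dQ D (X i j) := rfl

theorem dMat_mul (D : Derivation ℝ B B) (X Y : QMat B m) :
    dMat D (X * Y) = dMat D X * Y + X * dMat D Y := by
  refine Matrix.ext fun i j => ?_
  simp only [dMat_apply, Matrix.mul_apply, Matrix.add_apply, dQ_sum, dQ_mul,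
    Finset.sum_add_distrib]

theorem dMat_comm {D X : Derivation ℝ B B} (h : ∀ b, X (D b) = D (X b)) (Y : QMat B m) :
    dMat X (dMat D Y) = dMat D (dMat X Y) := by
  refine Matrix.ext fun i j => ?_
  simp [dQ_comm h]

theorem reTr_dMat (D : Derivation ℝ B B) (X : QMat B m) : reTr (dMat D X) = D (reTr X) := by
  simp [reTr, Matrix.trace, re_sum, map_sum]

theorem dMat_eMat (D : Derivation ℝ B B) : dMat D (eMat B m) = 0 := by
  refine Matrix.ext fun i j => ?_
  rcases i with (_ | _) | i <;> rcases j with (_ | _) | j <;> simp [eMat, embM]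

theorem dMat_embH (D : Derivation ℝ B B) (f : Pair B m) (p : ℍ[B])
    (P : Matrix (Fin m) (Fin m) ℍ[B]) :
    dMat D (embH f p P) = embH (dPair D f) (dQ D p) (P.map (dQ D)) := by
  refine Matrix.ext fun i j => ?_
  rcases i with (_ | _) | i <;> rcases j with (_ | _) | j <;>
    simp [embH, dPair, dQ_add, dQ_sub, dQ_neg, dQ_star]

theorem two_half_smul (a : ℍ[B]) : (2⁻¹ : ℝ) • a + (2⁻¹ : ℝ) • a = a := by
  rw [← add_smul]; norm_num

/-- The value of the covariant derivative on even matrices. -/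
theorem nabla_embH (D : Derivation ℝ B B) (u f : Pair B m) (p : ℍ[B])
    (P : Matrix (Fin m) (Fin m) ℍ[B]) (hP : Pᴴ = -P) (hu : star u.1 = -u.1)
    (hf : star f.1 = -f.1) (hp : star p = -p) :
    nabla (dMat D) (embH u 0 0) (embH f p P) =
      embH (dQ D f.1 + comS u.1 p + (1 / 2 : ℝ) • comV u.2 f.2,
          fun r => dQ D (f.2 r) - p * u.2 r + ∑ s, u.2 s * P s r + f.1 * u.2 r - u.1 * f.2 r)
        (dQ D p + (comS u.1 f.1 - (1 / 2 : ℝ) • comV u.2 f.2))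
        (Matrix.of fun r s => dQ D (P r s) - comM u.2 f.2 r s) := by
  have hP' : ∀ r s, star (P s r) = -P r s := fun r s => congrFun (congrFun hP r) s
  have hc := two_half_smul (comV u.2 f.2)
  refine Matrix.ext fun i j => ?_
  rcases i with (_ | _) | i <;> rcases j with (_ | _) | j <;>
    simp [nabla, qmat_mul_apply, embH, comS, hP', hu, hf, hp, comM, Finset.sum_neg_distrib,
      dQ_add, dQ_sub, dQ_neg, dQ_star]
  · noncomm_ring
  -- The lower corner entry p - w receives the whole commutator; one half belongs to the transversal
  -- part and one half to the centralizer part.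
  · have h : ∑ x, u.2 x * star (f.2 x) - ∑ x, f.2 x * star (u.2 x)
        = (2⁻¹ : ℝ) • comV u.2 f.2 + (2⁻¹ : ℝ) • comV u.2 f.2 := hc.symm
    generalize (2⁻¹ : ℝ) • comV u.2 f.2 = c at h ⊢
    rw [sub_eq_iff_eq_add] at h
    rw [h]
    noncomm_ring
  · noncomm_ring
  · noncomm_ring
  · noncomm_ring

theorem embH_inj {f f' : Pair B m} {p p' : ℍ[B]} {P P' : Matrix (Fin m) (Fin m) ℍ[B]}
    (h : embH f p P = embH f' p' P') : f = f' ∧ p = p' ∧ P = P' := by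
  have h1 : f.1 + p = f'.1 + p' := congrFun (congrFun h (.inl false)) (.inl false)
  have h2 : p - f.1 = p' - f'.1 := congrFun (congrFun h (.inl true)) (.inl true)
  have h3 : ∀ r, f.2 r = f'.2 r := fun r => congrFun (congrFun h (.inl true)) (.inr r)
  have h4 : ∀ r s, P r s = P' r s := fun r s => congrFun (congrFun h (.inr r)) (.inr s)
  have h5 : f.1 = f'.1 := by
    rw [← two_half_smul f.1, ← two_half_smul f'.1, ← smul_add, ← smul_add]
    congr 1
    linear_combination (norm := abel) h1 - h2
  refine ⟨Prod.ext h5 (funext h3), ?_, Matrix.ext h4⟩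
  rw [h5] at h1
  exact add_left_cancel h1

theorem embH_add (f f' : Pair B m) (p p' : ℍ[B]) (P P' : Matrix (Fin m) (Fin m) ℍ[B]) :
    embH f p P + embH f' p' P' = embH (f + f') (p + p') (P + P') := by
  refine Matrix.ext fun i j => ?_
  rcases i with (_ | _) | i <;> rcases j with (_ | _) | j <;> simp [embH] <;> abel

theorem embH_smul (c : ℝ) (f : Pair B m) (p : ℍ[B]) (P : Matrix (Fin m) (Fin m) ℍ[B]) :
    c • embH f p P = embH (c • f) (c • p) (c • P) := by
  refine Matrix.ext fun i j => ?_
  rcases i with (_ | _) | i <;> rcases j with (_ | _) | j <;> simp [embH, smul_sub]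

/-- The answer does not involve p and P, which lie in the centralizer: the next link of a chain does
not see which antiderivatives were chosen. -/
theorem eMat_lie_embH (f : Pair B m) (p : ℍ[B]) (P : Matrix (Fin m) (Fin m) ℍ[B])
    (hf : star f.1 = -f.1) :
    eMat B m * embH f p P - embH f p P * eMat B m = embM (-(f.1 + f.1)) f.2 := by
  refine Matrix.ext fun i j => ?_
  rcases i with (_ | _) | i <;> rcases j with (_ | _) | j <;>
    simp [qmat_mul_apply, embH, embM, eMat, hf]
  all_goals noncomm_ring

theorem eMat_lie_embM (v : ℍ[B]) (x : Fin m → ℍ[B]) :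
    eMat B m * embM v x - embM v x * eMat B m = embH (star v - v, x) 0 0 := by
  refine Matrix.ext fun i j => ?_
  rcases i with (_ | _) | i <;> rcases j with (_ | _) | j <;>
    simp [qmat_mul_apply, embH, embM, eMat]

/-- The trace form on even matrices transversal to the centralizer. -/
theorem reTr_embH (f g : Pair B m) (p : ℍ[B]) (P : Matrix (Fin m) (Fin m) ℍ[B])
    (hg : star g.1 = -g.1) : reTr (embH f p P * embH g 0 0) = (-2 : ℝ) • rePair f g := by
  rw [reTr, Matrix.trace, Fintype.sum_sum_type, Fintype.sum_bool]
  simp [qmat_mul_apply, embH, rePair, hg, herm, re_sum]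
  simp only [two_smul]
  ring

theorem nabla_embM (D : Derivation ℝ B B) (u : Pair B m) (v : ℍ[B]) (x : Fin m → ℍ[B])
    (hu : star u.1 = -u.1) :
    nabla (dMat D) (embH u 0 0) (embM v x) =
      embM (dQ D v + (u.1 * v + v * u.1) + herm x u.2)
        (fun r => dQ D (x r) + u.1 * x r - v * u.2 r) := by
  refine Matrix.ext fun i j => ?_
  rcases i with (_ | _) | i <;> rcases j with (_ | _) | j <;>
    simp [nabla, qmat_mul_apply, embH, embM, hu, herm, dQ_star]
  all_goals noncomm_ring

theorem star_eq_neg_of_re {a : ℍ[B]} (h : a.re = 0) : star a = -a := by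
  ext <;> simp [h]

theorem half_smul_add (b : B) : (1 / 2 : ℝ) • (b + b) = b := by
  rw [← two_smul ℝ b, smul_smul]; norm_num

theorem re_eq_zero_of_star {a : ℍ[B]} (h : star a = -a) : a.re = 0 := by
  have h1 : a.re = -a.re := by
    simpa using congrArg (fun x : ℍ[B] => x.re) h
  rw [← half_smul_add a.re]
  nth_rewrite 1 [h1]
  simp

theorem comS_re (a b : ℍ[B]) : (comS a b).re = 0 := by
  simp [comS]; ring

theorem star_herm (x y : Fin m → ℍ[B]) : star (herm x y) = herm y x := by
  simp [herm]

theorem comV_re (x y : Fin m → ℍ[B]) : (comV x y).re = 0 := by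
  rw [comV, ← star_herm x y]; simp

/-- A quaternion plus its conjugate is real. Together with `antiS_eq` this is why q may be taken as
a scalar of `B`. -/
theorem antiV_eq (x y : Fin m → ℍ[B]) : antiV x y = ((antiV x y).re : ℍ[B]) := by
  rw [antiV, ← star_herm x y]; ext <;> simp

theorem antiS_eq {a b : ℍ[B]} (ha : a.re = 0) (hb : b.re = 0) :
    antiS a b = ((antiS a b).re : ℍ[B]) := by
  ext <;> simp [antiS, ha, hb] <;> ring

/-- The value of `𝓙` on `h` for a choice `q` of the antiderivative. -/
def valJ (D : Derivation ℝ B B) (u h : Pair B m) (q : B) : Pair B m :=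
  ((1 / 4 : ℝ) • dQ D h.1 + (1 / 4 : ℝ) • comV u.2 h.2 + q • u.1,
    fun r => dQ D (h.2 r) + (1 / 2 : ℝ) • (h.1 * u.2 r) + u.1 * h.2 r + q • u.2 r)

/-- The odd matrix of a pair `h` and the centralizer component `q`. -/
def embJ (h : Pair B m) (q : B) : QMat B m := embM (-((1 / 2 : ℝ) • h.1) - (q : ℍ[B])) h.2

/-- The real part of the corner entry is the obstruction to lying in the image of ad e; it vanishes
exactly when q is the required antiderivative, and what is left is the value of 𝓙. -/
theorem nabla_embJ (D : Derivation ℝ B B) {u h : Pair B m} (q : B) (hu : u.1.re = 0)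
    (hh : h.1.re = 0) :
    nabla (dMat D) (embH u 0 0) (embJ h q) =
      embM (-((valJ D u h q).1 + (valJ D u h q).1)
        - ((D q + ((1 / 2 : ℝ) • antiS u.1 h.1 - (1 / 2 : ℝ) • antiV u.2 h.2).re : B) : ℍ[B]))
        (valJ D u h q).2 := by
  have hq : dQ D (q : ℍ[B]) = ((D q : B) : ℍ[B]) := by ext <;> simp
  rw [embJ, nabla_embM _ _ _ _ (star_eq_neg_of_re hu)]
  congr 1
  · have h1 := antiS_eq hu hh
    have h2 := antiV_eq u.2 h.2
    have h3 : ((D q + ((1 / 2 : ℝ) • antiS u.1 h.1 - (1 / 2 : ℝ) • antiV u.2 h.2).re : B) : ℍ[B])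
        = ((D q : B) : ℍ[B]) + ((1 / 2 : ℝ) • antiS u.1 h.1 - (1 / 2 : ℝ) • antiV u.2 h.2) := by
      rw [h1, h2]; ext <;> simp
    rw [h3]
    simp only [valJ, comV, antiV, antiS, dQ_sub, dQ_neg, dQ_smul, hq, mul_sub, sub_mul, mul_neg,
      neg_mul, mul_smul_comm, smul_mul_assoc, Quaternion.coe_mul_eq_smul,
      Quaternion.mul_coe_eq_smul]
    generalize q • u.1 = z
    module
  · funext r
    simp only [valJ, sub_mul, neg_mul, smul_mul_assoc, Quaternion.coe_mul_eq_smul]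
    module

/-- The coefficient -1/2 in `embJ` is chosen for this: with v the corner entry, star v - v is the
scalar part of h, while q drops out. -/
theorem eMat_lie_embJ {h : Pair B m} (hh : h.1.re = 0) (q : B) :
    eMat B m * embJ h q - embJ h q * eMat B m = embH h 0 0 := by
  rw [embJ, eMat_lie_embM]
  have h1 := star_eq_neg_of_re hh
  congr 1
  refine Prod.ext ?_ rfl
  simp [h1]
  rw [← two_half_smul h.1]
  simp
  module

/-- A relation `y = 𝓗 w` as a matrix equation. -/
theorem IsH.nabla_eq {D : Derivation ℝ B B} {N : Submodule ℝ B} {u w y : Pair B m}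
    (h : IsH D N u w y) (hu : u.1.re = 0) :
    w.1.re = 0 ∧ y.1.re = 0 ∧ ∃ p P, nabla (dMat D) (embH u 0 0) (embH w p P) = embH y 0 0 := by
  obtain ⟨hw, p, P, hp, -, hDp, hP, -, hDP, hy1, hy2⟩ := h
  refine ⟨hw, ?_, p, P, ?_⟩
  · rw [hy1]; simp [comS_re, comV_re, hw]
  · rw [nabla_embH D u w p P hP (star_eq_neg_of_re hu) (star_eq_neg_of_re hw)
      (star_eq_neg_of_re hp)]
    congr 1
    · exact Prod.ext hy1.symm (funext fun r => (hy2 r).symm)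
    · rw [hDp, neg_add_cancel]
    · refine Matrix.ext fun r s => ?_
      simp [hDP]

/-- The two zero slots on the right-hand side are precisely the equations for the derivatives of p
and P. -/
theorem IsH.of_nabla_eq {D : Derivation ℝ B B} {N : Submodule ℝ B} {u w y : Pair B m}
    {p : ℍ[B]} {P : Matrix (Fin m) (Fin m) ℍ[B]} (hu : u.1.re = 0) (hw : w.1.re = 0)
    (hp : p.re = 0) (hP : Pᴴ = -P) (hpN : QIn N p) (hPN : ∀ r s, QIn N (P r s))
    (h : nabla (dMat D) (embH u 0 0) (embH w p P) = embH y 0 0) : IsH D N u w y := by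
  rw [nabla_embH D u w p P hP (star_eq_neg_of_re hu) (star_eq_neg_of_re hw)
      (star_eq_neg_of_re hp)] at h
  obtain ⟨h1, h2, h3⟩ := embH_inj h
  refine ⟨hw, p, P, hp, hpN, eq_neg_of_add_eq_zero_left h2, hP, hPN, fun r s => ?_,
    (congrArg Prod.fst h1).symm, fun r => (congrFun (congrArg Prod.snd h1) r).symm⟩
  exact sub_eq_zero.1 (congrFun (congrFun h3 r) s)

theorem isJ_iff {D : Derivation ℝ B B} {N : Submodule ℝ B} {u h w : Pair B m} :
    IsJ D N u h w ↔ h.1.re = 0 ∧ ∃ q ∈ N,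
      D q = -((1 / 2 : ℝ) • antiS u.1 h.1 - (1 / 2 : ℝ) • antiV u.2 h.2).re ∧ w = valJ D u h q := by
  simp only [IsJ, Prod.ext_iff, valJ, funext_iff]

theorem valJ_re {D : Derivation ℝ B B} {u h : Pair B m} {q : B} (hu : u.1.re = 0)
    (hh : h.1.re = 0) : (valJ D u h q).1.re = 0 := by
  simp [valJ, hu, hh, comV_re]

/-- A relation `w = 𝓙 h` as a matrix equation. -/
theorem IsJ.nabla_eq {D : Derivation ℝ B B} {N : Submodule ℝ B} {u h w : Pair B m}
    (H : IsJ D N u h w) (hu : u.1.re = 0) :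
    ∃ q, eMat B m * embJ h q - embJ h q * eMat B m = embH h 0 0 ∧ ∀ p P,
      nabla (dMat D) (embH u 0 0) (embJ h q) = eMat B m * embH w p P - embH w p P * eMat B m := by
  obtain ⟨hh, q, -, hq, rfl⟩ := isJ_iff.1 H
  refine ⟨q, eMat_lie_embJ hh q, fun p P => ?_⟩
  rw [nabla_embJ D q hu hh, eMat_lie_embH _ _ _ (star_eq_neg_of_re (valJ_re hu hh)), hq]
  simp

theorem embM_inj {v v' : ℍ[B]} {x x' : Fin m → ℍ[B]} (h : embM v x = embM v' x') :
    v = v' ∧ x = x' :=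
  ⟨congrFun (congrFun h (.inl false)) (.inl true),
    funext fun r => congrFun (congrFun h (.inl false)) (.inr r)⟩

theorem IsJ.of_nabla_eq {D : Derivation ℝ B B} {N : Submodule ℝ B} {u h w : Pair B m} {q : B}
    {p : ℍ[B]} {P : Matrix (Fin m) (Fin m) ℍ[B]} (hu : u.1.re = 0) (hh : h.1.re = 0)
    (hw : w.1.re = 0) (hq : q ∈ N)
    (H : nabla (dMat D) (embH u 0 0) (embJ h q)
      = eMat B m * embH w p P - embH w p P * eMat B m) : IsJ D N u h w := by
  rw [nabla_embJ D q hu hh, eMat_lie_embH _ _ _ (star_eq_neg_of_re hw)] at H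
  obtain ⟨h1, h2⟩ := embM_inj H
  -- Both scalar components are imaginary, so the real part of the corner entry isolates the
  -- equation for D q.
  have h3 := congrArg (fun x : ℍ[B] => x.re) h1
  simp only [Quaternion.re_sub, Quaternion.re_neg, Quaternion.re_add, valJ_re hu hh, hw,
    Quaternion.re_coe, add_zero, neg_zero, zero_sub, neg_eq_zero] at h3
  have h4 : D q = -((1 / 2 : ℝ) • antiS u.1 h.1 - (1 / 2 : ℝ) • antiV u.2 h.2).re :=
    eq_neg_of_add_eq_zero_left h3
  refine isJ_iff.2 ⟨hh, q, hq, h4, Prod.ext ?_ h2.symm⟩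
  rw [h4, neg_add_cancel, Quaternion.coe_zero, sub_zero, neg_inj] at h1
  rw [← two_half_smul w.1, ← two_half_smul (valJ D u h q).1, ← smul_add, ← smul_add, h1]

end Realization
end HPnFlow
end

noncomputable section

namespace HPnFlow

/-! ## The Hamiltonian pair -/

section HamiltonianPair

variable {B : Type} [CommRing B] [Algebra ℝ B] {m : ℕ}

/-- The differential algebra modulo total derivatives. -/
abbrev ModTotal (D : Derivation ℝ B B) : Type := B ⧸ LinearMap.range (D : B →ₗ[ℝ] B)

/-- Reduction modulo total derivatives. -/
abbrev toModTotal (D : Derivation ℝ B B) : B →ₗ[ℝ] ModTotal D :=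
  (LinearMap.range (D : B →ₗ[ℝ] B)).mkQ

theorem toModTotal_eq_zero {D : Derivation ℝ B B} {b : B} :
    toModTotal D b = 0 ↔ ∃ g, D g = b := by
  rw [Submodule.mkQ_apply, Submodule.Quotient.mk_eq_zero, LinearMap.mem_range]; rfl

/-- The factor -2 is the one in `reTr_embH`. -/
theorem exists_eq_iff_smul {D : Derivation ℝ B B} {b : B} :
    (∃ g, D g = b) ↔ (-2 : ℝ) • toModTotal D b = 0 := by
  rw [← toModTotal_eq_zero, smul_eq_zero_iff_right (by norm_num : (-2 : ℝ) ≠ 0)]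

/-- The trace form with values modulo total derivatives. -/
def trQ (D : Derivation ℝ B B) : QMat B m →ₗ[ℝ] ModTotal D := toModTotal D ∘ₗ reTrL

theorem trQ_apply (D : Derivation ℝ B B) (X : QMat B m) :
    trQ D X = toModTotal D (reTr X) := rfl

theorem trQ_mul_comm (D : Derivation ℝ B B) (X Y : QMat B m) :
    trQ D (X * Y) = trQ D (Y * X) := by
  rw [trQ_apply, trQ_apply, reTr_mul_comm]

theorem trQ_dMat (D : Derivation ℝ B B) (X : QMat B m) : trQ D (dMat D X) = 0 := by
  rw [trQ_apply, reTr_dMat]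
  exact toModTotal_eq_zero.2 ⟨_, rfl⟩

theorem trQ_embH (D : Derivation ℝ B B) (f g : Pair B m) (p : ℍ[B])
    (P : Matrix (Fin m) (Fin m) ℍ[B]) (hg : g.1.re = 0) :
    trQ D (embH f p P * embH g 0 0) = (-2 : ℝ) • toModTotal D (rePair f g) := by
  rw [trQ_apply, reTr_embH _ _ _ _ (star_eq_neg_of_re hg), map_smul]

theorem rePair_zero_left (g : Pair B m) : rePair 0 g = 0 := by
  simp [rePair, herm]

theorem rePair_comb (f g₁ g₂ : Pair B m) (c₁ c₂ : ℝ) :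
    rePair f (c₁ • g₁ + c₂ • g₂) = c₁ • rePair f g₁ + c₂ • rePair f g₂ := by
  have h : ∀ c : ℝ, ∀ a : ℍ[B], star (c • a) = c • star a := fun c a => by ext <;> simp
  simp only [rePair, herm, Prod.fst_add, Prod.snd_add, Prod.smul_fst, Prod.smul_snd, Pi.add_apply,
    Pi.smul_apply, star_add, h, mul_add, mul_smul_comm, Finset.sum_add_distrib,
    ← Finset.smul_sum, Quaternion.re_add, Quaternion.re_smul, smul_add]
  abel

/-- The trace form in `reTr_embH` contains no p and P, so the centralizer is orthogonal to
transversal matrices. -/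
theorem trQ_orth (D : Derivation ℝ B B) {g : Pair B m} (hg : g.1.re = 0) (p : ℍ[B])
    (P : Matrix (Fin m) (Fin m) ℍ[B]) : trQ D (embH g 0 0 * embH 0 p P) = 0 := by
  rw [trQ_mul_comm, trQ_embH _ _ _ _ _ hg, rePair_zero_left, map_zero, smul_zero]

theorem dPair_comb (X : Derivation ℝ B B) (f g : Pair B m) (c₁ c₂ : ℝ) :
    dPair X (c₁ • f + c₂ • g) = c₁ • dPair X f + c₂ • dPair X g := by
  ext1
  · simp [dPair, dQ_add, dQ_smul]
  · funext r; simp [dPair, dQ_add, dQ_smul]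

theorem dPair_re {X : Derivation ℝ B B} {f : Pair B m} (hf : f.1.re = 0) :
    (dPair X f).1.re = 0 := by simp [dPair, hf]

theorem embH_sub_same (f : Pair B m) (p p' : ℍ[B]) (P P' : Matrix (Fin m) (Fin m) ℍ[B]) :
    embH f p P - embH f p' P' = embH 0 (p - p') (P - P') := by
  rw [sub_eq_iff_eq_add, embH_add]; simp

theorem embH_zero_mul (p p' : ℍ[B]) (P P' : Matrix (Fin m) (Fin m) ℍ[B]) :
    embH 0 p P * embH 0 p' P' = embH 0 (p * p') (P * P') := by
  refine Matrix.ext fun i j => ?_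
  rcases i with (_ | _) | i <;> rcases j with (_ | _) | j <;>
    simp [embH, Matrix.mul_apply]

theorem dMat_embH_const {X : Derivation ℝ B B} {f : Pair B m} (hf : dPair X f = 0) (p : ℍ[B])
    (P : Matrix (Fin m) (Fin m) ℍ[B]) :
    dMat X (embH f p P) = embH 0 (dQ X p) (P.map (dQ X)) := by
  rw [dMat_embH, hf]

theorem dMat_embH_perp (X : Derivation ℝ B B) (f : Pair B m) :
    dMat X (embH f 0 0) = embH (dPair X f) 0 0 := by
  rw [dMat_embH, dQ_zero]
  congr 1
  exact Matrix.ext fun i j => by simp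

/-- Two matrices with the same transversal part differ by an element of the even centralizer, which
is closed under products and hence under commutators. -/
theorem trQ_orth_lie (D : Derivation ℝ B B) {f₁ f₂ g : Pair B m} (hg : g.1.re = 0)
    (p₁ p₁' p₂ p₂' : ℍ[B]) (P₁ P₁' P₂ P₂' : Matrix (Fin m) (Fin m) ℍ[B]) :
    trQ D (embH g 0 0 * ((embH f₁ p₁ P₁ - embH f₁ p₁' P₁') * (embH f₂ p₂ P₂ - embH f₂ p₂' P₂')
      - (embH f₂ p₂ P₂ - embH f₂ p₂' P₂') * (embH f₁ p₁ P₁ - embH f₁ p₁' P₁'))) = 0 := by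
  rw [embH_sub_same, embH_sub_same, embH_zero_mul, embH_zero_mul, mul_sub, map_sub,
    trQ_orth D hg, trQ_orth D hg, sub_zero]

theorem eMat_comm_sub (f : Pair B m) (p p' : ℍ[B]) (P P' : Matrix (Fin m) (Fin m) ℍ[B]) :
    eMat B m * (embH f p P - embH f p' P') - (embH f p P - embH f p' P') * eMat B m = 0 := by
  rw [embH_sub_same, eMat_lie_embH _ _ _ (by simp)]
  refine Matrix.ext fun i j => ?_
  rcases i with (_ | _) | i <;> rcases j with (_ | _) | j <;> simp [embM]

/-- A relation `y = 𝓔 w` as a chain of matrix equations. -/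
theorem IsE.nabla_eq {D : Derivation ℝ B B} {N : Submodule ℝ B} {u w y : Pair B m}
    (h : IsE D N u w y) (hu : u.1.re = 0) :
    w.1.re = 0 ∧ y.1.re = 0 ∧ ∃ p P V f p' P',
      nabla (dMat D) (embH u 0 0) (embH w p P) = eMat B m * V - V * eMat B m ∧
      nabla (dMat D) (embH u 0 0) V
        = eMat B m * embH f p' P' - embH f p' P' * eMat B m ∧
      nabla (dMat D) (embH u 0 0) (embH f p' P') = embH y 0 0 := by
  obtain ⟨h, h1, f, h2, h3⟩ := h
  obtain ⟨hw, -, p, P, hP⟩ := h1.nabla_eq hu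
  obtain ⟨-, hy, p', P', hP'⟩ := h3.nabla_eq hu
  obtain ⟨q, hq, hq'⟩ := h2.nabla_eq hu
  exact ⟨hw, hy, p, P, _, f, p', P', by rw [hP, hq], hq' p' P', hP'⟩

theorem isHamiltonian_opH (m : ℕ) : IsHamiltonian (opH m) := by
  intro B _ _ D u hu
  have hD := dMat_mul (m := m) D
  have hτ := trQ_mul_comm (m := m) D
  have hτD := trQ_dMat (m := m) D
  refine ⟨fun w₁ w₂ y₁ y₂ h₁ h₂ => ?_, fun w y X h hX hXu hXw => ?_⟩
  · obtain ⟨-, hy₁, p₁, P₁, h₁⟩ := IsH.nabla_eq h₁ hu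
    obtain ⟨-, hy₂, p₂, P₂, h₂⟩ := IsH.nabla_eq h₂ hu
    rw [exists_eq_iff_smul, map_add,
      smul_add, ← trQ_embH D _ _ p₁ P₁ hy₂, ← trQ_embH D _ _ p₂ P₂ hy₁, ← h₁, ← h₂,
      hτ (embH w₂ p₂ P₂), trace_nabla_mul hD hτ hτD, add_neg_cancel]
  · have hy : ∀ i, (y i).1.re = 0 := fun i => ((h i).nabla_eq hu).2.1
    choose p P hn using fun i => ((h i).nabla_eq hu).2.2
    have hU : ∀ i, dMat (X i) (embH u 0 0) = embH (y i) 0 0 := fun i => by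
      rw [dMat_embH_perp, hXu]
    -- As X_j does not move w_k, it changes only the centralizer part of the matrix of w_k. That
    -- change is orthogonal to y_i, and only the commutator term of `variation_first` survives.
    have key : ∀ i j k, (-2 : ℝ) • toModTotal D (rePair (w i) (dPair (X j) (y k))) =
        trQ D (nabla (dMat D) (embH u 0 0) (embH (w j) (p j) (P j)) *
          (embH (w k) (p k) (P k) * embH (w i) (p i) (P i)
            - embH (w i) (p i) (P i) * embH (w k) (p k) (P k))) := fun i j k => by
      rw [← trQ_embH D _ _ (p i) (P i) (dPair_re (hy k)), ← dMat_embH_perp, ← hn k,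
        variation_first hD (dMat_mul _) (dMat_comm (hX j)) hτ hτD, hn i,
        dMat_embH_const (hXw j k), trQ_orth D (hy i), neg_zero, zero_add, hU, hn j]
    rw [exists_eq_iff_smul, map_add,
      map_add, smul_add, smul_add, key, key, key]
    have := trace_vol hD hτ hτD (embH u 0 0) (embH (w 0) (p 0) (P 0)) (embH (w 1) (p 1) (P 1))
      (embH (w 2) (p 2) (P 2))
    rw [← this]
    abel

theorem isHamiltonian_pencil (m : ℕ) (c₁ c₂ : ℝ) :
    IsHamiltonian (opComb c₁ (opH m) c₂ (opE m)) := by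
  intro B _ _ D u hu
  have hD := dMat_mul (m := m) D
  have hτ := trQ_mul_comm (m := m) D
  have hτD := trQ_dMat (m := m) D
  refine ⟨fun w₁ w₂ y₁ y₂ h₁ h₂ => ?_, fun w y X h hX hXu hXw => ?_⟩
  · obtain ⟨a₁, b₁, h₁, k₁, rfl⟩ := h₁
    obtain ⟨a₂, b₂, h₂, k₂, rfl⟩ := h₂
    obtain ⟨-, ha₁, p₁, P₁, hK₁⟩ := IsH.nabla_eq h₁ hu
    obtain ⟨-, ha₂, p₂, P₂, hK₂⟩ := IsH.nabla_eq h₂ hu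
    obtain ⟨-, hb₁, r₁, R₁, V₁, f₁, s₁, S₁, hW₁, hV₁, hZ₁⟩ := IsE.nabla_eq k₁ hu
    obtain ⟨-, hb₂, r₂, R₂, V₂, f₂, s₂, S₂, hW₂, hV₂, hZ₂⟩ := IsE.nabla_eq k₂ hu
    have e1 : trQ D (embH w₁ p₁ P₁ * embH a₂ 0 0) + trQ D (embH w₂ p₂ P₂ * embH a₁ 0 0) = 0 := by
      rw [← hK₁, ← hK₂, hτ (embH w₂ p₂ P₂), trace_nabla_mul hD hτ hτD, add_neg_cancel]
    have e2 : trQ D (embH w₁ r₁ R₁ * embH b₂ 0 0) + trQ D (embH w₂ r₂ R₂ * embH b₁ 0 0) = 0 := by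
      -- Skewness of 𝓔: ∇ is integrated by parts three times along the two chains, ad e being moved
      -- across at each link.
      have g1 := trace_nabla_mul hD hτ hτD (embH u 0 0) (embH w₁ r₁ R₁) (embH f₂ s₂ S₂)
      have g2 := trace_nabla_mul hD hτ hτD (embH u 0 0) (embH w₂ r₂ R₂) (embH f₁ s₁ S₁)
      have g3 := trace_nabla_mul hD hτ hτD (embH u 0 0) V₁ V₂
      rw [hW₁, trace_lie_mul hτ, ← hV₂, neg_inj] at g1
      rw [hW₂, trace_lie_mul hτ, ← hV₁, neg_inj] at g2
      rw [← hZ₁, ← hZ₂, ← g1, ← g2, hτ V₂, g3, add_neg_cancel]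
    rw [exists_eq_iff_smul]
    rw [trQ_embH D _ _ _ _ ha₁, trQ_embH D _ _ _ _ ha₂] at e1
    rw [trQ_embH D _ _ _ _ hb₁, trQ_embH D _ _ _ _ hb₂] at e2
    simp only [rePair_comb, map_add, map_smul]
    linear_combination (norm := module) c₁ • e1 + c₂ • e2
  · choose a b h k hy using h
    have ha : ∀ i, (a i).1.re = 0 := fun i => ((h i).nabla_eq hu).2.1
    have hb : ∀ i, (b i).1.re = 0 := fun i => ((k i).nabla_eq hu).2.1
    choose p P hK using fun i => ((h i).nabla_eq hu).2.2
    choose r R V f s S hW hV hZ using fun i => ((k i).nabla_eq hu).2.2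
    have hU : ∀ i, dMat (X i) (embH u 0 0) = embH (y i) 0 0 := fun i => by
      rw [dMat_embH_perp, hXu]
    have hY : ∀ i, embH (y i) 0 0 =
        c₁ • nabla (dMat D) (embH u 0 0) (embH (w i) (p i) (P i))
          + c₂ • nabla (dMat D) (embH u 0 0) (embH (f i) (s i) (S i)) := fun i => by
      rw [hK, hZ, embH_smul, embH_smul, embH_add, hy]; simp
    -- As for 𝓗 alone, the variations of the matrices of w_k are central with respect to e and
    -- orthogonal to the values; one commutator term from 𝓗 and three from 𝓔 remain.
    have key : ∀ i j k, (-2 : ℝ) • toModTotal D (rePair (w i) (dPair (X j) (y k))) =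
        c₁ • trQ D (embH (y j) 0 0 * (embH (w k) (p k) (P k) * embH (w i) (p i) (P i)
            - embH (w i) (p i) (P i) * embH (w k) (p k) (P k)))
        + c₂ • (trQ D (embH (y j) 0 0 * (embH (f k) (s k) (S k) * embH (w i) (r i) (R i)
            - embH (w i) (r i) (R i) * embH (f k) (s k) (S k)))
          + trQ D (embH (y j) 0 0 * (V k * V i - V i * V k))
          + trQ D (embH (y j) 0 0 * (embH (w k) (r k) (R k) * embH (f i) (s i) (S i)
            - embH (f i) (s i) (S i) * embH (w k) (r k) (R k)))) := fun i j k => by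
      rw [hy k, dPair_comb, rePair_comb, map_add, map_smul, map_smul, smul_add,
        smul_comm (-2 : ℝ) c₁, smul_comm (-2 : ℝ) c₂,
        ← trQ_embH D _ _ (p i) (P i) (dPair_re (ha k)),
        ← trQ_embH D _ _ (r i) (R i) (dPair_re (hb k)), ← dMat_embH_perp, ← dMat_embH_perp,
        ← hK k, ← hZ k,
        variation_first hD (dMat_mul _) (dMat_comm (hX j)) hτ hτD,
        variation_second hD (dMat_mul _) (dMat_comm (hX j)) hτ hτD (dMat_eMat _)
          (hW i) (hV i) (hW k) (hV k),
        hK i, hZ i, dMat_embH_const (hXw j k), dMat_embH_const (hXw j k), trQ_orth D (ha i),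
        trQ_orth D (hb i), neg_zero, zero_add, zero_add, hU]
    rw [exists_eq_iff_smul, map_add,
      map_add, smul_add, smul_add, key, key, key]
    have := jacobi_pencil hD hτ hτD c₁ c₂ (hW 0) (hV 0) (hW 1) (hV 1) (hW 2) (hV 2)
      (eMat_comm_sub (w 0) (p 0) (r 0) (P 0) (R 0)) (eMat_comm_sub (w 1) (p 1) (r 1) (P 1) (R 1))
      (eMat_comm_sub (w 2) (p 2) (r 2) (P 2) (R 2))
      (by rw [hZ, trQ_orth_lie D (hb _)]) (by rw [hZ, trQ_orth_lie D (hb _)])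
      (by rw [hZ, trQ_orth_lie D (hb _)]) (hY 0) (hY 1) (hY 2)
    rw [← this]
    module

/-- This is the pencil with coefficients 0 and 1; the value of 𝓗 that the pencil also demands is the
first link of the chain defining 𝓔. -/
theorem isHamiltonian_opE (m : ℕ) : IsHamiltonian (opE m) := by
  intro B _ _ D u hu
  have key : ∀ w y, opE m B D ⊤ u w y → opComb 0 (opH m) 1 (opE m) B D ⊤ u w y := fun w y h =>
    ⟨_, y, h.choose_spec.1, h, by simp⟩
  obtain ⟨h1, h2⟩ := isHamiltonian_pencil m 0 1 B D u hu
  exact ⟨fun w₁ w₂ y₁ y₂ k₁ k₂ => h1 w₁ w₂ y₁ y₂ (key _ _ k₁) (key _ _ k₂),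
    fun w y X k => h2 w y X fun i => key _ _ (k i)⟩

theorem isHamiltonianPair_opH_opE (m : ℕ) : IsHamiltonianPair (opH m) (opE m) :=
  ⟨isHamiltonian_opH m, isHamiltonian_opE m, isHamiltonian_pencil m⟩

end HamiltonianPair
end HPnFlow
end

noncomputable section

namespace HPnFlow

/-! ## The formal resolvent -/

section Resolvent

open PowerSeries

variable {A : Type*} [Ring A]

theorem coeff_zero_mul_eq (F G : A⟦X⟧) : coeff 0 (F * G) = coeff 0 F * coeff 0 G := by
  simp only [coeff_zero_eq_constantCoeff, map_mul]

theorem coeff_mul_low_left {k : ℕ} {F : A⟦X⟧} (hF : ∀ j < k, coeff j F = 0) (G : A⟦X⟧) :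
    (∀ j < k, coeff j (F * G) = 0) ∧ coeff k (F * G) = coeff k F * coeff 0 G := by
  refine ⟨fun j hj => ?_, ?_⟩
  · rw [coeff_mul]
    refine Finset.sum_eq_zero fun p hp => ?_
    rw [hF p.1 (by have := Finset.HasAntidiagonal.mem_antidiagonal.1 hp; omega), zero_mul]
  · rw [coeff_mul, Finset.sum_eq_single (k, 0)]
    · intro p hp hne
      have := Finset.HasAntidiagonal.mem_antidiagonal.1 hp
      rw [hF p.1 _, zero_mul]
      rcases p with ⟨a, b⟩
      by_contra hlt
      exact hne (Prod.ext (by simp at *; omega) (by simp at *; omega))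
    · simp

theorem coeff_mul_low_right {k : ℕ} {F : A⟦X⟧} (hF : ∀ j < k, coeff j F = 0) (G : A⟦X⟧) :
    (∀ j < k, coeff j (G * F) = 0) ∧ coeff k (G * F) = coeff 0 G * coeff k F := by
  refine ⟨fun j hj => ?_, ?_⟩
  · rw [coeff_mul]
    refine Finset.sum_eq_zero fun p hp => ?_
    rw [hF p.2 (by have := Finset.HasAntidiagonal.mem_antidiagonal.1 hp; omega), mul_zero]
  · rw [coeff_mul, Finset.sum_eq_single (0, k)]
    · intro p hp hne
      have := Finset.HasAntidiagonal.mem_antidiagonal.1 hp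
      rw [hF p.2 _, mul_zero]
      rcases p with ⟨a, b⟩
      by_contra hlt
      exact hne (Prod.ext (by simp at *; omega) (by simp at *; omega))
    · simp

theorem coeff_mul_congr {k : ℕ} {F F' G G' : A⟦X⟧} (hF : ∀ j ≤ k, coeff j F = coeff j F')
    (hG : ∀ j ≤ k, coeff j G = coeff j G') : ∀ j ≤ k, coeff j (F * G) = coeff j (F' * G') := by
  intro j hj
  rw [coeff_mul, coeff_mul]
  refine Finset.sum_congr rfl fun p hp => ?_
  have := Finset.HasAntidiagonal.mem_antidiagonal.1 hp
  rw [hF p.1 (by omega), hG p.2 (by omega)]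

variable [Algebra ℝ A]

/-- A linear map acting on the coefficients of power series. -/
def hat (D : A →ₗ[ℝ] A) (f : A⟦X⟧) : A⟦X⟧ := PowerSeries.mk fun n => D (coeff n f)

@[simp] theorem coeff_hat (D : A →ₗ[ℝ] A) (f : A⟦X⟧) (n : ℕ) :
    coeff n (hat D f) = D (coeff n f) := by simp [hat]

theorem hat_mul {D : A →ₗ[ℝ] A} (hD : ∀ a b, D (a * b) = D a * b + a * D b) (f g : A⟦X⟧) :
    hat D (f * g) = hat D f * g + f * hat D g := by
  ext n
  simp only [coeff_hat, coeff_mul, map_add, map_sum, hD, Finset.sum_add_distrib]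

/-- The Euler derivation `z d/dz`. -/
def eulerZ (f : A⟦X⟧) : A⟦X⟧ := PowerSeries.mk fun n => (n : ℝ) • coeff n f

@[simp] theorem coeff_eulerZ (f : A⟦X⟧) (n : ℕ) : coeff n (eulerZ f) = (n : ℝ) • coeff n f := by
  simp [eulerZ]

theorem eulerZ_mul (f g : A⟦X⟧) : eulerZ (f * g) = eulerZ f * g + f * eulerZ g := by
  ext n
  simp only [coeff_eulerZ, coeff_mul, map_add, Finset.smul_sum, ← Finset.sum_add_distrib]
  refine Finset.sum_congr rfl fun p hp => ?_
  rw [← Finset.HasAntidiagonal.mem_antidiagonal.1 hp, Nat.cast_add, add_smul, smul_mul_assoc,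
    mul_smul_comm]

/-- The operator `z (D + ad u) - ad e` on power series. -/
def laxOp (D : A →ₗ[ℝ] A) (e u : A) (f : A⟦X⟧) : A⟦X⟧ :=
  X * (hat D f + (C u * f - f * C u)) - (C e * f - f * C e)

theorem coeff_laxOp_zero (D : A →ₗ[ℝ] A) (e u : A) (f : A⟦X⟧) :
    coeff 0 (laxOp D e u f) = -(e * coeff 0 f - coeff 0 f * e) := by
  simp [laxOp]

theorem coeff_laxOp_succ (D : A →ₗ[ℝ] A) (e u : A) (f : A⟦X⟧) (k : ℕ) :
    coeff (k + 1) (laxOp D e u f) =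
      nabla D u (coeff k f) - (e * coeff (k + 1) f - coeff (k + 1) f * e) := by
  simp [laxOp, nabla, coeff_succ_X_mul]

/-- A derivation plus inner derivations, multiplied by the central variable z where needed, is a
derivation. -/
theorem laxOp_mul {D : A →ₗ[ℝ] A} (hD : ∀ a b, D (a * b) = D a * b + a * D b) (e u : A)
    (f g : A⟦X⟧) : laxOp D e u (f * g) = laxOp D e u f * g + f * laxOp D e u g := by
  have hX : ∀ h : A⟦X⟧, f * (X * h) = X * (f * h) := fun h => by
    rw [← mul_assoc, (commute_X f).eq, mul_assoc]
  simp only [laxOp, hat_mul hD, mul_sub, sub_mul, mul_add, add_mul, mul_assoc, hX]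
  abel

theorem laxOp_sub (D : A →ₗ[ℝ] A) (e u : A)
    (f g : A⟦X⟧) : laxOp D e u (f - g) = laxOp D e u f - laxOp D e u g := by
  have : hat D (f - g) = hat D f - hat D g := by ext n; simp
  simp only [laxOp, this, mul_sub, sub_mul, mul_add]
  abel

/-- `M = -e + M₁ z + M₂ z² + ⋯` commutes with `D + u - e / z` and satisfies `M ^ 3 = M`. -/
structure IsResolvent (D : A →ₗ[ℝ] A) (e u : A) (M : A⟦X⟧) : Prop where
  coeff_zero : coeff 0 M = -e
  cube : M * M * M = M
  lax : ∀ k, nabla D u (coeff k M) = e * coeff (k + 1) M - coeff (k + 1) M * e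

theorem IsResolvent.laxOp_eq {D : A →ₗ[ℝ] A} {e u : A} {M : A⟦X⟧} (h : IsResolvent D e u M) :
    laxOp D e u M = 0 := by
  ext k
  cases k with
  | zero => rw [coeff_laxOp_zero, h.coeff_zero]; simp
  | succ k => rw [coeff_laxOp_succ, h.lax, sub_self, map_zero]

/-- As d commutes with e, the linearized cubic equation says 3e²d = d. Multiplying by e² gives 3e²d
= e²d, hence e²d = 0 and d = 0. -/
theorem eq_zero_of_cube {e d : A} (he : e * (e * e) = e) (h : e * d = d * e)
    (h3 : e * (e * d) + e * (d * e) + d * (e * e) = d) : d = 0 := by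
  rw [← h, ← mul_assoc d, ← h, mul_assoc e d, ← h] at h3
  have h5 : ∀ x, e * (e * (e * x)) = e * x := fun x => by
    rw [← mul_assoc e e x, ← mul_assoc e (e * e), he]
  have h4 := congrArg (fun x => e * (e * x)) h3
  simp only [mul_add, h5] at h4
  have h6 : (2 : ℝ) • (e * (e * d)) = 0 := by
    linear_combination (norm := module) h4
  have h7 : e * (e * d) = 0 := (smul_eq_zero_iff_right (by norm_num)).1 h6
  rw [← h3, h7]; simp

theorem IsResolvent.unique {D : A →ₗ[ℝ] A} {e u : A} {M M' : A⟦X⟧} (he : e * (e * e) = e)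
    (h : IsResolvent D e u M) (h' : IsResolvent D e u M') : M = M' := by
  ext k
  induction k using Nat.strong_induction_on with
  | _ k ih =>
    cases k with
    | zero => rw [h.coeff_zero, h'.coeff_zero]
    | succ k =>
      rw [← sub_eq_zero, ← map_sub]
      have hF : ∀ j < k + 1, coeff j (M - M') = 0 := fun j hj => by
        rw [map_sub, ih j hj, sub_self]
      -- Telescoping M³ - M'³: at the lowest possibly nonzero order the difference solves the cubic
      -- equation linearized at -e, while the Lax equation makes it commute with e.
      have h1 : M - M' = (M - M') * (M * M) + M' * ((M - M') * M) + M' * M' * (M - M') := by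
        nth_rewrite 1 [← h.cube, ← h'.cube]; noncomm_ring
      have h2 := congrArg (coeff (k + 1)) h1
      have h3 := coeff_mul_low_left hF M
      rw [map_add, map_add, (coeff_mul_low_left hF _).2, (coeff_mul_low_right h3.1 _).2, h3.2,
        (coeff_mul_low_right hF _).2] at h2
      simp only [coeff_zero_mul_eq, h.coeff_zero,
        h'.coeff_zero] at h2
      refine eq_zero_of_cube he ?_ ?_
      · have h4 := h.lax k
        rw [ih k (Nat.lt_succ_self k), h'.lax k] at h4
        rw [map_sub]
        linear_combination (norm := noncomm_ring) -h4
      · rw [← sub_eq_zero]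
        rw [← sub_eq_zero] at h2
        linear_combination (norm := noncomm_ring) -h2

/-- Conjugating e preserves e³ = e, so commutators with e solve the linearized equation. -/
theorem cube_lie {e : A} (he : e * (e * e) = e) (y : A) :
    e * (e * (e * y - y * e)) + e * ((e * y - y * e) * e) + (e * y - y * e) * (e * e)
      - (e * y - y * e) = 0 := by
  have h5 : ∀ x, e * (e * (e * x)) = e * x := fun x => by
    rw [← mul_assoc e e x, ← mul_assoc e (e * e), he]
  simp only [mul_sub, sub_mul, mul_assoc, h5, he]
  abel

theorem exists_lie_of_cube {e R S : A} (he : e * (e * e) = e)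
    (h : e * (e * R) + e * (R * e) + R * (e * e) - R = -(e * S - S * e)) :
    ∃ y, R = e * (e * y - y * e) - (e * y - y * e) * e := by
  have h5 : ∀ x, e * (e * (e * x)) = e * x := fun x => by
    rw [← mul_assoc e e x, ← mul_assoc e (e * e), he]
  let ad : A → A := fun x => e * x - x * e
  -- Because e has eigenvalues in {0, 1, -1}, ad e has eigenvalues in {0, ±1, ±2}, and π = (ad² -
  -- 1)(ad² - 4) is four times the projector onto the kernel of ad e. It commutes with the
  -- linearized cube, so the hypothesis forces π R = 0, and R is then recovered from ad² R and ad⁴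
  -- R.
  let π : A → A := fun x => ad (ad (ad (ad x))) - (5 : ℝ) • ad (ad x) + (4 : ℝ) • x
  have hπ : ∀ x, ad (π x) = 0 := fun x => by
    simp only [π, ad, mul_sub, sub_mul, mul_add, add_mul, mul_assoc, h5, he, mul_smul_comm,
      smul_mul_assoc, smul_sub]
    module
  have hπad : ∀ x, π (ad x) = 0 := fun x => by
    rw [← hπ x]
    simp only [π, ad, mul_sub, sub_mul, mul_add, add_mul, mul_assoc, h5, he, mul_smul_comm,
      smul_mul_assoc, smul_sub]
    abel
  have hR : π R = 0 := by
    refine eq_zero_of_cube he (sub_eq_zero.1 (hπ R)) ?_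
    have h1 : π (e * (e * R) + e * (R * e) + R * (e * e) - R) = 0 := by
      rw [h, ← hπad (-S)]; simp only [ad]; congr 1; noncomm_ring
    rw [← sub_eq_zero, ← h1]
    simp only [π, ad, mul_sub, sub_mul, mul_add, add_mul, mul_assoc, h5, he, mul_smul_comm,
      smul_mul_assoc, smul_sub, smul_add]
    abel
  refine ⟨(1 / 4 : ℝ) • ((5 : ℝ) • R - ad (ad R)), ?_⟩
  have h2 : R = (1 / 4 : ℝ) • ((5 : ℝ) • ad (ad R) - ad (ad (ad (ad R)))) := by
    simp only [π] at hR
    linear_combination (norm := module) (1 / 4 : ℝ) • hR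
  nth_rewrite 1 [h2]
  simp only [ad, mul_sub, sub_mul, mul_smul_comm, smul_mul_assoc, smul_sub, mul_assoc]
  abel

/-- The next coefficient must solve two equations at once, the Lax equation with right-hand side R
and the cubic one with defect S. The part of a in the image of ad e serves the former, the part
commuting with e the latter; the hypothesis is their compatibility. -/
theorem exists_next {e R S : A} (he : e * (e * e) = e)
    (h : e * (e * R) + e * (R * e) + R * (e * e) - R = -(e * S - S * e)) :
    ∃ a, R = e * a - a * e ∧ S + (e * (e * a) + e * (a * e) + a * (e * e) - a) = 0 := by
  obtain ⟨y, hy⟩ := exists_lie_of_cube he h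
  have h5 : ∀ x, e * (e * (e * x)) = e * x := fun x => by
    rw [← mul_assoc e e x, ← mul_assoc e (e * e), he]
  have h1 := cube_lie he y
  rw [hy, cube_lie he] at h
  have hS : S * e = e * S := by linear_combination (norm := abel) -h
  have hS' : ∀ x, S * (e * x) = e * (S * x) := fun x => by rw [← mul_assoc, hS, mul_assoc]
  -- On elements c commuting with e the linearized cube is 3e²c - c; since e⁴ = e², it takes S -
  -- (3/2)e²S to -S.
  refine ⟨(e * y - y * e) + (S - (3 / 2 : ℝ) • (e * (e * S))), ?_, ?_⟩
  · rw [hy]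
    simp only [mul_sub, sub_mul, mul_add, add_mul, mul_assoc, hS, mul_smul_comm, smul_mul_assoc, h5]
    abel
  · have h2 : e * (e * (S - (3 / 2 : ℝ) • (e * (e * S))))
        + e * ((S - (3 / 2 : ℝ) • (e * (e * S))) * e) + (S - (3 / 2 : ℝ) • (e * (e * S))) * (e * e)
        - (S - (3 / 2 : ℝ) • (e * (e * S))) = -S := by
      simp only [mul_sub, sub_mul, mul_assoc, hS, hS', mul_smul_comm,
        smul_mul_assoc, h5]
      module
    linear_combination (norm := noncomm_ring) h1 + h2

theorem exists_isResolvent {D : A →ₗ[ℝ] A} (hD : ∀ a b, D (a * b) = D a * b + a * D b) {e u : A}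
    (he : e * (e * e) = e) : ∃ M, IsResolvent D e u M := by
  -- N is a polynomial of degree at most k in z that solves both equations up to order k.
  let Inv : ℕ → A⟦X⟧ → Prop := fun k N => coeff 0 N = -e ∧ (∀ j > k, coeff j N = 0) ∧
    (∀ j < k, nabla D u (coeff j N) = e * coeff (j + 1) N - coeff (j + 1) N * e) ∧
    ∀ j ≤ k, coeff j (N * N * N - N) = 0
  have step : ∀ k N, Inv k N → ∃ N', Inv (k + 1) N' ∧ ∀ j ≤ k, coeff j N' = coeff j N := by
    rintro k N ⟨h0, hhigh, hlax, hcube⟩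
    have hL0 : ∀ j < k + 1, coeff j (laxOp D e u N) = 0 := by
      intro j hj
      cases j with
      | zero => rw [coeff_laxOp_zero, h0]; simp
      | succ j => rw [coeff_laxOp_succ, hlax j (by omega), sub_self]
    have hL1 : coeff (k + 1) (laxOp D e u N) = nabla D u (coeff k N) := by
      rw [coeff_laxOp_succ, hhigh (k + 1) (by omega)]; simp
    -- The compatibility needed by `exists_next`: apply the derivation `laxOp` to N³ - N and compare
    -- coefficients at order k + 1, computed directly and by the Leibniz rule.
    have hc := coeff_laxOp_succ D e u (N * N * N - N) k
    have h3 := coeff_mul_low_left hL0 N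
    have hexp : laxOp D e u (N * N * N - N) = laxOp D e u N * (N * N) + N * (laxOp D e u N * N)
        + N * N * laxOp D e u N - laxOp D e u N := by
      rw [laxOp_sub, laxOp_mul hD, laxOp_mul hD]; noncomm_ring
    have hz : nabla D u (0 : A) = 0 := by simp [nabla]
    rw [hexp, map_sub, map_add, map_add, (coeff_mul_low_left hL0 _).2,
      (coeff_mul_low_right h3.1 _).2, h3.2, (coeff_mul_low_right hL0 _).2, hL1,
      hcube k le_rfl, hz, zero_sub] at hc
    simp only [coeff_zero_mul_eq, h0] at hc
    obtain ⟨a, ha1, ha2⟩ := exists_next (S := coeff (k + 1) (N * N * N - N))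
      (R := nabla D u (coeff k N)) he (by rw [← hc]; noncomm_ring)
    have hF : ∀ j < k + 1, coeff j (monomial (k + 1) a) = 0 := fun j hj => by
      rw [coeff_monomial, if_neg (by omega)]
    have hF1 : coeff (k + 1) (monomial (k + 1) a) = a := coeff_monomial_same _ _
    have hlow : ∀ j ≤ k, coeff j (N + monomial (k + 1) a) = coeff j N := fun j hj => by
      rw [map_add, hF j (by omega), add_zero]
    have htop : coeff (k + 1) (N + monomial (k + 1) a) = a := by
      rw [map_add, hF1, hhigh _ (by omega), zero_add]
    refine ⟨N + monomial (k + 1) a, ⟨?_, fun j hj => ?_, fun j hj => ?_, fun j hj => ?_⟩, hlow⟩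
    · rw [hlow 0 (by omega), h0]
    · rw [map_add, coeff_monomial, if_neg (by omega), hhigh j (by omega), add_zero]
    · rcases Nat.lt_succ_iff_lt_or_eq.1 hj with h | rfl
      · rw [hlow j (by omega), hlow (j + 1) (by omega), hlax j h]
      · rw [hlow j le_rfl, htop, ha1]
    · set F := monomial (k + 1) a with hFdef
      have hexp2 : (N + F) * (N + F) * (N + F) - (N + F) = (N * N * N - N)
          + (F * ((N + F) * (N + F)) + N * (F * (N + F)) + N * N * F - F) := by noncomm_ring
      have h4 := coeff_mul_low_left hF (N + F)
      rcases Nat.lt_succ_iff_lt_or_eq.1 (Nat.lt_succ_of_le hj) with h | rfl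
      · rw [hexp2, map_add, hcube j (by omega), map_sub, map_add, map_add,
          (coeff_mul_low_left hF _).1 j h, (coeff_mul_low_right h4.1 _).1 j h,
          (coeff_mul_low_right hF _).1 j h, hF j h]
        simp
      · have h6 : coeff (k + 1) (F * ((N + F) * (N + F)) + N * (F * (N + F)) + N * N * F - F)
            = e * (e * a) + e * (a * e) + a * (e * e) - a := by
          rw [map_sub, map_add, map_add, (coeff_mul_low_left hF _).2,
            (coeff_mul_low_right h4.1 _).2, h4.2, (coeff_mul_low_right hF _).2, hF1]
          simp only [coeff_zero_mul_eq, hlow 0 (by omega), h0]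
          noncomm_ring
        rw [hexp2, map_add, h6, ha2]
  have base : Inv 0 (C (-e)) := by
    refine ⟨by simp, fun j hj => ?_, fun j hj => absurd hj (by omega), fun j hj => ?_⟩
    · rw [coeff_C, if_neg (by omega)]
    · obtain rfl : j = 0 := by omega
      simp [he, mul_assoc]
  choose! f hf hf' using step
  let N : ℕ → A⟦X⟧ := fun k => Nat.rec (C (-e)) (fun k N => f k N) k
  have hN : ∀ k, Inv k (N k) := fun k => by
    induction k with
    | zero => exact base
    | succ k ih => exact hf k (N k) ih
  have hstab : ∀ k d j, j ≤ k → coeff j (N (k + d)) = coeff j (N k) := fun k d j hj => by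
    induction d with
    | zero => rfl
    | succ d ih => rw [← ih]; exact hf' (k + d) (N (k + d)) (hN _) j (by omega)
  -- Later steps leave lower coefficients unchanged, so the diagonal is the limit.
  let M : A⟦X⟧ := PowerSeries.mk fun k => coeff k (N k)
  have hM : ∀ k, ∀ j ≤ k, coeff j M = coeff j (N k) := fun k j hj => by
    obtain ⟨d, rfl⟩ := Nat.exists_eq_add_of_le hj
    rw [hstab j d j le_rfl]; simp [M]
  refine ⟨M, ?_, ?_, fun k => ?_⟩
  · rw [hM 0 0 le_rfl, (hN 0).1]
  · ext k
    rw [coeff_mul_congr (coeff_mul_congr (hM k) (hM k)) (hM k) k le_rfl, hM k k le_rfl,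
      ← sub_eq_zero, ← map_sub, (hN k).2.2.2 k le_rfl]
  · rw [hM (k + 1) k (by omega), hM (k + 1) (k + 1) le_rfl, (hN (k + 1)).2.2.1 k (by omega)]

/-- In the eigenblocks of M with eigenvalues λ, μ in {0, 1, -1}, the hypothesis leaves only blocks
with λ² + λμ + μ² = 1, and there λ ≠ μ. The witness multiplies a block by (λ - μ)(1 + (3/4)λμ), and
(λ - μ)²(1 + (3/4)λμ) = 1 on all of them. -/
theorem exists_lie_of_tangent {R : Type*} [Ring R] [Algebra ℝ R] {M x : R} (hM : M * M * M = M)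
    (h : x * M * M + M * x * M + M * M * x = x) : ∃ y, x = M * y - y * M := by
  have hM' : M * (M * M) = M := by rw [← mul_assoc, hM]
  have h5 : ∀ z, M * (M * (M * z)) = M * z := fun z => by
    rw [← mul_assoc M M z, ← mul_assoc M (M * M), hM']
  have h1 : M * (M * (x * (M * M))) + M * (x * M) = 0 := by
    have := congrArg (fun z => M * z * M) h
    simp only [mul_add, add_mul, mul_assoc, hM', h5] at this
    linear_combination (norm := noncomm_ring) this
  refine ⟨(M * x - x * M) + (3 / 4 : ℝ) • (M * (M * x * M) - (M * x * M) * M), ?_⟩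
  simp only [mul_sub, sub_mul, mul_add, add_mul, mul_assoc, mul_smul_comm, smul_mul_assoc, hM',
    h5, smul_sub] at h ⊢
  linear_combination (norm := module) (3 / 2 : ℝ) • h1 - h

/-! ### The variational identity for the resolvent -/

section Variation

variable {Q : Type*} [AddCommGroup Q] [Module ℝ Q]

theorem trace_coeff_mul_comm {τ : A →ₗ[ℝ] Q} (hτ : ∀ a b, τ (a * b) = τ (b * a)) (k : ℕ)
    (f g : A⟦X⟧) : τ (coeff k (f * g)) = τ (coeff k (g * f)) := by
  rw [coeff_mul, coeff_mul, map_sum, map_sum]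
  exact Finset.sum_nbij' Prod.swap Prod.swap (by simp [add_comm]) (by simp [add_comm]) (by simp)
    (by simp) fun p _ => hτ _ _

theorem trace_coeff_laxOp {D : A →ₗ[ℝ] A} {τ : A →ₗ[ℝ] Q} (hτ : ∀ a b, τ (a * b) = τ (b * a))
    (hτD : ∀ a, τ (D a) = 0) (e u : A) (k : ℕ) (f : A⟦X⟧) :
    τ (coeff k (laxOp D e u f)) = 0 := by
  cases k with
  | zero => rw [coeff_laxOp_zero, map_neg, map_sub, hτ, sub_self, neg_zero]
  | succ k => rw [coeff_laxOp_succ, map_sub, map_sub, trace_nabla hτ hτD, hτ e, sub_self, sub_zero]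

/-- The variation of `⟨M, e⟩`. -/
theorem IsResolvent.trace_variation {D δ : A →ₗ[ℝ] A} (hD : ∀ a b, D (a * b) = D a * b + a * D b)
    (hδ : ∀ a b, δ (a * b) = δ a * b + a * δ b) (hδD : ∀ a, δ (D a) = D (δ a))
    {τ : A →ₗ[ℝ] Q} (hτ : ∀ a b, τ (a * b) = τ (b * a)) (hτD : ∀ a, τ (D a) = 0) {e u : A}
    (hδe : δ e = 0) {M : A⟦X⟧} (h : IsResolvent D e u M) (k : ℕ) :
    (k : ℝ) • τ (δ u * coeff k M) = τ (δ (coeff (k + 1) M) * e) := by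
  have hT := trace_coeff_mul_comm hτ
  have hM := h.cube
  have hx : hat δ M * M * M + M * hat δ M * M + M * M * hat δ M = hat δ M := by
    have := congrArg (hat δ) hM
    rwa [hat_mul hδ, hat_mul hδ, add_mul] at this
  have hy : eulerZ M * M * M + M * eulerZ M * M + M * M * eulerZ M = eulerZ M := by
    have := congrArg eulerZ hM
    rwa [eulerZ_mul, eulerZ_mul, add_mul] at this
  -- Both δM and z dM/dz are tangent to the solutions of M³ = M, hence commutators with M.
  obtain ⟨N, hN⟩ := exists_lie_of_tangent hM hx
  obtain ⟨N', hN'⟩ := exists_lie_of_tangent hM hy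
  have hLδ : laxOp D e u (hat δ M) = -(X * (C (δ u) * M - M * C (δ u))) := by
    rw [eq_neg_iff_add_eq_zero]
    ext k
    have h1 := congrArg δ (h.lax k)
    cases k with
    | zero =>
      rw [map_add, coeff_laxOp_zero, coeff_hat, h.coeff_zero, map_neg, hδe]
      simp
    | succ k =>
      have h1 := congrArg δ (h.lax k)
      rw [map_add, coeff_laxOp_succ, coeff_succ_X_mul]
      simp only [nabla, map_add, map_sub, hδ, hδD, hδe, zero_mul, mul_zero, zero_add,
        add_zero] at h1
      simp only [nabla, coeff_hat, map_sub, coeff_C_mul, coeff_mul_C, map_zero]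
      linear_combination (norm := abel) h1
  have hLθ : laxOp D e u (eulerZ M) = -(C e * M - M * C e) := by
    ext k
    cases k with
    | zero =>
      rw [coeff_laxOp_zero, coeff_eulerZ, map_neg, map_sub, coeff_C_mul, coeff_mul_C, h.coeff_zero]
      simp
    | succ k =>
      rw [coeff_laxOp_succ]
      simp only [nabla, coeff_eulerZ, map_neg, map_sub, coeff_C_mul, coeff_mul_C, map_smul,
        mul_smul_comm, smul_mul_assoc, Nat.cast_add, Nat.cast_one]
      have h1 := h.lax k
      rw [nabla] at h1
      linear_combination (norm := module) (k : ℝ) • h1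
  have hz : ∀ f : A⟦X⟧, M * (X * f) = X * (M * f) := fun f => by
    rw [← mul_assoc, (commute_X M).eq, mul_assoc]
  -- Varying the Lax equation shows that this P commutes with M, so it is trace-orthogonal to every
  -- commutator with M, in particular to z dM/dz. Integrating the resulting identity by parts gives
  -- the claim.
  set P := laxOp D e u N - X * C (δ u) with hP
  have hcomm : M * P = P * M := by
    have h1 : laxOp D e u (hat δ M) = M * laxOp D e u N - laxOp D e u N * M := by
      rw [hN, laxOp_sub, laxOp_mul hD, laxOp_mul hD, h.laxOp_eq]; simp
    rw [hLδ] at h1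
    rw [hP, mul_sub, sub_mul, hz, mul_assoc]
    rw [mul_sub] at h1
    linear_combination (norm := abel) -h1
  have h1 : τ (coeff (k + 1) (P * eulerZ M)) = 0 := by
    rw [hN', mul_sub, map_sub, map_sub, ← mul_assoc, ← hcomm, mul_assoc, hT, mul_assoc, sub_self]
  have h2 : τ (coeff (k + 1) (laxOp D e u N * eulerZ M))
      = -τ (coeff (k + 1) (N * laxOp D e u (eulerZ M))) := by
    rw [eq_neg_iff_add_eq_zero, ← map_add, ← map_add, ← laxOp_mul hD, trace_coeff_laxOp hτ hτD]
  have h3 : τ (coeff (k + 1) (hat δ M * C e)) = τ (coeff (k + 1) (N * (C e * M - M * C e))) := by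
    rw [hN, sub_mul, mul_sub, map_sub, map_sub, map_sub, map_sub, ← mul_assoc N M, mul_assoc M, hT,
      mul_assoc N]
  rw [hP, sub_mul, map_sub, map_sub, h2, hLθ, mul_neg, map_neg, map_neg, neg_neg, ← h3,
    mul_assoc, coeff_succ_X_mul, coeff_C_mul, coeff_mul_C, coeff_hat, coeff_eulerZ,
    mul_smul_comm, map_smul, sub_eq_zero] at h1
  exact h1.symm

end Variation

end Resolvent
end HPnFlow
end

noncomputable section

namespace HPnFlow

/-! ## Differential polynomials -/

section Jets

open MvPolynomial

variable {m : ℕ}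

@[simp] theorem Dx_X (a : Comp m × ℕ) : Dx m (X a) = X (a.1, a.2 + 1) := by
  simp [Dx, mkDerivation_X]

theorem Dx_iterate_X (v : Comp m) (k j : ℕ) : (Dx m)^[k] (X (v, j)) = X (v, j + k) := by
  induction k with
  | zero => rfl
  | succ k ih => rw [Function.iterate_succ_apply', ih, Dx_X]; rfl

theorem mem_noConst {f : Jet m} : f ∈ noConst m ↔ constantCoeff f = 0 := by
  rw [noConst, LinearMap.mem_ker]; rfl

theorem Dx_mem_noConst (f : Jet m) : Dx m f ∈ noConst m := by
  rw [mem_noConst]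
  induction f using MvPolynomial.induction_on with
  | C a => simp [← MvPolynomial.algebraMap_eq]
  | add p q hp hq => simp [hp, hq]
  | mul_X p a hp => simp [hp]

theorem pderiv_zero_Dx (v : Comp m) (f : Jet m) :
    pderiv (v, 0) (Dx m f) = Dx m (pderiv (v, 0) f) := by
  have h : ⁅(pderiv (v, 0) : Derivation ℝ (Jet m) (Jet m)), Dx m⁆ = 0 := by
    refine MvPolynomial.derivation_ext fun a => ?_
    rw [Derivation.commutator_apply, Dx_X, pderiv_X, pderiv_X]
    simp only [Pi.single_apply, Prod.ext_iff, apply_ite (Dx m), Derivation.map_one_eq_zero,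
      map_zero, ite_self, sub_zero, Derivation.zero_apply,
      Nat.add_eq_zero_iff, one_ne_zero, and_false, if_false]
  have := DFunLike.congr_fun h f
  rwa [Derivation.commutator_apply, Derivation.zero_apply, sub_eq_zero] at this

theorem pderiv_succ_Dx (v : Comp m) (k : ℕ) (f : Jet m) :
    pderiv (v, k + 1) (Dx m f) = Dx m (pderiv (v, k + 1) f) + pderiv (v, k) f := by
  have h : ⁅(pderiv (v, k + 1) : Derivation ℝ (Jet m) (Jet m)), Dx m⁆ = pderiv (v, k) := by
    refine MvPolynomial.derivation_ext fun a => ?_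
    rw [Derivation.commutator_apply, Dx_X, pderiv_X, pderiv_X, pderiv_X]
    simp only [Pi.single_apply, Prod.ext_iff, apply_ite (Dx m), Derivation.map_one_eq_zero,
      map_zero, ite_self, sub_zero, Nat.add_right_cancel_iff]
  have := DFunLike.congr_fun h f
  rwa [Derivation.commutator_apply, sub_eq_iff_eq_add'] at this

theorem exists_order (v : Comp m) (f : Jet m) : ∃ r, ∀ j ≥ r, pderiv (v, j) f = 0 := by
  classical
  refine ⟨f.vars.sup Prod.snd + 1, fun j hj => pderiv_eq_zero_of_notMem_vars fun h => ?_⟩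
  have := Finset.le_sup (f := Prod.snd) h
  simp at this
  omega

/-- The total derivative raises the order in each variable by one; downward induction from the order
of f. -/
theorem pderiv_eq_zero_of_Dx {v : Comp m} {f : Jet m} {s : ℕ}
    (h : ∀ j > s, pderiv (v, j) (Dx m f) = 0) : ∀ j ≥ s, pderiv (v, j) f = 0 := by
  obtain ⟨r, hr⟩ := exists_order v f
  have key : ∀ d j, s ≤ j → r ≤ j + d → pderiv (v, j) f = 0 := fun d => by
    induction d with
    | zero => exact fun j _ hj => hr j hj
    | succ d ih =>
      intro j hj hd
      have h1 := pderiv_succ_Dx v j f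
      rw [h _ (by omega), ih (j + 1) (by omega) (by omega), map_zero, zero_add] at h1
      exact h1.symm
  exact fun j hj => key r j hj (by omega)

theorem eq_C_of_pderiv {f : Jet m} (h : ∀ a, pderiv a f = 0) : f = C (constantCoeff f) := by
  classical
  ext d
  rw [coeff_C]
  split_ifs with hd
  · rw [← hd]; rfl
  · obtain ⟨i, hi⟩ := Finsupp.ne_iff.1 (Ne.symm hd)
    have h1 := coeff_pderiv (i := i) f (d - Finsupp.single i 1)
    have h2 : d - Finsupp.single i 1 + Finsupp.single i 1 = d :=
      tsub_add_cancel_of_le (Finsupp.single_le_iff.2 (Nat.one_le_iff_ne_zero.2 hi))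
    rw [h, h2, coeff_zero] at h1
    exact (mul_eq_zero.1 h1.symm).resolve_right (by positivity)

theorem eq_C_of_Dx_eq_zero {f : Jet m} (h : Dx m f = 0) : f = C (constantCoeff f) :=
  eq_C_of_pderiv fun a => pderiv_eq_zero_of_Dx (s := 0) (v := a.1) (by simp [h]) a.2 (by omega)

/-- The kernel of the total derivative consists of the constants. This makes the antiderivatives
single-valued on differential polynomials. -/
theorem Dx_injOn_noConst {f g : Jet m} (hf : f ∈ noConst m) (hg : g ∈ noConst m)
    (h : Dx m f = Dx m g) : f = g := by
  rw [← sub_eq_zero, eq_C_of_Dx_eq_zero (f := f - g) (by rw [map_sub, h, sub_self]),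
    mem_noConst.1 (sub_mem hf hg), C_0]

theorem pderiv_comm (a b : Comp m × ℕ) (f : Jet m) :
    pderiv a (pderiv b f) = pderiv b (pderiv a f) := by
  have h : ⁅(pderiv a : Derivation ℝ (Jet m) (Jet m)),
      (pderiv b : Derivation ℝ (Jet m) (Jet m))⁆ = 0 := by
    refine MvPolynomial.derivation_ext fun c => ?_
    rw [Derivation.commutator_apply, pderiv_X, pderiv_X]
    simp [Pi.single_apply, apply_ite]
  have := DFunLike.congr_fun h f
  rwa [Derivation.commutator_apply, Derivation.zero_apply, sub_eq_zero] at this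

/-- A differential polynomial all of whose multiples are total derivatives vanishes. -/
theorem eq_zero_of_forall_mul_total {g : Jet m} (h : ∀ a, ∃ f, Dx m f = a * g) : g = 0 := by
  -- Multiply g by a derivative of another component v' of order K + 1, beyond all those of v' in g.
  -- If the product is D f, then f has order at most K in v' and contains no v_s, and g is the
  -- derivative of f by v'_K; so g contains no v_s either.
  have key : ∀ v s, (∀ j > s, pderiv (v, j) g = 0) → pderiv (v, s) g = 0 := fun v s hs => by
    obtain ⟨v', hv'⟩ : ∃ v' : Comp m, v' ≠ v := by
      by_cases h0 : v = Sum.inl 0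
      · exact ⟨Sum.inl 1, by rw [h0]; simp⟩
      · exact ⟨Sum.inl 0, fun h => h0 h.symm⟩
    obtain ⟨K, hK⟩ := exists_order v' g
    obtain ⟨f, hf⟩ := h (X (v', K + 1))
    have h1 : pderiv (v, s) f = 0 := by
      refine pderiv_eq_zero_of_Dx (fun j hj => ?_) s le_rfl
      rw [hf, Derivation.leibniz, hs j hj, pderiv_X_of_ne (by simp [hv'])]
      simp
    have h2 : pderiv (v', K + 1) f = 0 := by
      refine pderiv_eq_zero_of_Dx (fun j hj => ?_) _ le_rfl
      rw [hf, Derivation.leibniz, hK j (by omega), pderiv_X_of_ne (by simp; omega)]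
      simp
    have h3 := pderiv_succ_Dx v' K f
    rw [hf, Derivation.leibniz, hK _ (by omega), pderiv_X_self, h2] at h3
    simp only [smul_eq_mul, mul_zero, zero_add, mul_one, map_zero] at h3
    rw [h3, pderiv_comm, h1, map_zero]
  have hall : ∀ a, pderiv a g = 0 := by
    rintro ⟨v, s⟩
    obtain ⟨r, hr⟩ := exists_order v g
    have : ∀ d j, r ≤ j + d → pderiv (v, j) g = 0 := fun d => by
      induction d with
      | zero => exact fun j hj => hr j hj
      | succ d ih => exact fun j hj => key v j fun i hi => ih i (by omega)
    exact this r s (by omega)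
  have hg := eq_C_of_pderiv hall
  -- What remains is a constant g. Differentiating D f = v₀ g by v₀ exhibits g as a total
  -- derivative, which has no constant term.
  obtain ⟨f, hf⟩ := h (X (Sum.inl 0, 0))
  have h1 := pderiv_zero_Dx (Sum.inl 0) f
  rw [hf, Derivation.leibniz, hall, pderiv_X_self] at h1
  simp only [smul_eq_mul, mul_zero, zero_add, mul_one] at h1
  have h2 := Dx_mem_noConst (pderiv (Sum.inl 0, 0) f)
  rw [← h1, mem_noConst] at h2
  rw [hg, h2, C_0]

theorem euler_Dx (v : Comp m) (f : Jet m) : euler v (Dx m f) = 0 := by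
  obtain ⟨r, hr⟩ := exists_order v f
  have h0 : ∀ k : ℕ, (Dx m)^[k] (0 : Jet m) = 0 := fun k =>
    Function.iterate_fixed (map_zero (Dx m)) k
  have hadd : ∀ (k : ℕ) (a b : Jet m), (Dx m)^[k] (a + b) = (Dx m)^[k] a + (Dx m)^[k] b :=
    fun k a b => by
      induction k with
      | zero => rfl
      | succ k ih =>
        rw [Function.iterate_succ_apply', ih, map_add, ← Function.iterate_succ_apply' (Dx m),
          ← Function.iterate_succ_apply' (Dx m)]
  rw [euler, finsum_eq_sum_of_support_subset (s := Finset.range (r + 1))]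
  -- The commutation rule of ∂/∂v_k with D makes the Euler sum telescope.
  · have key : ∀ n, ∑ k ∈ Finset.range (n + 1), (-1 : ℝ) ^ k • (Dx m)^[k] (pderiv (v, k) (Dx m f))
        = (-1 : ℝ) ^ n • (Dx m)^[n + 1] (pderiv (v, n) f) := fun n => by
      induction n with
      | zero => simp [pderiv_zero_Dx]
      | succ n ih =>
        rw [Finset.sum_range_succ, ih, pderiv_succ_Dx, hadd,
          Function.iterate_succ_apply (Dx m) (n + 1),
          pow_succ]
        module
    rw [key, hr r le_rfl, h0, smul_zero]
  · intro k hk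
    by_contra hn
    refine hk ?_
    obtain ⟨k, rfl⟩ : ∃ j, k = j + 1 := ⟨k - 1, by simp at hn; omega⟩
    simp at hn
    simp only []
    rw [pderiv_succ_Dx, hr _ (by omega), hr _ (by omega)]
    simp [h0]

/-- The evolutionary derivation with characteristic `a` in the component `v`. -/
def evo (v : Comp m) (a : Jet m) : Derivation ℝ (Jet m) (Jet m) :=
  mkDerivation ℝ fun b => if b.1 = v then (Dx m)^[b.2] a else 0

theorem evo_Dx (v : Comp m) (a f : Jet m) : evo v a (Dx m f) = Dx m (evo v a f) := by
  have h : ⁅evo v a, Dx m⁆ = 0 := by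
    refine MvPolynomial.derivation_ext fun c => ?_
    rw [Derivation.commutator_apply, Dx_X, evo, mkDerivation_X, mkDerivation_X,
      Derivation.zero_apply, sub_eq_zero]
    split_ifs with h
    · rw [Function.iterate_succ_apply']
    · simp
  have := DFunLike.congr_fun h f
  rwa [Derivation.commutator_apply, Derivation.zero_apply, sub_eq_zero] at this

theorem exists_by_parts (k : ℕ) : ∀ a b : Jet m, ∃ g, Dx m g =
    (Dx m)^[k] a * b - a * ((-1 : ℝ) ^ k • (Dx m)^[k] b) := by
  induction k with
  | zero => exact fun a b => ⟨0, by simp⟩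
  | succ k ih =>
    intro a b
    obtain ⟨g, hg⟩ := ih a (Dx m b)
    refine ⟨(Dx m)^[k] a * b - g, ?_⟩
    rw [map_sub, hg, Derivation.leibniz, ← Function.iterate_succ_apply' (Dx m),
      Function.iterate_succ_apply (Dx m) k b, pow_succ, mul_smul]
    simp only [smul_eq_mul, neg_smul, one_smul, smul_neg, mul_neg]
    ring

/-- The first variation formula, by repeated integration by parts. It lets the Euler operator be
identified by testing against all characteristics a. -/
theorem exists_evo_eq (v : Comp m) (a f : Jet m) :
    ∃ g, Dx m g = evo v a f - a * euler v f := by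
  classical
  set r := f.vars.sup Prod.snd + 1 with hrdef
  have hvars : ∀ b ∈ f.vars, b.2 < r := fun b hb =>
    Nat.lt_succ_of_le (Finset.le_sup (f := Prod.snd) hb)
  have hr : ∀ j ≥ r, pderiv (v, j) f = 0 := fun j hj =>
    pderiv_eq_zero_of_notMem_vars fun h => absurd (hvars _ h) (by simp; omega)
  have h0 : ∀ k : ℕ, (Dx m)^[k] (0 : Jet m) = 0 := fun k =>
    Function.iterate_fixed (map_zero (Dx m)) k
  have h1 : euler v f = ∑ k ∈ Finset.range r, (-1 : ℝ) ^ k • (Dx m)^[k] (pderiv (v, k) f) := by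
    rw [euler, finsum_eq_sum_of_support_subset]
    intro k hk
    by_contra hn
    refine hk ?_
    simp at hn
    simp [hr k hn, h0]
  have h2 : evo v a f = ∑ k ∈ Finset.range r, (Dx m)^[k] a * pderiv (v, k) f := by
    let E : Derivation ℝ (Jet m) (Jet m) := ∑ k ∈ Finset.range r, ((Dx m)^[k] a) • pderiv (v, k)
    have hE : ∀ f, E f = ∑ k ∈ Finset.range r, (Dx m)^[k] a * pderiv (v, k) f := fun f => by
      change Derivation.coeFnAddMonoidHom E f = _
      rw [map_sum, Finset.sum_apply]
      rfl
    rw [← hE]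
    refine derivation_eq_of_forall_mem_vars fun b hb => ?_
    rw [hE, evo, mkDerivation_X]
    split_ifs with h
    · rw [Finset.sum_eq_single b.2]
      · rw [← h, pderiv_X_self, mul_one]
      · intro k _ hk
        rw [pderiv_X_of_ne (fun h' => hk (congrArg Prod.snd h').symm), mul_zero]
      · exact fun h' => absurd (Finset.mem_range.2 (hvars b hb)) h'
    · refine (Finset.sum_eq_zero fun k _ => ?_).symm
      rw [pderiv_X_of_ne (fun h' => h (congrArg Prod.fst h')), mul_zero]
  choose g hg using fun k => exists_by_parts (m := m) k a (pderiv (v, k) f)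
  refine ⟨∑ k ∈ Finset.range r, g k, ?_⟩
  rw [map_sum, h1, h2, Finset.mul_sum, ← Finset.sum_sub_distrib]
  exact Finset.sum_congr rfl fun k _ => hg k

end Jets
end HPnFlow
end

noncomputable section

namespace HPnFlow

/-! ## Symmetries of the resolvent -/

section Symmetry

open PowerSeries

variable {A : Type*} [Ring A] [Algebra ℝ A]

/-- Combined with uniqueness, every such ring homomorphism turns into an identity for the
coefficients of the resolvent. -/
theorem IsResolvent.map {A' : Type*} [Ring A'] [Algebra ℝ A'] {D : A →ₗ[ℝ] A} {D' : A' →ₗ[ℝ] A'}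
    {e u : A} {M : A⟦X⟧} (h : IsResolvent D e u M) (φ : A →+* A') (hφ : ∀ a, φ (D a) = D' (φ a)) :
    IsResolvent D' (φ e) (φ u) (PowerSeries.map φ M) := by
  refine ⟨?_, ?_, fun k => ?_⟩
  · rw [coeff_map, h.coeff_zero, map_neg]
  · rw [← map_mul, ← map_mul, h.cube]
  · have := congrArg φ (h.lax k)
    simpa only [nabla, map_add, map_sub, map_mul, hφ, coeff_map] using this

/-- The substitution `z ↦ -z`. -/
def altSeries (f : A⟦X⟧) : A⟦X⟧ := PowerSeries.mk fun k => (-1 : ℝ) ^ k • coeff k f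

@[simp] theorem coeff_altSeries (f : A⟦X⟧) (k : ℕ) :
    coeff k (altSeries f) = (-1 : ℝ) ^ k • coeff k f := by simp [altSeries]

theorem altSeries_mul (f g : A⟦X⟧) : altSeries (f * g) = altSeries f * altSeries g := by
  ext k
  simp only [coeff_altSeries, coeff_mul, Finset.smul_sum]
  refine Finset.sum_congr rfl fun p hp => ?_
  rw [← Finset.HasAntidiagonal.mem_antidiagonal.1 hp, pow_add, smul_mul_smul_comm]

/-- Replacing `e` by `-e` amounts to `M(z) ↦ -M(-z)`. -/
theorem IsResolvent.neg_alt {D : A →ₗ[ℝ] A} {e u : A} {M : A⟦X⟧} (h : IsResolvent D (-e) u M) :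
    IsResolvent D e u (-altSeries M) := by
  refine ⟨?_, ?_, fun k => ?_⟩
  · rw [map_neg, coeff_altSeries, h.coeff_zero]; simp
  · rw [neg_mul_neg, mul_neg, ← altSeries_mul, ← altSeries_mul, h.cube]
  · have h1 := h.lax k
    rw [nabla] at h1
    simp only [nabla, map_neg, coeff_altSeries, map_smul, mul_neg, neg_mul, mul_smul_comm,
      smul_mul_assoc, pow_succ] at h1 ⊢
    linear_combination (norm := module) -(-1 : ℝ) ^ k • h1

/-- The involution acting on coefficients. -/
def starSeries [StarRing A] (f : A⟦X⟧) : A⟦X⟧ := PowerSeries.mk fun k => star (coeff k f)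

@[simp] theorem coeff_starSeries [StarRing A] (f : A⟦X⟧) (k : ℕ) :
    coeff k (starSeries f) = star (coeff k f) := by simp [starSeries]

theorem starSeries_mul [StarRing A] (f g : A⟦X⟧) :
    starSeries (f * g) = starSeries g * starSeries f := by
  ext k
  simp only [coeff_starSeries, coeff_mul, star_sum, star_mul]
  exact Finset.sum_nbij' Prod.swap Prod.swap (by simp [add_comm]) (by simp [add_comm]) (by simp)
    (by simp) fun p _ => rfl

/-- The involution amounts to `M(z) ↦ M(-z)`. -/
theorem IsResolvent.star_alt [StarRing A] {D : A →ₗ[ℝ] A} {e u : A} {M : A⟦X⟧}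
    (h : IsResolvent D e u M) (hD : ∀ a, D (star a) = star (D a)) (he : star e = e)
    (hu : star u = -u) : IsResolvent D e u (altSeries (starSeries M)) := by
  refine ⟨?_, ?_, fun k => ?_⟩
  · simp [h.coeff_zero, he]
  · rw [← altSeries_mul, ← altSeries_mul, ← starSeries_mul, ← starSeries_mul, ← mul_assoc, h.cube]
  · have h1 := congrArg star (h.lax k)
    simp only [nabla, star_add, star_sub, star_mul, he, hu] at h1
    simp only [nabla, coeff_altSeries, coeff_starSeries, map_smul, mul_smul_comm, hD,
      smul_mul_assoc, pow_succ]
    simp only [mul_neg, neg_mul] at h1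
    linear_combination (norm := module) (-1 : ℝ) ^ k • h1

/-- Conjugation by an invertible element. -/
def conjHom (g g' : A) (h : g' * g = 1) (h' : g * g' = 1) : A →+* A where
  toFun x := g * x * g'
  map_one' := by rw [mul_one, h']
  map_mul' x y := by
    rw [mul_assoc (g * x), ← mul_assoc g', ← mul_assoc g', h, one_mul]; simp only [mul_assoc]
  map_zero' := by simp
  map_add' x y := by rw [mul_add, add_mul]

@[simp] theorem conjHom_apply (g g' : A) (h : g' * g = 1) (h' : g * g' = 1) (x : A) :
    conjHom g g' h h' x = g * x * g' := rfl

end Symmetry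

/-! ### Algebra homomorphisms acting on quaternions, pairs and matrices -/

section Map

variable {B B' : Type} [CommRing B] [CommRing B'] [Algebra ℝ B] [Algebra ℝ B'] {m : ℕ}

/-- A homomorphism of algebras acting on quaternions by components. -/
def qMap (φ : B →ₐ[ℝ] B') : ℍ[B] →+* ℍ[B'] :=
  let f : ℍ[B] → ℍ[B'] := fun q => ⟨φ q.re, φ q.imI, φ q.imJ, φ q.imK⟩
  have h0 : ∀ q : ℍ[B], (f q).re = φ q.re := fun _ => rfl
  have h1 : ∀ q : ℍ[B], (f q).imI = φ q.imI := fun _ => rfl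
  have h2 : ∀ q : ℍ[B], (f q).imJ = φ q.imJ := fun _ => rfl
  have h3 : ∀ q : ℍ[B], (f q).imK = φ q.imK := fun _ => rfl
  { toFun := f
    map_one' := by ext <;> simp [h0, h1, h2, h3]
    map_zero' := by ext <;> simp [h0, h1, h2, h3]
    map_mul' := fun x y => by ext <;> simp [h0, h1, h2, h3]
    map_add' := fun x y => by ext <;> simp [h0, h1, h2, h3] }

@[simp] theorem qMap_re (φ : B →ₐ[ℝ] B') (q : ℍ[B]) : (qMap φ q).re = φ q.re := rfl
@[simp] theorem qMap_imI (φ : B →ₐ[ℝ] B') (q : ℍ[B]) : (qMap φ q).imI = φ q.imI := rfl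
@[simp] theorem qMap_imJ (φ : B →ₐ[ℝ] B') (q : ℍ[B]) : (qMap φ q).imJ = φ q.imJ := rfl
@[simp] theorem qMap_imK (φ : B →ₐ[ℝ] B') (q : ℍ[B]) : (qMap φ q).imK = φ q.imK := rfl

theorem qMap_star (φ : B →ₐ[ℝ] B') (q : ℍ[B]) : qMap φ (star q) = star (qMap φ q) := by
  ext <;> simp

theorem qMap_smul (φ : B →ₐ[ℝ] B') (c : ℝ) (q : ℍ[B]) : qMap φ (c • q) = c • qMap φ q := by
  ext <;> simp

/-- A homomorphism of algebras acting on matrices by components. -/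
def matMap (φ : B →ₐ[ℝ] B') : QMat B m →+* QMat B' m := (qMap φ).mapMatrix

@[simp] theorem matMap_apply (φ : B →ₐ[ℝ] B') (X : QMat B m) (i j : Bool ⊕ Fin m) :
    matMap φ X i j = qMap φ (X i j) := rfl

theorem matMap_dMat {D : Derivation ℝ B B} {D' : Derivation ℝ B' B'} {φ : B →ₐ[ℝ] B'}
    (h : ∀ b, φ (D b) = D' (φ b)) (X : QMat B m) : matMap φ (dMat D X) = dMat D' (matMap φ X) := by
  refine Matrix.ext fun i j => ?_
  ext <;> simp [h]

/-- A homomorphism of algebras acting on pairs by components. -/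
def pairMap (φ : B →ₐ[ℝ] B') (f : Pair B m) : Pair B' m := (qMap φ f.1, fun r => qMap φ (f.2 r))

theorem matMap_embH (φ : B →ₐ[ℝ] B') (f : Pair B m) (p : ℍ[B]) (P : Matrix (Fin m) (Fin m) ℍ[B]) :
    matMap φ (embH f p P) = embH (pairMap φ f) (qMap φ p) (P.map (qMap φ)) := by
  refine Matrix.ext fun i j => ?_
  rcases i with (_ | _) | i <;> rcases j with (_ | _) | j <;> simp [embH, pairMap, qMap_star]

theorem matMap_eMat (φ : B →ₐ[ℝ] B') : matMap φ (eMat B m) = eMat B' m := by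
  refine Matrix.ext fun i j => ?_
  rcases i with (_ | _) | i <;> rcases j with (_ | _) | j <;> simp [eMat, embM]

end Map

/-! ### Recovering pairs from even and odd matrices -/

section Decode

variable {B : Type} [CommRing B] [Algebra ℝ B] {m : ℕ}

theorem eMat_cube : eMat B m * (eMat B m * eMat B m) = eMat B m := by
  refine Matrix.ext fun i j => ?_
  rcases i with (_ | _) | i <;> rcases j with (_ | _) | j <;> simp [qmat_mul_apply, eMat, embM]

theorem star_eMat : star (eMat B m) = eMat B m := by
  refine Matrix.ext fun i j => ?_
  rcases i with (_ | _) | i <;> rcases j with (_ | _) | j <;>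
    simp [Matrix.star_apply, eMat, embM]

theorem star_embH {f : Pair B m} {p : ℍ[B]} {P : Matrix (Fin m) (Fin m) ℍ[B]}
    (hf : f.1.re = 0) (hp : p.re = 0) (hP : Pᴴ = -P) : star (embH f p P) = -embH f p P := by
  have hP' : ∀ r s, star (P s r) = -P r s := fun r s => congrFun (congrFun hP r) s
  refine Matrix.ext fun i j => ?_
  rcases i with (_ | _) | i <;> rcases j with (_ | _) | j <;>
    simp [Matrix.star_apply, embH, star_eq_neg_of_re hf, star_eq_neg_of_re hp, hP'] <;> abel

theorem dMat_star (D : Derivation ℝ B B) (X : QMat B m) : dMat D (star X) = star (dMat D X) := by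
  refine Matrix.ext fun i j => ?_
  simp [Matrix.star_apply, dQ_star]

/-- The signs of the symmetric decomposition. -/
def sigVec : Bool ⊕ Fin m → ℍ[B]
  | Sum.inl false => -1
  | _ => 1

variable (B m) in
/-- The signature matrix of the symmetric decomposition. -/
def sigMat : QMat B m := Matrix.diagonal sigVec

theorem sigMat_mul_self : sigMat B m * sigMat B m = 1 := by
  rw [sigMat, Matrix.diagonal_mul_diagonal, ← Matrix.diagonal_one]
  congr 1
  funext i
  rcases i with (_ | _) | i <;> simp [sigVec]

theorem sigMat_conj_apply (X : QMat B m) (i j : Bool ⊕ Fin m) :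
    (sigMat B m * X * sigMat B m) i j = sigVec i * X i j * sigVec j := by
  rw [sigMat, Matrix.mul_diagonal, Matrix.diagonal_mul]

theorem sigMat_eMat : sigMat B m * eMat B m * sigMat B m = -eMat B m := by
  refine Matrix.ext fun i j => ?_
  rw [sigMat_conj_apply]
  rcases i with (_ | _) | i <;> rcases j with (_ | _) | j <;> simp [eMat, embM, sigVec]

theorem sigMat_embH (f : Pair B m) (p : ℍ[B]) (P : Matrix (Fin m) (Fin m) ℍ[B]) :
    sigMat B m * embH f p P * sigMat B m = embH f p P := by
  refine Matrix.ext fun i j => ?_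
  rw [sigMat_conj_apply]
  rcases i with (_ | _) | i <;> rcases j with (_ | _) | j <;> simp [embH, sigVec]

theorem dMat_sigMat (D : Derivation ℝ B B) : dMat D (sigMat B m) = 0 := by
  refine Matrix.ext fun i j => ?_
  rcases i with (_ | _) | i <;> rcases j with (_ | _) | j <;>
    simp [sigMat, sigVec, Matrix.diagonal, apply_ite (dQ D), dQ_neg]

/-- The component of an even matrix transversal to the centralizer of `eMat`. -/
def perpH (X : QMat B m) : Pair B m :=
  ((1 / 2 : ℝ) • (X (.inl false) (.inl false) - X (.inl true) (.inl true)),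
    fun r => X (.inl true) (.inr r))

/-- The scalar component of an even matrix in the centralizer of `eMat`. -/
def parH (X : QMat B m) : ℍ[B] :=
  (1 / 2 : ℝ) • (X (.inl false) (.inl false) + X (.inl true) (.inl true))

/-- The matrix component of an even matrix in the centralizer of `eMat`. -/
def blockH (X : QMat B m) : Matrix (Fin m) (Fin m) ℍ[B] := Matrix.of fun r s => X (.inr r) (.inr s)

theorem eq_zero_of_eq_neg {a : ℍ[B]} (h : a = -a) : a = 0 := by
  rw [← two_half_smul a]
  nth_rewrite 1 [h]
  simp

/-- Invariance under the signature removes the odd blocks; skewness relates the remaining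
off-diagonal entries and makes the diagonal blocks imaginary and skew. -/
theorem eq_embH {X : QMat B m} (hs : star X = -X) (hθ : sigMat B m * X * sigMat B m = X) :
    X = embH (perpH X) (parH X) (blockH X) ∧ (perpH X).1.re = 0 ∧ (parH X).re = 0 ∧
      (blockH X)ᴴ = -blockH X := by
  have h1 : ∀ i j, star (X j i) = -X i j := fun i j => congrFun (congrFun hs i) j
  have h2 : ∀ i j, sigVec i * X i j * sigVec j = X i j := fun i j => by
    have := congrFun (congrFun hθ i) j
    rwa [sigMat_conj_apply] at this
  refine ⟨?_, ?_, ?_, ?_⟩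
  · refine Matrix.ext fun i j => ?_
    rcases i with (_ | _) | i <;> rcases j with (_ | _) | j <;>
      simp [embH, perpH, parH, blockH, h1]
    · module
    · exact eq_zero_of_eq_neg (by simpa [sigVec] using (h2 (.inl false) (.inl true)).symm)
    · exact eq_zero_of_eq_neg (by simpa [sigVec] using (h2 (.inl false) (.inr j)).symm)
    · exact eq_zero_of_eq_neg (by simpa [sigVec] using (h2 (.inl true) (.inl false)).symm)
    · module
    · exact eq_zero_of_eq_neg (by simpa [sigVec] using (h2 (.inr i) (.inl false)).symm)
  · simp [perpH, re_eq_zero_of_star (h1 _ _)]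
  · simp [parH, re_eq_zero_of_star (h1 _ _)]
  · exact Matrix.ext fun i j => h1 _ _

/-- The pair of an odd matrix. -/
def perpM (X : QMat B m) : Pair B m :=
  (star (X (.inl false) (.inl true)) - X (.inl false) (.inl true),
    fun r => X (.inl false) (.inr r))

/-- The component of an odd matrix in the centralizer of `eMat`. -/
def parM (X : QMat B m) : B := -(X (.inl false) (.inl true)).re

theorem perpM_re (X : QMat B m) : (perpM X).1.re = 0 := by simp [perpM]

theorem eq_embJ {X : QMat B m} (hs : star X = X) (hθ : sigMat B m * X * sigMat B m = -X) :
    X = embJ (perpM X) (parM X) := by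
  have h1 : ∀ i j, star (X j i) = X i j := fun i j => congrFun (congrFun hs i) j
  have h2 : ∀ i j, sigVec i * X i j * sigVec j = -X i j := fun i j => by
    have := congrFun (congrFun hθ i) j
    rwa [sigMat_conj_apply] at this
  have h3 : ∀ a : ℍ[B], a = -((1 / 2 : ℝ) • (star a - a)) - ((-a.re : B) : ℍ[B]) := fun a => by
    ext <;> simp <;> module
  refine Matrix.ext fun i j => ?_
  rcases i with (_ | _) | i <;> rcases j with (_ | _) | j <;>
      simp only [embJ, embM, Matrix.of_apply]
  · exact eq_zero_of_eq_neg (by simpa [sigVec] using (h2 (.inl false) (.inl false)))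
  · exact h3 _
  · rfl
  · rw [← h1, perpM, parM, ← h3]
  · exact eq_zero_of_eq_neg (by simpa [sigVec] using (h2 (.inl true) (.inl true)))
  · exact eq_zero_of_eq_neg (by simpa [sigVec] using (h2 (.inl true) (.inr j)))
  · exact (h1 _ _).symm
  · exact eq_zero_of_eq_neg (by simpa [sigVec] using (h2 (.inr i) (.inl true)))
  · exact eq_zero_of_eq_neg (by simpa [sigVec] using (h2 (.inr i) (.inr j)))

end Decode

end HPnFlow
end

noncomputable section

namespace HPnFlow

/-! ## The hierarchy -/

section Hierarchy

variable {m : ℕ}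

theorem exists_jet_resolvent (m : ℕ) : ∃ M : PowerSeries (QMat (Jet m) m),
    IsResolvent (dMat (Dx m)) (eMat (Jet m) m) (embH (uJet m) 0 0) M :=
  exists_isResolvent (dMat_mul _) eMat_cube

@[simp] theorem uJet_fst_re (m : ℕ) : (uJet m).1.re = 0 := rfl

@[simp] theorem uJet_fst_imI (m : ℕ) : (uJet m).1.imI = MvPolynomial.X (Sum.inl 0, 0) := rfl

@[simp] theorem uJet_fst_imJ (m : ℕ) : (uJet m).1.imJ = MvPolynomial.X (Sum.inl 1, 0) := rfl

@[simp] theorem uJet_fst_imK (m : ℕ) : (uJet m).1.imK = MvPolynomial.X (Sum.inl 2, 0) := rfl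

@[simp] theorem uJet_snd_re (r : Fin m) :
    ((uJet m).2 r).re = MvPolynomial.X (Sum.inr (r, 0), 0) := rfl

@[simp] theorem uJet_snd_imI (r : Fin m) :
    ((uJet m).2 r).imI = MvPolynomial.X (Sum.inr (r, 1), 0) := rfl

@[simp] theorem uJet_snd_imJ (r : Fin m) :
    ((uJet m).2 r).imJ = MvPolynomial.X (Sum.inr (r, 2), 0) := rfl

@[simp] theorem uJet_snd_imK (r : Fin m) :
    ((uJet m).2 r).imK = MvPolynomial.X (Sum.inr (r, 3), 0) := rfl

/-- The coefficients of the resolvent on differential polynomials. -/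
def resC (m k : ℕ) : QMat (Jet m) m := PowerSeries.coeff k (exists_jet_resolvent m).choose

theorem isResolvent_jet (m : ℕ) : IsResolvent (dMat (Dx m)) (eMat (Jet m) m) (embH (uJet m) 0 0)
    (PowerSeries.mk (resC m)) := by
  have : PowerSeries.mk (resC m) = (exists_jet_resolvent m).choose := PowerSeries.ext fun k => by
    rw [PowerSeries.coeff_mk]; rfl
  rw [this]
  exact (exists_jet_resolvent m).choose_spec

theorem resC_zero (m : ℕ) : resC m 0 = -eMat (Jet m) m := by
  simpa only [PowerSeries.coeff_mk] using (isResolvent_jet m).coeff_zero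

theorem nabla_resC (m k : ℕ) : nabla (dMat (Dx m)) (embH (uJet m) 0 0) (resC m k) =
    eMat (Jet m) m * resC m (k + 1) - resC m (k + 1) * eMat (Jet m) m := by
  simpa only [PowerSeries.coeff_mk] using (isResolvent_jet m).lax k

/-- The conjugate transpose with z replaced by -z is again a resolvent for the same field. -/
theorem star_resC (m k : ℕ) : star (resC m k) = (-1 : ℝ) ^ k • resC m k := by
  have h := (isResolvent_jet m).star_alt (dMat_star _) star_eMat
    (star_embH (uJet_fst_re m) (by simp) (by simp))
  have h2 := congrArg (PowerSeries.coeff k) ((isResolvent_jet m).unique eMat_cube h)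
  simp only [coeff_altSeries, coeff_starSeries, PowerSeries.coeff_mk] at h2
  nth_rewrite 2 [h2]
  rw [smul_smul, ← mul_pow]
  simp

/-- Conjugation by the signature fixes the field and changes the sign of e, which
`IsResolvent.neg_alt` undoes by z ↦ -z. -/
theorem sigMat_resC (m k : ℕ) : sigMat (Jet m) m * resC m k * sigMat (Jet m) m
    = -((-1 : ℝ) ^ k • resC m k) := by
  have h := (isResolvent_jet m).map (D' := dMat (Dx m))
    (conjHom (sigMat _ m) (sigMat _ m) sigMat_mul_self sigMat_mul_self)
    (fun a => by simp [dMat_mul, dMat_sigMat])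
  rw [conjHom_apply, conjHom_apply, sigMat_eMat, sigMat_embH] at h
  have h2 := congrArg (PowerSeries.coeff k) ((isResolvent_jet m).unique eMat_cube h.neg_alt)
  simp only [coeff_altSeries, PowerSeries.coeff_mk, PowerSeries.coeff_map, map_neg,
    conjHom_apply] at h2
  nth_rewrite 2 [h2]
  rw [smul_neg, smul_smul, ← mul_pow]
  simp

theorem isResolvent_zero {B : Type} [CommRing B] [Algebra ℝ B] (D : Derivation ℝ B B) :
    IsResolvent (dMat D) (eMat B m) 0 (PowerSeries.C (-eMat B m)) := by
  refine ⟨by simp, ?_, fun k => ?_⟩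
  · rw [← map_mul, ← map_mul]; simp [mul_assoc, eMat_cube]
  · cases k <;> simp [nabla, dMat_eMat]

theorem embH_zero {B : Type} [CommRing B] : embH (0 : Pair B m) 0 0 = 0 := by
  refine Matrix.ext fun i j => ?_
  rcases i with (_ | _) | i <;> rcases j with (_ | _) | j <;> simp [embH]

/-- Setting all jet variables to zero gives a resolvent of the zero field, which is the constant
series -e by uniqueness. -/
theorem resC_noConst (m k : ℕ) (i j : Bool ⊕ Fin m) : QIn (noConst m) (resC m (k + 1) i j) := by
  let φ : Jet m →ₐ[ℝ] Jet m := MvPolynomial.aeval fun _ => 0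
  have hφ : ∀ f, φ f = MvPolynomial.C (MvPolynomial.constantCoeff f) := fun f => by
    simp only [φ]
    rw [MvPolynomial.aeval_zero', MvPolynomial.algebraMap_eq]
  have hφD : ∀ b, φ (Dx m b) = Dx m (φ b) := fun b => by
    rw [hφ, hφ, mem_noConst.1 (Dx_mem_noConst b), MvPolynomial.derivation_C, MvPolynomial.C_0]
  have hu : matMap φ (embH (uJet m) 0 0) = 0 := by
    rw [matMap_embH, ← embH_zero]
    congr 1
    · refine Prod.ext ?_ (funext fun r => ?_) <;> refine Quaternion.ext _ _ ?_ ?_ ?_ ?_ <;>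
        simp [pairMap, φ]
  have h := (isResolvent_jet m).map (matMap φ) (matMap_dMat hφD)
  rw [matMap_eMat, hu] at h
  have h1 := congrArg (PowerSeries.coeff (k + 1)) (h.unique eMat_cube (isResolvent_zero _))
  rw [PowerSeries.coeff_map, PowerSeries.coeff_mk, PowerSeries.coeff_C, if_neg (by omega)] at h1
  have h2 : qMap φ (resC m (k + 1) i j) = 0 := congrFun (congrFun h1 i) j
  have h3 : ∀ f, φ f = 0 → f ∈ noConst m := fun f hf => by
    rw [hφ] at hf
    exact mem_noConst.2 (MvPolynomial.C_injective _ _ (by rw [hf, MvPolynomial.C_0]))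
  exact ⟨h3 _ (congrArg (fun x : ℍ[Jet m] => x.re) h2),
    h3 _ (congrArg (fun x : ℍ[Jet m] => x.imI) h2),
    h3 _ (congrArg (fun x : ℍ[Jet m] => x.imJ) h2),
    h3 _ (congrArg (fun x : ℍ[Jet m] => x.imK) h2)⟩

/-- The covector of the `l`-th member of the hierarchy. -/
def hierW (m l : ℕ) : Pair (Jet m) m := perpH (resC m (2 * l + 1))

/-- The `l`-th member of the hierarchy. -/
def hierU (m l : ℕ) : Pair (Jet m) m := perpM (resC m (2 * l + 2))

/-- The antiderivative `D⁻¹ Re (⟨u, h⟩ + ⟨𝐮, 𝐡⟩)` for the `l`-th member of the hierarchy. -/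
def hierQ (m l : ℕ) : Jet m := parM (resC m (2 * l + 2))

/-- The `l`-th Hamiltonian density. -/
def hierH (m l : ℕ) : Jet m := (1 / (1 + 2 * (l : ℝ))) • hierQ m l

theorem resC_odd (m l : ℕ) : resC m (2 * l + 1) = embH (hierW m l) (parH (resC m (2 * l + 1)))
    (blockH (resC m (2 * l + 1))) ∧ (hierW m l).1.re = 0 ∧ (parH (resC m (2 * l + 1))).re = 0 ∧
      (blockH (resC m (2 * l + 1)))ᴴ = -blockH (resC m (2 * l + 1)) :=
  eq_embH (by rw [star_resC]; simp [pow_succ, pow_mul])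
    (by rw [sigMat_resC]; simp [pow_succ, pow_mul])

theorem resC_even (m l : ℕ) : resC m (2 * l + 2) = embJ (hierU m l) (hierQ m l) :=
  eq_embJ (by rw [star_resC]; simp [pow_succ, pow_mul])
    (by rw [sigMat_resC]; simp [pow_succ, pow_mul])

theorem hierU_re (m l : ℕ) : (hierU m l).1.re = 0 := perpM_re _

theorem QIn.add {B : Type} [CommRing B] [Algebra ℝ B] {N : Submodule ℝ B} {p q : ℍ[B]}
    (hp : QIn N p) (hq : QIn N q) : QIn N (p + q) :=
  ⟨N.add_mem hp.1 hq.1, N.add_mem hp.2.1 hq.2.1, N.add_mem hp.2.2.1 hq.2.2.1,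
    N.add_mem hp.2.2.2 hq.2.2.2⟩

theorem QIn.smul {B : Type} [CommRing B] [Algebra ℝ B] {N : Submodule ℝ B} {p : ℍ[B]}
    (c : ℝ) (hp : QIn N p) : QIn N (c • p) :=
  ⟨N.smul_mem c hp.1, N.smul_mem c hp.2.1, N.smul_mem c hp.2.2.1, N.smul_mem c hp.2.2.2⟩

/-- The Lax equation at an odd index; the antiderivatives are entries of the resolvent and so have
no constant term. -/
theorem jetH_hier (m l : ℕ) : JetH (hierW m l) (hierU m l) := by
  obtain ⟨h1, h2, h3, h4⟩ := resC_odd m l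
  refine IsH.of_nabla_eq (uJet_fst_re m) h2 h3 h4 ?_ (fun r s => resC_noConst m _ _ _) ?_
  · exact ((resC_noConst m _ _ _).add (resC_noConst m _ _ _)).smul _
  · rw [← h1, nabla_resC, resC_even, eMat_lie_embJ (hierU_re m l)]

theorem hierQ_mem (m l : ℕ) : hierQ m l ∈ noConst m :=
  (noConst m).neg_mem (resC_noConst m _ _ _).1

/-- The Lax equation at an even index. -/
theorem jetJ_hier (m l : ℕ) : JetJ (hierU m l) (hierW m (l + 1)) := by
  obtain ⟨h1, h2, -, -⟩ := resC_odd m (l + 1)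
  refine IsJ.of_nabla_eq (uJet_fst_re m) (hierU_re m l) h2 (hierQ_mem m l)
    (p := parH (resC m (2 * (l + 1) + 1))) (P := blockH (resC m (2 * (l + 1) + 1))) ?_
  rw [← h1, ← resC_even, nabla_resC]
  rfl

theorem coeff_one_mul_eq {A : Type*} [Ring A] (f g : PowerSeries A) :
    PowerSeries.coeff 1 (f * g) = PowerSeries.coeff 0 f * PowerSeries.coeff 1 g
      + PowerSeries.coeff 1 f * PowerSeries.coeff 0 g := by
  rw [PowerSeries.coeff_mul, show Finset.HasAntidiagonal.antidiagonal 1 = {(0, 1), (1, 0)} from rfl,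
    Finset.sum_pair (by simp)]

theorem resC_one (m : ℕ) : resC m 1 = embH (uJet m) 0 0 := by
  have h0 := nabla_resC m 0
  rw [resC_zero, nabla, map_neg, dMat_eMat] at h0
  -- The field is itself a commutator with e, so it solves the linearized cubic equation; M₁ - u
  -- does too and commutes with e, hence vanishes.
  have hU := eMat_lie_embJ (uJet_fst_re m) 0
  have h1 := cube_lie (e := eMat (Jet m) m) eMat_cube (embJ (uJet m) 0)
  rw [hU] at h1
  have h2 := congrArg (PowerSeries.coeff 1) (isResolvent_jet m).cube
  have h3 : resC m 1 - embH (uJet m) 0 0 = 0 := by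
    refine eq_zero_of_cube eMat_cube ?_ ?_
    · linear_combination (norm := noncomm_ring) -h0
    · rw [coeff_one_mul_eq, coeff_one_mul_eq, coeff_zero_mul_eq] at h2
      simp only [PowerSeries.coeff_mk, resC_zero] at h2
      linear_combination (norm := noncomm_ring) h2 - h1
  exact sub_eq_zero.1 h3

theorem hierU_zero (m : ℕ) : hierU m 0 = dPair (Dx m) (uJet m) := by
  have h := nabla_resC m 1
  rw [resC_one, show 1 + 1 = 2 * 0 + 2 from rfl, resC_even, eMat_lie_embJ (hierU_re m 0), nabla,
    sub_self,
    add_zero, dMat_embH_perp] at h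
  exact (embH_inj h).1.symm

theorem isHierarchy_hierU (m : ℕ) : IsHierarchy (hierU m) :=
  ⟨hierU_zero m, fun l => ⟨_, jetJ_hier m l, jetH_hier m (l + 1)⟩⟩

theorem jetE_hier (m l : ℕ) : JetE (hierW m l) (hierU m (l + 1)) :=
  ⟨_, jetH_hier m l, (isHierarchy_hierU m).2 l⟩

theorem dQ_Dx_inj {p p' : ℍ[Jet m]} (hp : QIn (noConst m) p) (hp' : QIn (noConst m) p')
    (h : dQ (Dx m) p = dQ (Dx m) p') : p = p' := by
  refine Quaternion.ext _ _ ?_ ?_ ?_ ?_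
  · exact Dx_injOn_noConst hp.1 hp'.1 (congrArg (fun x : ℍ[Jet m] => x.re) h)
  · exact Dx_injOn_noConst hp.2.1 hp'.2.1 (congrArg (fun x : ℍ[Jet m] => x.imI) h)
  · exact Dx_injOn_noConst hp.2.2.1 hp'.2.2.1 (congrArg (fun x : ℍ[Jet m] => x.imJ) h)
  · exact Dx_injOn_noConst hp.2.2.2 hp'.2.2.2 (congrArg (fun x : ℍ[Jet m] => x.imK) h)

theorem JetH.unique {w y y' : Pair (Jet m) m} (h : JetH w y) (h' : JetH w y') : y = y' := by
  obtain ⟨-, p, P, -, hp, hDp, -, hP, hDP, h1, h2⟩ := h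
  obtain ⟨-, p', P', -, hp', hDp', -, hP', hDP', h1', h2'⟩ := h'
  obtain rfl : p = p' := dQ_Dx_inj hp hp' (by rw [hDp, hDp'])
  obtain rfl : P = P' :=
    Matrix.ext fun r s => dQ_Dx_inj (hP r s) (hP' r s) (by rw [hDP, hDP'])
  exact Prod.ext (by rw [h1, h1']) (funext fun r => by rw [h2, h2'])

theorem JetJ.unique {h w w' : Pair (Jet m) m} (H : JetJ h w) (H' : JetJ h w') : w = w' := by
  obtain ⟨-, q, hq, hDq, rfl⟩ := isJ_iff.1 H
  obtain ⟨-, q', hq', hDq', rfl⟩ := isJ_iff.1 H'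
  rw [Dx_injOn_noConst hq hq' (by rw [hDq, hDq'])]

theorem JetR.unique {h y y' : Pair (Jet m) m} (H : JetR h y) (H' : JetR h y') : y = y' := by
  obtain ⟨w, h1, h2⟩ := H
  obtain ⟨w', h1', h2'⟩ := H'
  rw [JetJ.unique h1' h1] at h2'
  exact JetH.unique h2 h2'

theorem IsHierarchy.eq_hierU {h : ℕ → Pair (Jet m) m} (H : IsHierarchy h) : h = hierU m := by
  funext l
  induction l with
  | zero => rw [H.1, hierU_zero]
  | succ l ih =>
    have := H.2 l
    rw [ih] at this
    exact JetR.unique this ((isHierarchy_hierU m).2 l)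

theorem isFlow_iff (χ : ℝ) (l : ℕ) (F : Pair (Jet m) m) :
    IsFlow χ (hierU m l) F ↔ F = hierU m (l + 1) + χ⁻¹ • hierU m l := by
  constructor
  · rintro ⟨w, y, h1, h2, rfl⟩
    rw [JetR.unique ⟨w, h1, h2⟩ ((isHierarchy_hierU m).2 l)]
  · rintro rfl
    exact ⟨_, _, jetJ_hier m l, jetH_hier m (l + 1), rfl⟩

theorem rePair_eq {B : Type} [CommRing B] [Algebra ℝ B] {u h : Pair B m} (hh : h.1.re = 0) :
    rePair u h = -((1 / 2 : ℝ) • antiS u.1 h.1 - (1 / 2 : ℝ) • antiV u.2 h.2).re := by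
  have h1 : (antiS u.1 h.1).re = (u.1 * h.1).re + (u.1 * h.1).re := by
    rw [antiS, Quaternion.re_add, re_mul_comm h.1]
  have h2 : (antiV u.2 h.2).re = (herm u.2 h.2).re + (herm u.2 h.2).re := by
    rw [antiV, Quaternion.re_add, ← star_herm u.2 h.2, Quaternion.re_star]
  rw [rePair, Quaternion.re_sub, Quaternion.re_smul, Quaternion.re_smul, h1, h2, half_smul_add,
    half_smul_add, star_eq_neg_of_re hh, mul_neg, Quaternion.re_add, Quaternion.re_neg]
  abel

/-- The real part of the corner entry in the Lax equation at an even index, where the right-hand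
side is imaginary. -/
theorem Dx_hierQ (m l : ℕ) : Dx m (hierQ m l) = rePair (uJet m) (hierU m l) := by
  have h1 := nabla_embJ (Dx m) (hierQ m l) (uJet_fst_re m) (hierU_re m l)
  obtain ⟨h3, h2, -, -⟩ := resC_odd m (l + 1)
  rw [← resC_even, nabla_resC, show 2 * l + 2 + 1 = 2 * (l + 1) + 1 from rfl, h3,
    eMat_lie_embH _ _ _ (star_eq_neg_of_re h2)] at h1
  have h4 := congrArg (fun x : ℍ[Jet m] => x.re) (embM_inj h1).1
  simp only [Quaternion.re_sub, Quaternion.re_neg, Quaternion.re_add,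
    valJ_re (uJet_fst_re m) (hierU_re m l), h2,
    Quaternion.re_coe, add_zero, neg_zero, zero_sub, zero_eq_neg] at h4
  rw [rePair_eq (hierU_re m l)]
  exact eq_neg_of_add_eq_zero_left h4

theorem isHamDensity_hier (m l : ℕ) : IsHamDensity l (hierU m l) (hierH m l) :=
  ⟨_, hierQ_mem m l, Dx_hierQ m l, rfl⟩

/-- The real component of a pair of differential polynomials with a given index. -/
def compJ (f : Pair (Jet m) m) : Comp m → Jet m
  | Sum.inl i => ![f.1.imI, f.1.imJ, f.1.imK] i
  | Sum.inr (r, i) => ![(f.2 r).re, (f.2 r).imI, (f.2 r).imJ, (f.2 r).imK] i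

theorem rePair_evo (v : Comp m) (a : Jet m) (f : Pair (Jet m) m) :
    rePair f (dPair (evo v a) (uJet m)) = a * compJ f v := by
  have hX : ∀ v w, evo v a (MvPolynomial.X (w, 0)) = if w = v then a else 0 := fun v w => by
    simp [evo, MvPolynomial.mkDerivation_X]
  rcases v with i | ⟨r, i⟩
  · fin_cases i <;> simp [rePair, herm, re_sum, dPair, hX, compJ] <;> ring
  · have h : ∀ s, s ≠ r → dQ (evo (Sum.inr (r, i)) a) ((uJet m).2 s) = 0 := fun s hs => by
      refine Quaternion.ext _ _ ?_ ?_ ?_ ?_ <;> simp [hX, hs]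
    rw [rePair, herm, Finset.sum_eq_single r]
    · fin_cases i <;> simp [dPair, hX, compJ] <;> ring
    · intro s _ hs
      rw [show (dPair (evo (Sum.inr (r, i)) a) (uJet m)).2 s = 0 from h s hs, star_zero, mul_zero]
    · simp

/-- Pairing with e sees only the centralizer component, with the same factor -2 as `reTr_embH`. -/
theorem reTr_embJ (h : Pair (Jet m) m) (hh : h.1.re = 0) (q : Jet m) :
    reTr (embJ h q * eMat (Jet m) m) = (-2 : ℝ) • q := by
  rw [reTr, Matrix.trace, Fintype.sum_sum_type, Fintype.sum_bool]
  simp [qmat_mul_apply, embJ, embM, eMat, hh]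
  module

theorem euler_hierH (l : ℕ) (v : Comp m) : euler v (hierH m l) = compJ (hierW m l) v := by
  rw [← sub_eq_zero]
  -- It suffices to compare both sides multiplied by an arbitrary characteristic a, modulo total
  -- derivatives; this is the variation of the density along `evo v a`.
  refine eq_zero_of_forall_mul_total fun a => ?_
  rw [← toModTotal_eq_zero]
  -- At index 2l + 1 the left factor is 1 + 2l, which the normalization of the density cancels.
  have hδ := (isResolvent_jet m).trace_variation (dMat_mul (Dx m)) (dMat_mul (evo v a))
    (dMat_comm (evo_Dx v a)) (trQ_mul_comm (Dx m)) (trQ_dMat (Dx m)) (dMat_eMat _) (2 * l + 1)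
  rw [PowerSeries.coeff_mk, PowerSeries.coeff_mk, (resC_odd m l).1, dMat_embH_perp, trQ_mul_comm,
    trQ_embH _ _ _ _ _ (dPair_re (uJet_fst_re m)), rePair_evo,
    trQ_apply (Dx m) (_ * eMat _ _)] at hδ
  have h1 : dMat (evo v a) (resC m (2 * l + 1 + 1)) * eMat _ m =
      dMat (evo v a) (resC m (2 * l + 2) * eMat _ m) := by
    rw [dMat_mul, dMat_eMat, mul_zero, add_zero]
  rw [h1, reTr_dMat, resC_even, reTr_embJ _ (hierU_re m l), Derivation.map_smul, map_smul] at hδ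
  have h2 : toModTotal (Dx m) (evo v a (hierH m l)) =
      toModTotal (Dx m) (a * compJ (hierW m l) v) := by
    rw [hierH, Derivation.map_smul, map_smul]
    have h3 : (1 + 2 * (l : ℝ)) ≠ 0 := by positivity
    push_cast at hδ
    rw [smul_comm, add_comm (2 * (l : ℝ))] at hδ
    rw [← smul_right_injective _ (by norm_num : (-2 : ℝ) ≠ 0) hδ, smul_smul, one_div_mul_cancel h3,
      one_smul]
  obtain ⟨g, hg⟩ := exists_evo_eq v a (hierH m l)
  have h3 := toModTotal_eq_zero.2 ⟨g, hg⟩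
  rw [map_sub, h2] at h3
  rw [mul_sub, map_sub, ← neg_sub, h3, neg_zero]

theorem covec_hierH (m l : ℕ) : covec (hierH m l) = hierW m l := by
  refine Prod.ext ?_ (funext fun r => ?_)
  · have h := (resC_odd m l).2.1
    refine (neg_neg _).trans (Quaternion.ext _ _ h.symm ?_ ?_ ?_) <;> simp [euler_hierH, compJ]
  · refine Quaternion.ext _ _ ?_ ?_ ?_ ?_ <;> simp [covec, deltaUbar, euler_hierH, compJ]

end Hierarchy

end HPnFlow
end

noncomputable section

namespace HPnFlow

/-! ## Invariance under rigid rotations -/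

section Rotation

variable {B : Type} [CommRing B] [Algebra ℝ B] {m : ℕ}

/-- The transformation `u ↦ g u ḡ`, `𝐮 ↦ g 𝐮 G`. -/
def rotate (g : ℍ[B]) (G : Matrix (Fin m) (Fin m) ℍ[B]) (f : Pair B m) : Pair B m :=
  (g * f.1 * star g, fun r => ∑ s, g * f.2 s * G s r)

/-- The block diagonal matrix implementing `rotate` by conjugation. -/
def rotMat (g : ℍ[B]) (G : Matrix (Fin m) (Fin m) ℍ[B]) : QMat B m :=
  Matrix.fromBlocks (Matrix.diagonal fun _ => g) 0 0 Gᴴ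

/-- The vector block holds the conjugate transpose, whence the reversed order in the second
argument. -/
theorem rotMat_mul (g g' : ℍ[B]) (G G' : Matrix (Fin m) (Fin m) ℍ[B]) :
    rotMat g G * rotMat g' G' = rotMat (g * g') (G' * G) := by
  simp [rotMat, Matrix.fromBlocks_multiply, Matrix.conjTranspose_mul]

theorem rotMat_one : rotMat (1 : ℍ[B]) (1 : Matrix (Fin m) (Fin m) ℍ[B]) = 1 := by
  rw [rotMat, Matrix.conjTranspose_one, Matrix.diagonal_one, Matrix.fromBlocks_one]

theorem dMat_rotMat {D : Derivation ℝ B B} {g : ℍ[B]} {G : Matrix (Fin m) (Fin m) ℍ[B]}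
    (hg : dQ D g = 0) (hG : ∀ r s, dQ D (G r s) = 0) : dMat D (rotMat g G) = 0 := by
  have h0 : dQ D 0 = 0 := map_zero (dQL D)
  refine Matrix.ext fun i j => ?_
  rcases i with i | i <;> rcases j with j | j <;>
    simp [rotMat, Matrix.diagonal, apply_ite (dQ D), dQ_star, hg, hG, h0]

theorem rotMat_conj_embH (g : ℍ[B]) (G : Matrix (Fin m) (Fin m) ℍ[B]) (f : Pair B m) :
    rotMat g G * embH f 0 0 * rotMat (star g) Gᴴ = embH (rotate g G f) 0 0 := by
  refine Matrix.ext fun i j => ?_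
  rcases i with (_ | _) | i <;> rcases j with (_ | _) | j <;>
    simp [qmat_mul_apply, rotMat, embH, rotate, Finset.sum_mul, mul_assoc]

theorem rotMat_conj_embJ {g : ℍ[B]} (hg : g * star g = 1) (G : Matrix (Fin m) (Fin m) ℍ[B])
    (h : Pair B m) (q : B) :
    rotMat g G * embJ h q * rotMat (star g) Gᴴ = embJ (rotate g G h) q := by
  have hq : g * (q : ℍ[B]) * star g = q := by
    rw [← Quaternion.coe_commutes, mul_assoc, hg, mul_one]
  refine Matrix.ext fun i j => ?_
  rcases i with (_ | _) | i <;> rcases j with (_ | _) | j <;>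
    simp [qmat_mul_apply, rotMat, embJ, embM, rotate, Finset.sum_mul, mul_sub, sub_mul, hq] <;>
    simp [mul_assoc]

theorem rotMat_conj_eMat {g : ℍ[B]} (hg : g * star g = 1) (G : Matrix (Fin m) (Fin m) ℍ[B]) :
    rotMat g G * eMat B m * rotMat (star g) Gᴴ = eMat B m := by
  refine Matrix.ext fun i j => ?_
  rcases i with (_ | _) | i <;> rcases j with (_ | _) | j <;>
    simp [qmat_mul_apply, rotMat, eMat, embM, hg]

theorem perpM_embJ {h : Pair B m} (hh : h.1.re = 0) (q : B) : perpM (embJ h q) = h := by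
  refine Prod.ext ?_ rfl
  simp only [perpM, embJ, embM, Matrix.of_apply, star_sub, star_neg, Quaternion.star_smul,
    star_eq_neg_of_re hh, Quaternion.star_coe]
  module

theorem rotate_add (g : ℍ[B]) (G : Matrix (Fin m) (Fin m) ℍ[B]) (f f' : Pair B m) :
    rotate g G (f + f') = rotate g G f + rotate g G f' := by
  refine Prod.ext ?_ (funext fun r => ?_)
  · simp [rotate, mul_add, add_mul]
  · simp [rotate, mul_add, add_mul, Finset.sum_add_distrib]

theorem rotate_smul (g : ℍ[B]) (G : Matrix (Fin m) (Fin m) ℍ[B]) (c : ℝ) (f : Pair B m) :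
    rotate g G (c • f) = c • rotate g G f := by
  refine Prod.ext ?_ (funext fun r => ?_)
  · simp [rotate]
  · simp [rotate, Finset.smul_sum]

theorem rotate_rotate (g g' : ℍ[B]) (G G' : Matrix (Fin m) (Fin m) ℍ[B]) (f : Pair B m) :
    rotate g' G' (rotate g G f) = rotate (g' * g) (G * G') f := by
  refine Prod.ext ?_ (funext fun r => ?_)
  · simp [rotate, mul_assoc]
  · simp only [rotate, Matrix.mul_apply, Finset.mul_sum, Finset.sum_mul]
    rw [Finset.sum_comm]
    simp only [mul_assoc]

theorem rotate_one (f : Pair B m) : rotate 1 1 f = f := by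
  refine Prod.ext ?_ (funext fun r => ?_)
  · simp [rotate]
  · simp [rotate, Matrix.one_apply]

theorem rotate_re {g : ℍ[B]} (hg : star g * g = 1) (G : Matrix (Fin m) (Fin m) ℍ[B])
    (f : Pair B m) : (rotate g G f).1.re = f.1.re := by
  rw [rotate, mul_assoc, re_mul_comm, mul_assoc, hg, mul_one]

theorem dPair_rotate {D : Derivation ℝ B B} {g : ℍ[B]} {G : Matrix (Fin m) (Fin m) ℍ[B]}
    (hg : dQ D g = 0) (hG : ∀ r s, dQ D (G r s) = 0) (f : Pair B m) :
    dPair D (rotate g G f) = rotate g G (dPair D f) := by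
  refine Prod.ext ?_ (funext fun r => ?_)
  · simp [dPair, rotate, dQ_mul, dQ_star, hg]
  · simp [dPair, rotate, dQ_sum, dQ_mul, hg, hG]

theorem pairMap_rotate {B' : Type} [CommRing B'] [Algebra ℝ B'] (φ : B →ₐ[ℝ] B') (g : ℍ[B])
    (G : Matrix (Fin m) (Fin m) ℍ[B]) (f : Pair B m) :
    pairMap φ (rotate g G f) = rotate (qMap φ g) (G.map (qMap φ)) (pairMap φ f) := by
  simp [pairMap, rotate, qMap_star]

theorem pairMap_add {B' : Type} [CommRing B'] [Algebra ℝ B'] (φ : B →ₐ[ℝ] B') (f f' : Pair B m) :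
    pairMap φ (f + f') = pairMap φ f + pairMap φ f' := by
  refine Prod.ext ?_ (funext fun r => ?_) <;> simp [pairMap]

theorem pairMap_smul {B' : Type} [CommRing B'] [Algebra ℝ B'] (φ : B →ₐ[ℝ] B') (c : ℝ)
    (f : Pair B m) : pairMap φ (c • f) = c • pairMap φ f := by
  refine Prod.ext ?_ (funext fun r => ?_) <;> simp [pairMap, qMap_smul]

theorem pairMap_perpM {B' : Type} [CommRing B'] [Algebra ℝ B'] (φ : B →ₐ[ℝ] B') (X : QMat B m) :
    pairMap φ (perpM X) = perpM (matMap φ X) := by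
  simp [pairMap, perpM, qMap_star]

end Rotation

/-! ### Substitution, evaluation and equivariance of the flows -/

section Substitution

variable {m : ℕ}

theorem compJ_dPair (f : Pair (Jet m) m) (v : Comp m) :
    compJ (dPair (Dx m) f) v = Dx m (compJ f v) := by
  rcases v with i | ⟨r, i⟩ <;> fin_cases i <;> rfl

theorem compJ_iterate (f : Pair (Jet m) m) (v : Comp m) (k : ℕ) :
    compJ ((dPair (Dx m))^[k] f) v = (Dx m)^[k] (compJ f v) := by
  induction k with
  | zero => rfl
  | succ k ih => rw [Function.iterate_succ_apply', Function.iterate_succ_apply', compJ_dPair, ih]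

theorem compJ_uJet (v : Comp m) : compJ (uJet m) v = MvPolynomial.X (v, 0) := by
  rcases v with i | ⟨r, i⟩ <;> fin_cases i <;> rfl

/-- The substitution of `f` for `(u, 𝐮)`, prolonged to derivatives. -/
def jetHom (f : Pair (Jet m) m) : Jet m →ₐ[ℝ] Jet m :=
  MvPolynomial.aeval fun a => (Dx m)^[a.2] (compJ f a.1)

theorem jetHom_X (f : Pair (Jet m) m) (a : Comp m × ℕ) :
    jetHom f (MvPolynomial.X a) = (Dx m)^[a.2] (compJ f a.1) := by
  rw [jetHom, MvPolynomial.aeval_X]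

theorem jetHom_Dx (f : Pair (Jet m) m) (b : Jet m) : jetHom f (Dx m b) = Dx m (jetHom f b) := by
  induction b using MvPolynomial.induction_on with
  | C a => simp [← MvPolynomial.algebraMap_eq]
  | add p q hp hq => simp [hp, hq]
  | mul_X p a hp =>
    rw [Derivation.leibniz, Dx_X, map_mul, Derivation.leibniz, map_add, smul_eq_mul, smul_eq_mul,
      map_mul, map_mul, hp, jetHom_X, jetHom_X, Function.iterate_succ_apply', smul_eq_mul,
      smul_eq_mul]

theorem pairMap_jetHom {f : Pair (Jet m) m} (hf : f.1.re = 0) :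
    pairMap (jetHom f) (uJet m) = f := by
  refine Prod.ext ?_ (funext fun r => ?_) <;> refine Quaternion.ext _ _ ?_ ?_ ?_ ?_ <;>
    simp [pairMap, jetHom_X, compJ, hf]

/-- Constant quaternions as quaternions of differential polynomials. -/
abbrev constQ (a : ℍ[ℝ]) : ℍ[Jet m] := qMap (Algebra.ofId ℝ (Jet m)) a

theorem dQ_constQ (a : ℍ[ℝ]) : dQ (Dx m) (constQ a) = 0 := by
  refine Quaternion.ext _ _ ?_ ?_ ?_ ?_ <;> simp [Algebra.ofId_apply]

/-- The rotation of differential polynomials by constants. -/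
abbrev jetRot (a : ℍ[ℝ]) (A : Matrix (Fin m) (Fin m) ℍ[ℝ]) (f : Pair (Jet m) m) : Pair (Jet m) m :=
  rotate (constQ a) (A.map constQ) f

/-- Substituting the rotated field and conjugating by the constant rotation matrix, which fixes e,
both produce resolvents of the rotated field. -/
theorem matMap_jetRot_resC {a : ℍ[ℝ]} (ha : a ∈ unitary ℍ[ℝ]) {A : Matrix (Fin m) (Fin m) ℍ[ℝ]}
    (hA : A ∈ unitary (Matrix (Fin m) (Fin m) ℍ[ℝ])) (k : ℕ) :
    matMap (jetHom (jetRot a A (uJet m))) (resC m k) =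
      rotMat (constQ a) (A.map constQ) * resC m k * rotMat (star (constQ a)) (A.map constQ)ᴴ := by
  have ha1 : star (constQ a : ℍ[Jet m]) * constQ a = 1 := by
    rw [← qMap_star, ← map_mul, (Unitary.mem_iff.1 ha).1, map_one]
  have ha2 : constQ a * star (constQ a : ℍ[Jet m]) = 1 := by
    rw [← qMap_star, ← map_mul, (Unitary.mem_iff.1 ha).2, map_one]
  have hstar : (A.map (constQ (m := m)))ᴴ = Aᴴ.map constQ :=
    Matrix.ext fun i j => (qMap_star _ _).symm
  have hmap : ∀ X Y : Matrix (Fin m) (Fin m) ℍ[ℝ], X * Y = 1 →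
      X.map (constQ (m := m)) * Y.map constQ = 1 := fun X Y h => by
    have := congrArg ((qMap (Algebra.ofId ℝ (Jet m))).mapMatrix) h
    rwa [map_mul, map_one] at this
  have hA1 : (A.map (constQ (m := m)))ᴴ * A.map constQ = 1 := by
    rw [hstar]; exact hmap _ _ (Unitary.mem_iff.1 hA).1
  have hA2 : A.map (constQ (m := m)) * (A.map constQ)ᴴ = 1 := by
    rw [hstar]; exact hmap _ _ (Unitary.mem_iff.1 hA).2
  have h1 := (isResolvent_jet m).map (matMap (jetHom (jetRot a A (uJet m))))
    (matMap_dMat (jetHom_Dx _))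
  rw [matMap_eMat, matMap_embH, pairMap_jetHom (by rw [rotate_re ha1, uJet_fst_re])] at h1
  have hd1 : dMat (Dx m) (rotMat (constQ a) (A.map constQ)) = 0 :=
    dMat_rotMat (dQ_constQ a) fun r s => dQ_constQ _
  have hd2 : dMat (Dx m) (rotMat (star (constQ a)) (A.map constQ)ᴴ) = 0 :=
    dMat_rotMat (by rw [dQ_star, dQ_constQ, star_zero])
      fun r s => by rw [Matrix.conjTranspose_apply, dQ_star, Matrix.map_apply, dQ_constQ, star_zero]
  have h2 := (isResolvent_jet m).map (D' := dMat (Dx m))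
    (conjHom (rotMat (constQ a) (A.map constQ)) (rotMat (star (constQ a)) (A.map constQ)ᴴ)
      (by rw [rotMat_mul, ha1, hA2, rotMat_one]) (by rw [rotMat_mul, ha2, hA1, rotMat_one]))
    (fun x => by simp [dMat_mul, hd1, hd2])
  rw [conjHom_apply, conjHom_apply, rotMat_conj_eMat ha2, rotMat_conj_embH] at h2
  have h0 : (0 : Matrix (Fin m) (Fin m) ℍ[Jet m]).map (qMap (jetHom (jetRot a A (uJet m)))) = 0 :=
    Matrix.ext fun i j => by simp
  rw [map_zero, h0] at h1
  have h3 := congrArg (PowerSeries.coeff k) (h1.unique eMat_cube h2)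
  rwa [PowerSeries.coeff_map, PowerSeries.coeff_map, PowerSeries.coeff_mk, conjHom_apply] at h3

theorem pairMap_jetRot_hierU {a : ℍ[ℝ]} (ha : a ∈ unitary ℍ[ℝ]) {A : Matrix (Fin m) (Fin m) ℍ[ℝ]}
    (hA : A ∈ unitary (Matrix (Fin m) (Fin m) ℍ[ℝ])) (l : ℕ) :
    pairMap (jetHom (jetRot a A (uJet m))) (hierU m l) = jetRot a A (hierU m l) := by
  have ha1 : star (constQ a : ℍ[Jet m]) * constQ a = 1 := by
    rw [← qMap_star, ← map_mul, (Unitary.mem_iff.1 ha).1, map_one]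
  have ha2 : constQ a * star (constQ a : ℍ[Jet m]) = 1 := by
    rw [← qMap_star, ← map_mul, (Unitary.mem_iff.1 ha).2, map_one]
  rw [hierU, pairMap_perpM, matMap_jetRot_resC ha hA, resC_even, rotMat_conj_embJ ha2,
    perpM_embJ (by rw [rotate_re ha1, hierU_re]), perpM_embJ (hierU_re m l)]

/-- Evaluation of differential polynomials as a homomorphism of algebras. -/
def evalHom (j : ℕ → Pair ℝ m) : Jet m →ₐ[ℝ] ℝ := MvPolynomial.aeval fun a => coord (j a.2) a.1

theorem evalPair_eq (j : ℕ → Pair ℝ m) (f : Pair (Jet m) m) :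
    evalPair j f = pairMap (evalHom j) f := rfl

theorem evalHom_compJ (j : ℕ → Pair ℝ m) (f : Pair (Jet m) m) (v : Comp m) :
    evalHom j (compJ f v) = coord (pairMap (evalHom j) f) v := by
  rcases v with i | ⟨r, i⟩ <;> fin_cases i <;> rfl

theorem act_eq_rotate {a : ℍ[ℝ]} (ha : a ∈ unitary ℍ[ℝ]) (A : Matrix (Fin m) (Fin m) ℍ[ℝ])
    (f : Pair ℝ m) : act a A f = rotate a A f := by
  have : a⁻¹ = star a := inv_eq_of_mul_eq_one_right (Unitary.mem_iff.1 ha).2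
  rw [act, this]
  rfl

/-- Coordinates ignore the real part of the scalar component; real quaternions are central, so a
unit a rotates that part to itself and never mixes it into the others. -/
theorem coord_rotate_congr {a : ℍ[ℝ]} (ha : a ∈ unitary ℍ[ℝ]) (A : Matrix (Fin m) (Fin m) ℍ[ℝ])
    {f f' : Pair ℝ m} (h : coord f = coord f') : coord (rotate a A f) = coord (rotate a A f') := by
  have h2 : f.2 = f'.2 := funext fun r => Quaternion.ext _ _ (congrFun h (Sum.inr (r, 0)))
    (congrFun h (Sum.inr (r, 1))) (congrFun h (Sum.inr (r, 2))) (congrFun h (Sum.inr (r, 3)))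
  have h1 : f.1 = f'.1 + ((f.1.re - f'.1.re : ℝ) : ℍ[ℝ]) := Quaternion.ext _ _ (by simp)
    ((congrFun h (Sum.inl 0)).trans (by simp [coord]))
    ((congrFun h (Sum.inl 1)).trans (by simp [coord]))
    ((congrFun h (Sum.inl 2)).trans (by simp [coord]))
  have h3 : (rotate a A f).1 = (rotate a A f').1 + ((f.1.re - f'.1.re : ℝ) : ℍ[ℝ]) := by
    simp only [rotate]
    nth_rewrite 1 [h1]
    rw [mul_add, add_mul, ← Quaternion.coe_commutes (f.1.re - f'.1.re) a, mul_assoc _ a,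
      (Unitary.mem_iff.1 ha).2, mul_one]
  funext v
  rcases v with i | ⟨r, i⟩
  · simp only [coord, h3]
    fin_cases i <;> simp
  · simp only [coord, rotate, h2]

theorem coord_evalPair_iterate (j : ℕ → Pair ℝ m) (k : ℕ) :
    coord (pairMap (evalHom j) ((dPair (Dx m))^[k] (uJet m))) = coord (j k) := by
  funext v
  rw [← evalHom_compJ, compJ_iterate, compJ_uJet, Dx_iterate_X, evalHom, MvPolynomial.aeval_X,
    zero_add]

theorem qMap_evalHom_constQ (j : ℕ → Pair ℝ m) (a : ℍ[ℝ]) : qMap (evalHom j) (constQ a) = a := by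
  refine Quaternion.ext _ _ ?_ ?_ ?_ ?_ <;> simp [Algebra.ofId_apply]

theorem pairMap_evalHom_jetRot (j : ℕ → Pair ℝ m) (a : ℍ[ℝ]) (A : Matrix (Fin m) (Fin m) ℍ[ℝ])
    (f : Pair (Jet m) m) :
    pairMap (evalHom j) (jetRot a A f) = rotate a A (pairMap (evalHom j) f) := by
  rw [pairMap_rotate, qMap_evalHom_constQ]
  congr 1
  exact Matrix.ext fun r s => qMap_evalHom_constQ j _

theorem evalHom_rotate {a : ℍ[ℝ]} (ha : a ∈ unitary ℍ[ℝ]) (A : Matrix (Fin m) (Fin m) ℍ[ℝ])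
    (j : ℕ → Pair ℝ m) :
    evalHom (fun k => rotate a A (j k)) = (evalHom j).comp (jetHom (jetRot a A (uJet m))) := by
  refine MvPolynomial.algHom_ext fun b => ?_
  have hiter : ∀ k, (dPair (Dx m))^[k] (jetRot a A (uJet m))
      = jetRot a A ((dPair (Dx m))^[k] (uJet m)) := fun k => by
    induction k with
    | zero => rfl
    | succ k ih =>
      rw [Function.iterate_succ_apply', Function.iterate_succ_apply', ih,
        jetRot, dPair_rotate (G := A.map constQ) (dQ_constQ a) fun r s => dQ_constQ _]
  rw [AlgHom.comp_apply, jetHom_X, ← compJ_iterate, evalHom_compJ, hiter, pairMap_evalHom_jetRot,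
    evalHom, MvPolynomial.aeval_X]
  exact (congrFun (coord_rotate_congr ha A (coord_evalPair_iterate j b.2)) b.1).symm

theorem evalPair_rotate {a : ℍ[ℝ]} (ha : a ∈ unitary ℍ[ℝ]) {A : Matrix (Fin m) (Fin m) ℍ[ℝ]}
    {F : Pair (Jet m) m} (hF : pairMap (jetHom (jetRot a A (uJet m))) F = jetRot a A F)
    (j : ℕ → Pair ℝ m) :
    evalPair (fun k => rotate a A (j k)) F = rotate a A (evalPair j F) := by
  rw [evalPair_eq, evalPair_eq, evalHom_rotate ha, ← pairMap_evalHom_jetRot, ← hF]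
  rfl

/-- The rotation by unitary constants as a continuous linear equivalence. -/
def rotateCLE {a : ℍ[ℝ]} (ha : a ∈ unitary ℍ[ℝ]) {A : Matrix (Fin m) (Fin m) ℍ[ℝ]}
    (hA : A ∈ unitary (Matrix (Fin m) (Fin m) ℍ[ℝ])) : Pair ℝ m ≃L[ℝ] Pair ℝ m :=
  LinearEquiv.toContinuousLinearEquiv
    { toFun := rotate a A
      invFun := rotate (star a) (star A)
      map_add' := rotate_add a A
      map_smul' := rotate_smul a A
      left_inv := fun f => by
        rw [rotate_rotate, (Unitary.mem_iff.1 ha).1, (Unitary.mem_iff.1 hA).2, rotate_one]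
      right_inv := fun f => by
        rw [rotate_rotate, (Unitary.mem_iff.1 ha).2, (Unitary.mem_iff.1 hA).1, rotate_one] }

/-- As L is invertible, no differentiability is needed: both sides take the default value together.
-/
theorem deriv_continuousLinearEquiv_comp {E : Type*} [NormedAddCommGroup E] [NormedSpace ℝ E]
    (L : E ≃L[ℝ] E) (f : ℝ → E) (x : ℝ) : deriv (fun y => L (f y)) x = L (deriv f x) := by
  have := L.comp_fderiv (f := f) (x := x)
  rw [← fderiv_apply_one_eq_deriv, ← fderiv_apply_one_eq_deriv]
  exact congrArg (fun T => T 1) this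

theorem iteratedDeriv_continuousLinearEquiv_comp {E : Type*} [NormedAddCommGroup E]
    [NormedSpace ℝ E] (L : E ≃L[ℝ] E) (f : ℝ → E) (k : ℕ) (x : ℝ) :
    iteratedDeriv k (fun y => L (f y)) x = L (iteratedDeriv k f x) := by
  induction k generalizing x with
  | zero => simp
  | succ k ih =>
    rw [iteratedDeriv_succ, iteratedDeriv_succ, ← deriv_continuousLinearEquiv_comp]
    congr 1
    exact funext ih

theorem IsSolution.rotate {a : ℍ[ℝ]} (ha : a ∈ unitary ℍ[ℝ]) {A : Matrix (Fin m) (Fin m) ℍ[ℝ]}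
    (hA : A ∈ unitary (Matrix (Fin m) (Fin m) ℍ[ℝ])) {F : Pair (Jet m) m}
    (hF : pairMap (jetHom (jetRot a A (uJet m))) F = jetRot a A F) {Ω : Set (ℝ × ℝ)}
    {u : ℝ → ℝ → Pair ℝ m} (h : IsSolution F Ω u) :
    IsSolution F Ω (fun t x => HPnFlow.rotate a A (u t x)) := by
  refine ⟨(rotateCLE ha hA).contDiff.comp_contDiffOn h.1, fun t x hx => ⟨?_, ?_⟩⟩
  · rw [rotate_re (Unitary.mem_iff.1 ha).1, (h.2 t x hx).1]
  · have h1 : ∀ k, iteratedDeriv k (fun y => HPnFlow.rotate a A (u t y)) x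
        = HPnFlow.rotate a A (iteratedDeriv k (fun y => u t y) x) := fun k =>
      iteratedDeriv_continuousLinearEquiv_comp (rotateCLE ha hA) _ k x
    simp only [h1]
    rw [evalPair_rotate ha hF, ← (h.2 t x hx).2]
    exact deriv_continuousLinearEquiv_comp (rotateCLE ha hA) (fun s => u s x) t

theorem isInvariantFlow_of_pairMap {F : Pair (Jet m) m}
    (hF : ∀ a ∈ unitary ℍ[ℝ], ∀ A ∈ unitary (Matrix (Fin m) (Fin m) ℍ[ℝ]),
      pairMap (jetHom (jetRot a A (uJet m))) F = jetRot a A F) : IsInvariantFlow F := by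
  intro a ha A hA
  have hact : act a A = rotate a A := funext (act_eq_rotate ha A)
  rw [hact]
  refine ⟨fun j _ => evalPair_rotate ha (hF a ha A hA) j, fun Ω u _ => ⟨fun h => ?_,
    fun h => h.rotate ha hA (hF a ha A hA)⟩⟩
  -- The converse is the direct statement for the inverse rotation.
  have h' := h.rotate (Unitary.star_mem ha) (Unitary.star_mem hA)
    (hF _ (Unitary.star_mem ha) _ (Unitary.star_mem hA))
  simpa only [rotate_rotate, (Unitary.mem_iff.1 ha).1, (Unitary.mem_iff.1 hA).2,
    rotate_one] using h'

theorem isInvariantFlow_hier (c : ℝ) (l l' : ℕ) :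
    IsInvariantFlow (hierU m l + c • hierU m l') :=
  isInvariantFlow_of_pairMap fun a ha A hA => by
    rw [pairMap_add, pairMap_smul, pairMap_jetRot_hierU ha hA, pairMap_jetRot_hierU ha hA,
      jetRot, jetRot, jetRot, rotate_add, rotate_smul]

end Substitution

end HPnFlow
end

noncomputable section

namespace HPnFlow

/-! ## The scalar-vector mKdV system -/

section Mkdv

variable {B : Type} [CommRing B] [Algebra ℝ B] {m : ℕ}

theorem dQ_herm (D : Derivation ℝ B B) (x y : Pair B m) :
    dQ D (herm x.2 y.2) = herm (dPair D x).2 y.2 + herm x.2 (dPair D y).2 := by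
  simp [herm, dQ_sum, dQ_mul, dQ_star, dPair, Finset.sum_add_distrib]

/-- It equals its own conjugate, and 2 is invertible. -/
theorem herm_self (x : Fin m → ℍ[B]) : herm x x = ((herm x x).re : ℍ[B]) := by
  have h := star_herm x x
  nth_rewrite 2 [← h] at h
  have h1 : star (herm x x) = herm x x := star_herm x x
  have h2 := congrArg (fun q : ℍ[B] => q.imI) h1
  have h3 := congrArg (fun q : ℍ[B] => q.imJ) h1
  have h4 := congrArg (fun q : ℍ[B] => q.imK) h1
  have key : ∀ a : B, -a = a → a = 0 := fun a ha => by
    linear_combination (norm := algebra) (-(1 / 2 : ℝ)) • ha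
  exact Quaternion.ext _ _ (by simp) (by simpa using key _ h2) (by simpa using key _ h3)
    (by simpa using key _ h4)

theorem herm_add_right (x y z : Fin m → ℍ[B]) : herm x (y + z) = herm x y + herm x z := by
  simp [herm, mul_add, Finset.sum_add_distrib]

theorem herm_smul_right (c : ℝ) (x y : Fin m → ℍ[B]) : herm x (c • y) = c • herm x y := by
  simp [herm, Finset.smul_sum]

theorem herm_bsmul_right (c : B) (x y : Fin m → ℍ[B]) : herm x (c • y) = c • herm x y := by
  simp [herm, Finset.smul_sum]

theorem herm_mul_right (c : ℍ[B]) (x y : Fin m → ℍ[B]) :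
    herm x (fun r => c * y r) = herm x y * star c := by
  simp [herm, Finset.sum_mul, mul_assoc]

/-- The potential `-½ u² + ½ |𝐮|²`. -/
def mkdvQ (U : Pair B m) : B := (-(1 / 2 : ℝ) • U.1 ^ 2 + (1 / 2 : ℝ) • herm U.2 U.2).re

/-- The scalar nonlocal variable `D⁻¹ (½ C(𝐮, 𝐰) - C(u, w))` for `w = 𝓙 (u_x, 𝐮_x)`. -/
def mkdvP (D : Derivation ℝ B B) (U : Pair B m) : ℍ[B] :=
  (1 / 2 : ℝ) • comV U.2 (dPair D U).2 - (1 / 4 : ℝ) • comS U.1 (dPair D U).1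
    - (1 / 2 : ℝ) • (herm U.2 U.2 * U.1)

/-- The matrix nonlocal variable `D⁻¹ 𝐂(𝐮, 𝐰)` for `w = 𝓙 (u_x, 𝐮_x)`. -/
def mkdvBlock (D : Derivation ℝ B B) (U : Pair B m) : Matrix (Fin m) (Fin m) ℍ[B] :=
  Matrix.of fun r s => star (U.2 r) * (dPair D U).2 s - star ((dPair D U).2 r) * U.2 s
    + star (U.2 r) * U.1 * U.2 s

theorem herm_valJ (D : Derivation ℝ B B) (U h : Pair B m) (q : B) :
    herm U.2 (valJ D U h q).2 = herm U.2 (dPair D h).2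
      + (1 / 2 : ℝ) • (herm U.2 U.2 * star h.1) + herm U.2 h.2 * star U.1
      + q • herm U.2 U.2 := by
  have : (valJ D U h q).2 = (dPair D h).2 + (1 / 2 : ℝ) • (fun r => h.1 * U.2 r)
    + (fun r => U.1 * h.2 r) + q • U.2 := rfl
  rw [this, herm_add_right, herm_add_right, herm_add_right, herm_smul_right, herm_bsmul_right,
    herm_mul_right, herm_mul_right]

theorem D_herm_self (D : Derivation ℝ B B) (U : Pair B m) :
    D (herm U.2 U.2).re = (2 : ℝ) • (herm U.2 (dPair D U).2).re := by
  have h := congrArg (fun q : ℍ[B] => q.re) (dQ_herm D U U)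
  rw [← star_herm U.2 (dPair D U).2] at h
  simp only [dQ_re, Quaternion.re_add, Quaternion.re_star] at h
  rw [h, two_smul]

theorem D_mkdvQ (D : Derivation ℝ B B) {U : Pair B m} (hu : U.1.re = 0) :
    D (mkdvQ U) = rePair U (dPair D U) := by
  have h := D_herm_self D U
  simp only [mkdvQ, rePair, Quaternion.re_add, Quaternion.re_smul, map_add, Derivation.map_smul, h,
    pow_two]
  simp [hu, dPair]
  algebra

theorem dQ_mkdvP (D : Derivation ℝ B B) {U : Pair B m} (hu : U.1.re = 0) :
    dQ D (mkdvP D U) = -(comS U.1 (valJ D U (dPair D U) (mkdvQ U)).1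
      - (1 / 2 : ℝ) • comV U.2 (valJ D U (dPair D U) (mkdvQ U)).2) := by
  have h1 : (dPair D U).1.re = 0 := by simp [dPair, hu]
  have h2 : (dPair D (dPair D U)).1.re = 0 := by simp [dPair, hu]
  have e1 : ∀ f : Pair B m, dQ D f.1 = (dPair D f).1 := fun _ => rfl
  have eT := herm_self (dPair D U).2
  have eN := herm_self U.2
  rw [comV, ← star_herm U.2 (valJ D U (dPair D U) (mkdvQ U)).2, herm_valJ]
  simp only [mkdvP, valJ, mkdvQ, comV, comS, dQ_sub, dQ_smul, dQ_mul, dQ_herm, e1]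
  rw [← star_herm U.2 (dPair D U).2, ← star_herm U.2 (dPair D (dPair D U)).2, eT, eN]
  -- Once the Hermitian products are atoms, with the self-products replaced by their real parts, a
  -- polynomial identity in quaternion components remains. The same device closes the next
  -- computations.
  generalize herm U.2 (dPair D U).2 = S
  generalize herm U.2 (dPair D (dPair D U)).2 = S2
  generalize (dPair D (dPair D U)).1 = u2 at *
  generalize (dPair D U).1 = u1 at *
  generalize U.1 = u at *
  ext <;> simp [hu, h1, h2, pow_two] <;> algebra

theorem dQ_mkdvBlock (D : Derivation ℝ B B) {U : Pair B m} (hu : U.1.re = 0) (r s : Fin m) :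
    dQ D (mkdvBlock D U r s) = comM U.2 (valJ D U (dPair D U) (mkdvQ U)).2 r s := by
  have e1 : ∀ f : Pair B m, dQ D f.1 = (dPair D f).1 := fun _ => rfl
  have e2 : ∀ (f : Pair B m) r, dQ D (f.2 r) = (dPair D f).2 r := fun _ _ => rfl
  have hu1 : star (dPair D U).1 = -(dPair D U).1 := star_eq_neg_of_re (by simp [dPair, hu])
  simp only [mkdvBlock, comM, valJ, Matrix.of_apply, dQ_add, dQ_sub, dQ_mul, dQ_star, e1, e2,
    star_add, Quaternion.star_smul, star_mul, star_eq_neg_of_re hu, hu1, mul_add, add_mul,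
    mul_smul_comm, smul_mul_assoc, mul_neg, neg_mul, mul_assoc, smul_neg]
  generalize mkdvQ U • (star (U.2 r) * U.2 s) = z
  module

theorem mkdvBlock_conjTranspose (D : Derivation ℝ B B) {U : Pair B m} (hu : U.1.re = 0) :
    (mkdvBlock D U)ᴴ = -mkdvBlock D U := by
  refine Matrix.ext fun r s => ?_
  simp only [Matrix.conjTranspose_apply, Matrix.neg_apply, mkdvBlock, Matrix.of_apply, star_add,
    star_sub, star_mul, star_star, star_eq_neg_of_re hu]
  noncomm_ring

theorem sum_mul_mkdvBlock (D : Derivation ℝ B B) (U : Pair B m) (r : Fin m) :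
    ∑ s, U.2 s * mkdvBlock D U s r = herm U.2 U.2 * (dPair D U).2 r
      - herm U.2 (dPair D U).2 * U.2 r + herm U.2 U.2 * U.1 * U.2 r := by
  simp only [mkdvBlock, Matrix.of_apply, herm, Finset.sum_mul, mul_add, mul_sub,
    Finset.sum_add_distrib, Finset.sum_sub_distrib, mul_assoc]

/-- The right-hand side of the scalar-vector mKdV system in a differential algebra. -/
def mkdvField (D : Derivation ℝ B B) (U : Pair B m) : Pair B m :=
  let U₁ := dPair D U
  let U₂ := dPair D U₁
  let U₃ := dPair D U₂
  ((1 / 4 : ℝ) • U₃.1 - (3 / 2 : ℝ) • (U.1 ^ 2 * U₁.1)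
      + (3 / 4 : ℝ) • comS U.1 (comV U.2 U₁.2) + (3 / 4 : ℝ) • comV U.2 U₂.2,
    fun r => U₃.2 r + (3 / 2 : ℝ) • ((herm U.2 U.2 - U.1 ^ 2 + U₁.1) * U₁.2 r)
      + (3 / 4 : ℝ) • (((2 : ℝ) • (U.1 * herm U.2 U.2) - antiS U.1 U₁.1 + U₂.1
          - comV U.2 U₁.2) * U.2 r))

theorem mkdvField_fst (D : Derivation ℝ B B) {U : Pair B m} (hu : U.1.re = 0) :
    (mkdvField D U).1 = dQ D (valJ D U (dPair D U) (mkdvQ U)).1 + comS U.1 (mkdvP D U)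
      + (1 / 2 : ℝ) • comV U.2 (valJ D U (dPair D U) (mkdvQ U)).2 := by
  have h1 : (dPair D U).1.re = 0 := by simp [dPair, hu]
  have h3 : (dPair D (dPair D (dPair D U))).1.re = 0 := by simp [dPair, hu]
  have e1 : ∀ f : Pair B m, dQ D f.1 = (dPair D f).1 := fun _ => rfl
  have eT := herm_self (dPair D U).2
  have eN := herm_self U.2
  have eD : D (mkdvQ U) = _ := D_mkdvQ D hu
  rw [comV, ← star_herm U.2 (valJ D U (dPair D U) (mkdvQ U)).2, herm_valJ]
  simp only [mkdvField, mkdvP, valJ, comV, comS, dQ_add, dQ_sub, dQ_smul, dQ_bsmul, dQ_herm, e1, eD,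
    rePair]
  rw [mkdvQ, ← star_herm U.2 (dPair D U).2, ← star_herm U.2 (dPair D (dPair D U)).2, eT, eN]
  generalize herm U.2 (dPair D U).2 = S
  generalize herm U.2 (dPair D (dPair D U)).2 = S2
  generalize (dPair D (dPair D (dPair D U))).1 = u3 at *
  generalize (dPair D (dPair D U)).1 = u2 at *
  generalize (dPair D U).1 = u1 at *
  generalize U.1 = u at *
  ext <;> simp [hu, h1, h3, pow_two] <;> algebra

theorem mkdvField_snd (D : Derivation ℝ B B) {U : Pair B m} (hu : U.1.re = 0) (r : Fin m) :
    (mkdvField D U).2 r = dQ D ((valJ D U (dPair D U) (mkdvQ U)).2 r) - mkdvP D U * U.2 r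
      + ∑ s, U.2 s * mkdvBlock D U s r + (valJ D U (dPair D U) (mkdvQ U)).1 * U.2 r
      - U.1 * (valJ D U (dPair D U) (mkdvQ U)).2 r := by
  have h1 : (dPair D U).1.re = 0 := by simp [dPair, hu]
  have h2 : (dPair D (dPair D U)).1.re = 0 := by simp [dPair, hu]
  have e1 : ∀ f : Pair B m, dQ D f.1 = (dPair D f).1 := fun _ => rfl
  have e2 : ∀ (f : Pair B m) r, dQ D (f.2 r) = (dPair D f).2 r := fun _ _ => rfl
  have eN := herm_self U.2
  have eD : D (mkdvQ U) = _ := D_mkdvQ D hu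
  rw [sum_mul_mkdvBlock]
  simp only [mkdvField, mkdvP, valJ, comV, comS, antiS, dQ_add, dQ_smul, dQ_mul, dQ_bsmul, e1, e2,
    eD, rePair]
  rw [mkdvQ, ← star_herm U.2 (dPair D U).2, eN]
  generalize herm U.2 (dPair D U).2 = S
  generalize (dPair D (dPair D (dPair D U))).2 r = x3 at *
  generalize (dPair D (dPair D U)).2 r = x2 at *
  generalize (dPair D U).2 r = x1 at *
  generalize U.2 r = x at *
  generalize (dPair D (dPair D U)).1 = u2 at *
  generalize (dPair D U).1 = u1 at *
  generalize U.1 = u at *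
  ext <;> simp [hu, h1, h2, pow_two] <;> algebra

theorem mkdvP_re (D : Derivation ℝ B B) {U : Pair B m} (hu : U.1.re = 0) : (mkdvP D U).re = 0 := by
  rw [mkdvP, herm_self U.2, Quaternion.coe_mul_eq_smul]
  simp [comV_re, comS_re, hu]

/-- One step of the recursion with explicit antiderivatives q, p and P. -/
theorem isR_mkdvField {D : Derivation ℝ B B} {N : Submodule ℝ B} {U : Pair B m} (hu : U.1.re = 0)
    (hQ : mkdvQ U ∈ N) (hP : QIn N (mkdvP D U)) (hM : ∀ r s, QIn N (mkdvBlock D U r s)) :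
    IsR D N U (dPair D U) (mkdvField D U) := by
  have h1 : (dPair D U).1.re = 0 := by simp [dPair, hu]
  exact ⟨_, isJ_iff.2 ⟨h1, _, hQ, (D_mkdvQ D hu).trans (rePair_eq h1), rfl⟩, valJ_re hu h1, _, _,
    mkdvP_re D hu, hP, dQ_mkdvP D hu, mkdvBlock_conjTranspose D hu, hM, dQ_mkdvBlock D hu,
    mkdvField_fst D hu, mkdvField_snd D hu⟩

end Mkdv

end HPnFlow
end

noncomputable section

namespace HPnFlow

/-! ### The density of the mKdV Hamiltonian -/

section MkdvHamiltonian

variable {B : Type} [CommRing B] [Algebra ℝ B] {m : ℕ}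

/-- The density `⅛ u_x² - ½ |𝐮_x|² - ⅛ A(u, C(𝐮, 𝐮_x)) + ⅛ (u² - |𝐮|²)²` in a differential
algebra. -/
def mkdvDensity (D : Derivation ℝ B B) (U : Pair B m) : ℍ[B] :=
  (1 / 8 : ℝ) • (dPair D U).1 ^ 2 - (1 / 2 : ℝ) • herm (dPair D U).2 (dPair D U).2
    - (1 / 8 : ℝ) • antiS U.1 (comV U.2 (dPair D U).2)
    + (1 / 8 : ℝ) • (U.1 ^ 2 - herm U.2 U.2) ^ 2

/-- A density whose total derivative relates `mkdvDensity` to `Re (⟨u, h⟩ + ⟨𝐮, 𝐡⟩)`. -/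
def mkdvCorrection (D : Derivation ℝ B B) (U : Pair B m) : ℍ[B] :=
  herm U.2 (dPair D U).2 - (1 / 4 : ℝ) • (U.1 * (dPair D U).1)

theorem herm_mkdvField (D : Derivation ℝ B B) (U : Pair B m) :
    herm U.2 (mkdvField D U).2 = herm U.2 (dPair D (dPair D (dPair D U))).2
      + (3 / 2 : ℝ) • (herm U.2 (dPair D U).2
        * star (herm U.2 U.2 - U.1 ^ 2 + (dPair D U).1))
      + (3 / 4 : ℝ) • (herm U.2 U.2 * star ((2 : ℝ) • (U.1 * herm U.2 U.2)
        - antiS U.1 (dPair D U).1 + (dPair D (dPair D U)).1 - comV U.2 (dPair D U).2)) := by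
  rw [← herm_mul_right, ← herm_mul_right, ← herm_smul_right, ← herm_smul_right, ← herm_add_right,
    ← herm_add_right]
  rfl

/-- The factor 3 is 1 + 2l at l = 1; the correction is what the canonical density differs by, a
total derivative. -/
theorem D_mkdvDensity (D : Derivation ℝ B B) {U : Pair B m} (hu : U.1.re = 0) :
    D ((3 : ℝ) • (mkdvDensity D U).re + D (mkdvCorrection D U).re)
      = rePair U (mkdvField D U) := by
  have h1 : (dPair D U).1.re = 0 := by simp [dPair, hu]
  have h2 : (dPair D (dPair D U)).1.re = 0 := by simp [dPair, hu]
  have h3 : (dPair D (dPair D (dPair D U))).1.re = 0 := by simp [dPair, hu]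
  have e1 : ∀ f : Pair B m, dQ D f.1 = (dPair D f).1 := fun _ => rfl
  have eN := herm_self U.2
  have eT := herm_self (dPair D U).2
  rw [map_add, Derivation.map_smul, ← dQ_re, ← dQ_re, ← dQ_re, rePair, herm_mkdvField, mkdvField,
    mkdvDensity, mkdvCorrection]
  simp only [pow_two, antiS, comS, comV, dQ_add, dQ_sub, dQ_smul, dQ_mul, dQ_herm, e1]
  rw [← star_herm U.2 (dPair D U).2, ← star_herm U.2 (dPair D (dPair D U)).2,
    ← star_herm (dPair D U).2 (dPair D (dPair D U)).2, eN, eT]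
  generalize herm U.2 (dPair D U).2 = S
  generalize herm U.2 (dPair D (dPair D U)).2 = S2
  generalize herm U.2 (dPair D (dPair D (dPair D U))).2 = S3
  generalize herm (dPair D U).2 (dPair D (dPair D U)).2 = V
  generalize (dPair D (dPair D (dPair D U))).1 = u3 at *
  generalize (dPair D (dPair D U)).1 = u2 at *
  generalize (dPair D U).1 = u1 at *
  generalize U.1 = u at *
  simp [hu, h1, h2, h3]
  algebra

end MkdvHamiltonian

/-! ### Identification with the first members of the hierarchy -/

section MkdvJet

variable {m : ℕ}

theorem qMap_herm {B B' : Type} [CommRing B] [CommRing B'] [Algebra ℝ B] [Algebra ℝ B']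
    (φ : B →ₐ[ℝ] B') (x y : Fin m → ℍ[B]) :
    qMap φ (herm x y) = herm (fun r => qMap φ (x r)) (fun r => qMap φ (y r)) := by
  simp [herm, qMap_star]

/-- The constant term of a differential polynomial, as a homomorphism of algebras. -/
def constHom (m : ℕ) : Jet m →ₐ[ℝ] ℝ := MvPolynomial.aeval fun _ => 0

theorem constHom_apply (f : Jet m) : constHom m f = MvPolynomial.constantCoeff f := by
  rw [constHom, MvPolynomial.aeval_zero']; rfl

theorem qIn_noConst_iff {q : ℍ[Jet m]} : QIn (noConst m) q ↔ qMap (constHom m) q = 0 := by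
  simp only [QIn, mem_noConst, ← constHom_apply, Quaternion.ext_iff, qMap_re, qMap_imI, qMap_imJ,
    qMap_imK, Quaternion.re_zero, Quaternion.imI_zero, Quaternion.imJ_zero, Quaternion.imK_zero]

theorem qMap_constHom_dQ (q : ℍ[Jet m]) : qMap (constHom m) (dQ (Dx m) q) = 0 :=
  qIn_noConst_iff.1 ⟨Dx_mem_noConst _, Dx_mem_noConst _, Dx_mem_noConst _, Dx_mem_noConst _⟩

theorem qMap_constHom_uJet_fst : qMap (constHom m) (uJet m).1 = 0 := by
  refine Quaternion.ext _ _ ?_ ?_ ?_ ?_ <;> simp [constHom]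

theorem qMap_constHom_uJet_snd (r : Fin m) : qMap (constHom m) ((uJet m).2 r) = 0 := by
  refine Quaternion.ext _ _ ?_ ?_ ?_ ?_ <;> simp [constHom]

theorem mkdvQ_mem : mkdvQ (uJet m) ∈ noConst m := by
  refine (qIn_noConst_iff.2 ?_).1
  rw [map_add, qMap_smul, qMap_smul, map_pow, qMap_herm, qMap_constHom_uJet_fst]
  simp [qMap_constHom_uJet_snd, herm]

theorem mkdvDensity_mem : (mkdvDensity (Dx m) (uJet m)).re ∈ noConst m := by
  refine (qIn_noConst_iff.2 ?_).1
  simp only [mkdvDensity, dPair, antiS, comV, map_add, map_sub, map_mul, map_pow, qMap_smul,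
    qMap_herm, qMap_constHom_uJet_fst, qMap_constHom_uJet_snd, qMap_constHom_dQ]
  simp [herm]

theorem mkdvP_mem : QIn (noConst m) (mkdvP (Dx m) (uJet m)) := by
  refine qIn_noConst_iff.2 ?_
  simp only [mkdvP, dPair, comS, comV, map_sub, map_mul, qMap_smul,
    qMap_herm, qMap_constHom_uJet_fst, qMap_constHom_uJet_snd, qMap_constHom_dQ]
  simp [herm]

theorem mkdvBlock_mem (r s : Fin m) : QIn (noConst m) (mkdvBlock (Dx m) (uJet m) r s) := by
  refine qIn_noConst_iff.2 ?_
  simp [mkdvBlock, dPair, qMap_constHom_uJet_fst, qMap_constHom_uJet_snd, qMap_constHom_dQ]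

/-- The explicit antiderivatives have no constant term, so they are the ones used by the recursion.
-/
theorem hierU_one : hierU m 1 = mkdvRHS m := by
  have h := (isHierarchy_hierU m).2 0
  rw [hierU_zero] at h
  exact JetR.unique h (isR_mkdvField (uJet_fst_re m) mkdvQ_mem mkdvP_mem mkdvBlock_mem)

theorem hierH_zero : hierH m 0 = mkdvH0 m := by
  have h : hierQ m 0 = mkdvH0 m := Dx_injOn_noConst (hierQ_mem m 0) mkdvQ_mem
    (by rw [Dx_hierQ, hierU_zero]; exact (D_mkdvQ (Dx m) (uJet_fst_re m)).symm)
  simp [hierH, h]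

theorem hierH_one : hierH m 1 = mkdvH1 m
    + Dx m ((1 / 3 : ℝ) • (mkdvCorrection (Dx m) (uJet m)).re) := by
  have h : hierQ m 1 = (3 : ℝ) • (mkdvDensity (Dx m) (uJet m)).re
      + Dx m (mkdvCorrection (Dx m) (uJet m)).re :=
    Dx_injOn_noConst (hierQ_mem m 1)
      (add_mem (Submodule.smul_mem _ _ mkdvDensity_mem) (Dx_mem_noConst _))
      (by rw [Dx_hierQ, hierU_one]; exact (D_mkdvDensity (Dx m) (uJet_fst_re m)).symm)
  rw [hierH, h, Derivation.map_smul, smul_add, smul_smul]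
  norm_num
  rfl

theorem euler_add (v : Comp m) (f g : Jet m) : euler v (f + g) = euler v f + euler v g := by
  rw [euler, euler, euler,
    ← finsum_add_distrib (euler_support_finite v f) (euler_support_finite v g)]
  refine finsum_congr fun k => ?_
  rw [map_add, ← smul_add]
  congr 1
  exact iterate_map_add (Dx m) k _ _

theorem covec_add_Dx (f g : Jet m) : covec (f + Dx m g) = covec f := by
  have h : ∀ v, euler v (f + Dx m g) = euler v f := fun v => by rw [euler_add, euler_Dx, add_zero]
  exact Prod.ext (congrArg (fun q => - -q) (Quaternion.ext _ _ rfl (h _) (h _) (h _)))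
    (funext fun r => Quaternion.ext _ _ (h _) (h _) (h _) (h _))

theorem jetH_mkdv : JetH (covec (mkdvH1 m)) (mkdvRHS m) := by
  rw [← covec_add_Dx (mkdvH1 m), ← hierH_one, covec_hierH, ← hierU_one]
  exact jetH_hier m 1

theorem jetE_mkdv : JetE (covec (mkdvH0 m)) (mkdvRHS m) := by
  rw [← hierH_zero, covec_hierH, ← hierU_one]
  exact jetE_hier m 0

end MkdvJet

end HPnFlow
end

/-! ### The main theorem -/

theorem mainTheorem3 (n : ℕ) (hn : 1 ≤ n) :
    HPnFlow.IsHamiltonianPair (HPnFlow.opH (n - 1)) (HPnFlow.opE (n - 1)) ∧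
    ∃ (h : ℕ → HPnFlow.Pair (HPnFlow.Jet (n - 1)) (n - 1)) (H : ℕ → HPnFlow.Jet (n - 1)),
      (HPnFlow.IsHierarchy h ∧ ∀ h', HPnFlow.IsHierarchy h' → h' = h) ∧
      (∀ l, HPnFlow.IsHamDensity l (h l) (H l)) ∧
      (∀ l, 1 ≤ l → ∀ F, HPnFlow.IsFlow (HPnFlow.chi n) (h (l - 1)) F ↔
        F = h l + (HPnFlow.chi n)⁻¹ • h (l - 1)) ∧
      (∀ l, HPnFlow.JetH (HPnFlow.covec (H l)) (h l)) ∧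
      (∀ l, 1 ≤ l → HPnFlow.JetE (HPnFlow.covec (H (l - 1))) (h l)) ∧
      (∀ l, 1 ≤ l →
        HPnFlow.IsInvariantFlow (h l + (HPnFlow.chi n)⁻¹ • h (l - 1))) ∧
      h 1 = HPnFlow.mkdvRHS (n - 1) ∧
      H 0 = HPnFlow.mkdvH0 (n - 1) ∧
      (∃ g, H 1 = HPnFlow.mkdvH1 (n - 1) + HPnFlow.Dx (n - 1) g) ∧
      HPnFlow.JetH (HPnFlow.covec (HPnFlow.mkdvH1 (n - 1))) (HPnFlow.mkdvRHS (n - 1)) ∧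
      HPnFlow.JetE (HPnFlow.covec (HPnFlow.mkdvH0 (n - 1))) (HPnFlow.mkdvRHS (n - 1)) := by
  refine ⟨HPnFlow.isHamiltonianPair_opH_opE _, HPnFlow.hierU _, HPnFlow.hierH _,
    ⟨HPnFlow.isHierarchy_hierU _, fun _ h => h.eq_hierU⟩, HPnFlow.isHamDensity_hier _, ?_,
    fun l => ?_, ?_, fun l _ => HPnFlow.isInvariantFlow_hier _ _ _, HPnFlow.hierU_one,
    HPnFlow.hierH_zero, ⟨_, HPnFlow.hierH_one⟩, HPnFlow.jetH_mkdv, HPnFlow.jetE_mkdv⟩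
  · rintro (_ | l) hl F
    · exact absurd hl (by decide)
    · exact HPnFlow.isFlow_iff _ l F
  · rw [HPnFlow.covec_hierH]
    exact HPnFlow.jetH_hier _ l
  · rintro (_ | l) hl
    · exact absurd hl (by decide)
    · rw [Nat.add_sub_cancel, HPnFlow.covec_hierH]
      exact HPnFlow.jetE_hier _ l
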